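/- A measured weighted graph (mwg) $G=(V,w,m)$ consists of a countable set $V$, a symmetric $w:V\times V\to[0,\infty)$ vanishing on the diagonal, and $m:V\to(0,\infty)$; $G$ is assumed connected and locally finite (each $x$ has finitely many $y$ with $w(x,y)>0$), and $L^p(V)$ is taken with respect to $m$. Put $\Delta f(x)=\sum_y \frac{w(x,y)}{m(x)}(f(y)-f(x))$, $\Gamma(f,g)=\frac12(\Delta(fg)-f\Delta g-g\Delta f)$, $\Gamma_2(f,g)=\frac12(\Delta\Gamma(f,g)-\Gamma(f,\Delta g)-\Gamma(g,\Delta f))$. For $\rho:V\to\mathbb R$ and $n\in(0,\infty]$, $CD(\rho,n)$ means $\Gamma_2(f,f)\ge\rho\,\Gamma(f,f)+\frac1n(\Delta f)^2$ pointwise for all bounded $f:V\to\mathbb R$; for $\kappa>0$, $G$ is $(\kappa,n,\rho)$-spectrally positive if $CD(\rho,n)$ holds and $\frac12\langle -\Delta f,f\rangle+\langle\rho f,f\rangle\ge\kappa\langle f,f\rangle$ for all finitely supported $f$, where $\langle f,g\rangle=\sum_x m(x)f(x)g(x)$. Let $Q$ be the Dirichlet form $Q(f,g)=\frac12\sum_{x,y}w(x,y)(f(x)-f(y))(g(x)-g(y))$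 whose domain $D(Q)$ is the closure of the finitely supported functions in the norm $(Q(f,f)+\|f\|_2^2)^{1/2}$, let $L$ be the associated non-negative self-adjoint operator on $L^2(V)$ (so $L=-\Delta$ on its domain), and for $W:V\to\mathbb R$ let $L+W$ be the operator associated with the form sum $Q+W$ on $D(Q)\cap L^2(V,|W|m)$. When $-(L+W)$ generates a strongly continuous semigroup on $L^2(V)$, that semigroup is written $P_t^W=e^{-t(L+W)}$; it acts on functions in the other $L^p(V)$ by $P_t^Wf(x)=\sum_y (P_t^W1_y)(x)f(y)$. Put $P_t=P_t^0$. For $T>0$ and $W\ge0$ let $$k_T(W)=\sup_{j\in\mathbb N}\int_0^T\|P_t(j\wedge W)\|_\infty\,dt\in[0,\infty],$$ and write $x_-=-\min\{0,x\}$. **Lemma.** Let $G$ be a finite or infinite mwg, $K,T>0$, $n\in(0,\infty]$, $\rho:V\to\mathbb R$, and assume $CD(\rho,n)$. (1) If $k_T((\rho-K)_-)\le\frac12\left(1-e^{-KT/4}\right)$, then $G$ is $(K/2,n,\rho)$-spectrally positive. Further, $-(L+\rho)$ generates a strongly continuous semigroup $P_t^\rho$ on $L^2(V)$, the operator $P_t^\rho$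 maps $L^p(V)$ boundedly to $L^p(V)$ for all $t>0$ and all $p\in[1,\infty]$, and $$\|P_t^\rho\|_{\infty,\infty}\le e^{K(T-t)/2},\qquad t>0.$$ (2) If $k_T((\rho-K)_-)\le\frac14\left(1-e^{-KT/2}\right)$, then $-(L+2\rho)$ generates a strongly continuous semigroup $P_t^{2\rho}$ on $L^2(V)$, and $$\|P_t^{2\rho}\|_{\infty,\infty}\le e^{K(T-t)},\qquad t>0.$$ -/

import Mathlib

open MeasureTheory Filter Topology
open scoped ENNReal NNReal

noncomputable section

/-- A measured and weighted graph on the vertex set `V`: symmetric edge weights vanishing on the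
diagonal and a positive vertex measure; the graph is locally finite and connected. -/
structure MWG (V : Type*) where
  w : V → V → ℝ
  m : V → ℝ
  w_nonneg : ∀ x y, 0 ≤ w x y
  w_symm : ∀ x y, w x y = w y x
  w_diag : ∀ x, w x x = 0
  m_pos : ∀ x, 0 < m x
  locallyFinite : ∀ x, {y | 0 < w x y}.Finite
  connected : ∀ x y, Relation.ReflTransGen (fun a b => 0 < w a b) x y

namespace MWG

variable {V : Type*}

/-- The Laplacian `Δ f(x) = ∑_y (w(x,y) / m(x)) (f(y) - f(x))` (a finite sum, by local
finiteness). -/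
def lap (G : MWG V) (f : V → ℝ) (x : V) : ℝ :=
  ∑' y, G.w x y / G.m x * (f y - f x)

/-- The carré du champ `Γ(f,g) = (Δ(fg) - f Δg - g Δf) / 2`. -/
def Gam (G : MWG V) (f g : V → ℝ) (x : V) : ℝ :=
  1 / 2 * (G.lap (fun z => f z * g z) x - f x * G.lap g x - g x * G.lap f x)

/-- The iterated form `Γ₂(f,g) = (Δ Γ(f,g) - Γ(f,Δg) - Γ(g,Δf)) / 2`. -/
def Gam2 (G : MWG V) (f g : V → ℝ) (x : V) : ℝ :=
  1 / 2 * (G.lap (G.Gam f g) x - G.Gam f (G.lap g) x - G.Gam g (G.lap f) x)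

/-- The variable curvature dimension condition `CD(ρ,n)`, for `n ∈ (0,∞]` (with `1/∞ = 0`). -/
def CD (G : MWG V) (ρ : V → ℝ) (n : ℝ≥0∞) : Prop :=
  ∀ f : V → ℝ, (∃ C : ℝ, ∀ x, |f x| ≤ C) →
    ∀ x, ρ x * G.Gam f f x + (n⁻¹).toReal * (G.lap f x) ^ 2 ≤ G.Gam2 f f x

/-- The inner product `⟨f,g⟩ = ∑_x m(x) f(x) g(x)`. -/
def ip (G : MWG V) (f g : V → ℝ) : ℝ :=
  ∑' x, G.m x * (f x * g x)

/-- `(K,n,ρ)`-spectrally positive Ricci curvature: `CD(ρ,n)` holds and `L/2 + ρ ≥ K` in quadratic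
form sense on finitely supported functions, where `L = -Δ`. -/
def SpectrallyPositive (G : MWG V) (K : ℝ) (n : ℝ≥0∞) (ρ : V → ℝ) : Prop :=
  G.CD ρ n ∧
    ∀ f : V → ℝ, f.support.Finite →
      K * G.ip f f ≤ 1 / 2 * G.ip (fun x => -G.lap f x) f + G.ip (fun x => ρ x * f x) f

/-- The energy `½ ∑_{x,y} w(x,y) (f(x) - f(y))²` as an extended nonnegative number. -/
def energy (G : MWG V) (f : V → ℝ) : ℝ≥0∞ :=
  2⁻¹ * ∑' p : V × V, ENNReal.ofReal (G.w p.1 p.2 * (f p.1 - f p.2) ^ 2)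

/-- The bilinear form `Q(f,g) = ½ ∑_{x,y} w(x,y) (f(x) - f(y)) (g(x) - g(y))`, which is `⟨Lf,g⟩`
on finitely supported functions; the sum converges absolutely on functions of finite energy. -/
def Q (G : MWG V) (f g : V → ℝ) : ℝ :=
  1 / 2 * ∑' p : V × V, G.w p.1 p.2 * ((f p.1 - f p.2) * (g p.1 - g p.2))

variable [MeasurableSpace V]

/-- The measure on `V` with point masses `m(x)`; `L^p(V)` is the `L^p` space of this measure. -/
def vol (G : MWG V) : Measure V :=
  Measure.sum fun x => ENNReal.ofReal (G.m x) • Measure.dirac x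

/-- The domain of the (regular) Dirichlet form `Q`: the closure of the finitely supported functions
in the form norm `(Q(f,f) + ‖f‖₂²)^(1/2)`. -/
def formDom (G : MWG V) : Set (V → ℝ) :=
  {f | MemLp f 2 G.vol ∧ ∀ ε : ℝ≥0∞, 0 < ε → ∃ φ : V → ℝ, φ.support.Finite ∧
    G.energy (fun x => f x - φ x) + (eLpNorm (fun x => f x - φ x) 2 G.vol) ^ 2 < ε}

/-- The domain of the form sum `Q + W`: the functions in the domain of `Q` that are square integrable
with respect to `|W| m`. -/
def formDomPot (G : MWG V) (W : V → ℝ) : Set (V → ℝ) :=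
  {f | f ∈ G.formDom ∧ Summable fun x => G.m x * (|W x| * (f x) ^ 2)}

/-- The graph of the operator `L + W` in `L²(V)` associated with the form sum `Q + W`: `u` lies in
the operator domain and `(L + W) u = g`. For `W = 0` this is `L` itself, `L u = -Δ u`. -/
def IsSchrodinger (G : MWG V) (W : V → ℝ) (u g : Lp ℝ 2 G.vol) : Prop :=
  (u : V → ℝ) ∈ G.formDomPot W ∧
    ∀ v ∈ G.formDomPot W, G.Q u v + G.ip (fun x => W x * u x) v = G.ip g v

/-- `S` (restricted to `t ≥ 0`) is a strongly continuous semigroup of bounded operators on `L²(V)`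
with generator exactly `-(L + W)`; it is then the unique one, i.e. `S t = e^{-t(L+W)}`. -/
structure Generates (G : MWG V) (W : V → ℝ)
    (S : ℝ → Lp ℝ 2 G.vol →L[ℝ] Lp ℝ 2 G.vol) : Prop where
  zero : S 0 = ContinuousLinearMap.id ℝ _
  add : ∀ s t, 0 ≤ s → 0 ≤ t → S (s + t) = (S s).comp (S t)
  cont : ∀ f, ContinuousOn (fun t => S t f) (Set.Ici 0)
  gen : ∀ f g, G.IsSchrodinger W f g ↔
    Tendsto (fun t : ℝ => t⁻¹ • (S t f - f)) (𝓝[>] 0) (𝓝 (-g))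

open Classical in
/-- The semigroup `P_t^W = e^{-t(L+W)}` on `L²(V)` (zero if `L + W` does not generate a strongly
continuous semigroup). -/
def semigroup (G : MWG V) (W : V → ℝ) : ℝ → Lp ℝ 2 G.vol →L[ℝ] Lp ℝ 2 G.vol :=
  if h : ∃ S, G.Generates W S then h.choose else fun _ => 0

theorem vol_singleton_ne_top [DiscreteMeasurableSpace V] (G : MWG V) (x : V) :
    G.vol {x} ≠ ∞ := by
  classical
  have h : G.vol {x} = ENNReal.ofReal (G.m x) := by
    rw [vol, Measure.sum_apply _ (MeasurableSet.of_discrete), tsum_eq_single x]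
    · simp
    · intro y hy
      simp [hy]
  rw [h]
  exact ENNReal.ofReal_ne_top

variable [DiscreteMeasurableSpace V]

/-- The kernel `(x,y) ↦ (P_t^W 1_y)(x)` of `P_t^W`. -/
def kernel (G : MWG V) (W : V → ℝ) (t : ℝ) (x y : V) : ℝ :=
  (G.semigroup W t
    (indicatorConstLp 2 (MeasurableSet.of_discrete (s := {y})) (G.vol_singleton_ne_top y)
      (1 : ℝ)) : V → ℝ) x

/-- The action of `P_t^W` on functions, `(P_t^W f)(x) = ∑_y (P_t^W 1_y)(x) f(y)`. On `L²(V)` this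
is the operator `P_t^W` itself, since `f = ∑_y f(y) 1_y` in `L²(V)`; it is the usual extension of
`P_t^W` to the other `L^p(V)`, including `p = ∞`. -/
def act (G : MWG V) (W : V → ℝ) (t : ℝ) (f : V → ℝ) (x : V) : ℝ :=
  ∑' y, G.kernel W t x y * f y

/-- `P_t^W` maps `L^p(V)` to `L^p(V)` (the defining sums converging absolutely) with
`‖P_t^W‖_{p,p} ≤ C`. -/
def OpNormLE (G : MWG V) (W : V → ℝ) (t : ℝ) (p : ℝ≥0∞) (C : ℝ) : Prop :=
  0 ≤ C ∧ ∀ f : V → ℝ, MemLp f p G.vol →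
    (∀ x, Summable fun y => G.kernel W t x y * f y) ∧
    eLpNorm (G.act W t f) p G.vol ≤ ENNReal.ofReal C * eLpNorm f p G.vol

/-- The Kato constant `k_T(W) = sup_n ∫_0^T ‖P_t (n ∧ W)‖_∞ dt` of `W ≥ 0`, where `P_t = e^{-tL}`
is the heat semigroup. -/
def kato (G : MWG V) (T : ℝ) (W : V → ℝ) : ℝ≥0∞ :=
  ⨆ n : ℕ, ∫⁻ t in Set.Ioc 0 T, eLpNorm (G.act 0 t (fun x => min (n : ℝ) (W x))) ∞ G.vol

end MWG

end

open MeasureTheory Filter Topology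
open scoped ENNReal NNReal

noncomputable section

set_option linter.unusedSectionVars false

namespace MWG

section

variable {V : Type*} (G : MWG V)

/-! ### The `L²` model -/

/-! The proof rests on positive supersolutions over finite sets. On a finite `F` the Dirichlet flow
of `Δ - U` is a matrix exponential. It preserves positivity because the off-diagonal entries are
nonnegative, and Duhamel's formula turns this into the comparison principle
`nonneg_of_supersolution`. The Dirichlet kernels increase with `F`; a lower bound for `Q + U` bounds
them in `L²` uniformly in `F`, so they converge to a minimal kernel.

If the time integral of the heat flow of `W` is at most `κ` up to time `T`, then `g_t = 1 + b ∫₀ᵗ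
P_s W ds` with `b = θ / (1 - θκ)` lies between `1` and `1 / (1 - θκ)` and satisfies `∂ₜ g ≥ Δ g + θ
W g` on `F`. For `θ = 1` and `U ≥ a - W`, comparison bounds the flow of the constant `1` by
`exp(-at) / (1 - κ)` up to time `T`, and blocks of length `T` are then iterated
(`KatoBound.heat_one_le_pow`). For general `θ`, the integral of `exp(-ωt) g_t` over `[0,T]` is a
positive supersolution of `L - θW + ω`, and Picone's inequality converts it into the form bound `θW
≤ Q + ω` (`KatoBound.form_le`). The case `θ = 2` gives both the spectral inequality and the
coercivity of `Q + U`.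

Coercivity links the minimal kernel to the abstract semigroup. Time integrals of the flow are limits
of finitely supported solutions with bounded form norm, so they lie in the operator domain and solve
the weak equation. Hence the minimal semigroup is generated by the form sum (`Coercive.generates`),
and uniqueness identifies it with `semigroup` (`Coercive.unique`, `Coercive.kernel_eq`). Symmetry
and the row sum bound then give all `L^p` bounds through `schur_test`. -/

theorem summable_mul_of_sq {f g : V → ℝ} (hf : Summable fun x => G.m x * f x ^ 2)
    (hg : Summable fun x => G.m x * g x ^ 2) : Summable fun x => G.m x * (f x * g x) := by
  refine Summable.of_norm_bounded (hf.add hg) fun x => ?_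
  rw [Real.norm_eq_abs, abs_mul, abs_of_pos (G.m_pos x), ← mul_add]
  refine mul_le_mul_of_nonneg_left ?_ (G.m_pos x).le
  rw [abs_le]
  constructor <;> nlinarith [sq_nonneg (f x + g x), sq_nonneg (f x - g x)]

section LTwo

variable [Countable V] [MeasurableSpace V] [DiscreteMeasurableSpace V]

theorem vol_singleton (x : V) : G.vol {x} = ENNReal.ofReal (G.m x) := by
  classical
  rw [vol, Measure.sum_apply _ (MeasurableSet.of_discrete), tsum_eq_single x]
  · simp
  · intro y hy
    simp [hy]

theorem vol_real_singleton (x : V) : G.vol.real {x} = G.m x := by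
  rw [Measure.real, vol_singleton, ENNReal.toReal_ofReal (G.m_pos x).le]

/-- Every vertex has positive mass, so the only null set is empty. Elements of `L²` may therefore be
treated as honest functions throughout. -/
theorem ae_vol_iff {p : V → Prop} : (∀ᵐ x ∂G.vol, p x) ↔ ∀ x, p x := by
  refine ⟨fun h x => ?_, fun h => Eventually.of_forall h⟩
  by_contra hx
  have h1 : G.vol {x} ≤ 0 := by
    rw [← (ae_iff.1 h)]
    exact measure_mono (by simpa using hx)
  rw [vol_singleton] at h1
  have := ENNReal.ofReal_pos.2 (G.m_pos x)
  exact absurd h1 (not_le.2 this)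

theorem ae_eq_vol_iff {α : Type*} {f g : V → α} : f =ᵐ[G.vol] g ↔ f = g := by
  rw [Filter.EventuallyEq, ae_vol_iff, funext_iff]

theorem lintegral_vol (f : V → ℝ≥0∞) :
    ∫⁻ x, f x ∂G.vol = ∑' x, ENNReal.ofReal (G.m x) * f x := by
  rw [vol, lintegral_sum_measure]
  congr 1
  ext x
  rw [lintegral_smul_measure, lintegral_dirac, smul_eq_mul]

theorem aestronglyMeasurable_vol (f : V → ℝ) : AEStronglyMeasurable f G.vol :=
  (measurable_of_countable f).aestronglyMeasurable

theorem eLpNorm_two_sq (f : V → ℝ) :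
    eLpNorm f 2 G.vol ^ 2 = ∑' x, ENNReal.ofReal (G.m x * f x ^ 2) := by
  rw [eLpNorm_eq_lintegral_rpow_enorm_toReal (by norm_num) (by norm_num), ← ENNReal.rpow_natCast,
    ← ENNReal.rpow_mul, lintegral_vol]
  norm_num
  congr 1
  ext x
  rw [ENNReal.ofReal_mul (G.m_pos x).le, ← sq_abs (f x), ENNReal.ofReal_pow (abs_nonneg _),
    Real.enorm_eq_ofReal_abs]

theorem memLp_two_iff (f : V → ℝ) : MemLp f 2 G.vol ↔ Summable fun x => G.m x * f x ^ 2 := by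
  have h0 : ∀ x, 0 ≤ G.m x * f x ^ 2 := fun x => mul_nonneg (G.m_pos x).le (sq_nonneg _)
  rw [MemLp, and_iff_right (G.aestronglyMeasurable_vol f)]
  have h1 : eLpNorm f 2 G.vol < ∞ ↔ eLpNorm f 2 G.vol ^ 2 ≠ ∞ := by
    rw [lt_top_iff_ne_top]
    simp
  rw [h1, eLpNorm_two_sq]
  constructor
  · intro h
    have := ENNReal.summable_toReal h
    simpa [ENNReal.toReal_ofReal (h0 _)] using this
  · intro h
    exact h.tsum_ofReal_ne_top

theorem summable_sq_Lp (f : Lp ℝ 2 G.vol) : Summable fun x => G.m x * f x ^ 2 :=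
  (G.memLp_two_iff f).1 (Lp.memLp f)

theorem inner_Lp (f g : Lp ℝ 2 G.vol) : inner ℝ f g = G.ip f g := by
  rw [L2.inner_def, ip]
  rw [integral_countable (L2.integrable_inner f g)]
  congr 1
  ext x
  rw [vol_real_singleton]
  simp [mul_comm]

theorem norm_sq_Lp (f : Lp ℝ 2 G.vol) : ‖f‖ ^ 2 = ∑' x, G.m x * f x ^ 2 := by
  rw [← real_inner_self_eq_norm_sq, inner_Lp, ip]
  simp_rw [sq]

theorem coe_toLp {f : V → ℝ} (hf : MemLp f 2 G.vol) : (hf.toLp f : V → ℝ) = f :=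
  G.ae_eq_vol_iff.1 hf.coeFn_toLp

theorem coe_add_Lp (f g : Lp ℝ 2 G.vol) : ((f + g : Lp ℝ 2 G.vol) : V → ℝ) = f + g :=
  G.ae_eq_vol_iff.1 (Lp.coeFn_add f g)

theorem coe_sub_Lp (f g : Lp ℝ 2 G.vol) : ((f - g : Lp ℝ 2 G.vol) : V → ℝ) = f - g :=
  G.ae_eq_vol_iff.1 (Lp.coeFn_sub f g)

theorem coe_smul_Lp (c : ℝ) (f : Lp ℝ 2 G.vol) : ((c • f : Lp ℝ 2 G.vol) : V → ℝ) = c • ⇑f :=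
  G.ae_eq_vol_iff.1 (Lp.coeFn_smul c f)

theorem Lp_ext {f g : Lp ℝ 2 G.vol} (h : ∀ x, f x = g x) : f = g :=
  Lp.ext (Eventually.of_forall h)

theorem sq_le_norm_Lp (f : Lp ℝ 2 G.vol) (x : V) : G.m x * f x ^ 2 ≤ ‖f‖ ^ 2 := by
  rw [norm_sq_Lp]
  exact (G.summable_sq_Lp f).le_tsum x fun y _ => mul_nonneg (G.m_pos y).le (sq_nonneg _)

theorem abs_le_norm_Lp (f : Lp ℝ 2 G.vol) (x : V) : |f x| ≤ ‖f‖ / √(G.m x) := by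
  rw [le_div_iff₀ (Real.sqrt_pos.2 (G.m_pos x))]
  refine abs_le_of_sq_le_sq' ?_ (norm_nonneg _) |>.2
  rw [mul_pow, Real.sq_sqrt (G.m_pos x).le, sq_abs, mul_comm]
  exact G.sq_le_norm_Lp f x

/-- Evaluation at a vertex, as a continuous functional on `L²`. -/
def evalLp (x : V) : Lp ℝ 2 G.vol →L[ℝ] ℝ :=
  LinearMap.mkContinuous
    { toFun := fun f => f x
      map_add' := fun f g => by rw [coe_add_Lp]; rfl
      map_smul' := fun c f => by rw [coe_smul_Lp]; rfl } (1 / √(G.m x)) fun f => by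
        simpa [div_eq_inv_mul] using G.abs_le_norm_Lp f x

theorem evalLp_apply (x : V) (f : Lp ℝ 2 G.vol) : G.evalLp x f = f x := rfl

/-- The indicator function of a vertex as an element of `L²`. -/
def delta (y : V) : Lp ℝ 2 G.vol :=
  indicatorConstLp 2 (MeasurableSet.of_discrete (s := {y})) (G.vol_singleton_ne_top y) (1 : ℝ)

theorem coe_delta (y : V) : (G.delta y : V → ℝ) = Set.indicator {y} fun _ => 1 :=
  G.ae_eq_vol_iff.1 indicatorConstLp_coeFn

theorem delta_apply_self (y : V) : G.delta y y = 1 := by simp [coe_delta]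

theorem delta_apply_ne {x y : V} (h : x ≠ y) : G.delta y x = 0 := by simp [coe_delta, h]

theorem inner_delta (f : Lp ℝ 2 G.vol) (y : V) : inner ℝ f (G.delta y) = G.m y * f y := by
  rw [inner_Lp, ip, tsum_eq_single y]
  · rw [delta_apply_self, mul_one]
  · intro x hx
    rw [delta_apply_ne G hx, mul_zero, mul_zero]

theorem coe_finsetSum_delta (f : V → ℝ) (s : Finset V) (x : V) [Decidable (x ∈ s)] :
    ((∑ y ∈ s, f y • G.delta y : Lp ℝ 2 G.vol) : V → ℝ) x = if x ∈ s then f x else 0 := by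
  classical
  rw [← evalLp_apply, map_sum]
  simp only [map_smul, evalLp_apply, smul_eq_mul]
  split_ifs with h
  · rw [Finset.sum_eq_single x]
    · rw [delta_apply_self, mul_one]
    · intro y _ hy
      rw [delta_apply_ne G hy.symm, mul_zero]
    · exact fun h' => absurd h h'
  · refine Finset.sum_eq_zero fun y hy => ?_
    rw [delta_apply_ne G (by rintro rfl; exact h hy), mul_zero]

/-- The squared error of a partial sum is the tail of the convergent series `∑ m f²`. Consequently a
bounded operator on `L²` is determined by its matrix entries, as `clm_ext` records. -/
theorem hasSum_delta (f : Lp ℝ 2 G.vol) : HasSum (fun y => f y • G.delta y) f := by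
  classical
  rw [HasSum, tendsto_iff_norm_sub_tendsto_zero]
  have h2 : Tendsto (fun s : Finset V => ‖∑ y ∈ s, f y • G.delta y - f‖ ^ 2) atTop (𝓝 0) := by
    have h3 : ∀ s : Finset V, ‖∑ y ∈ s, f y • G.delta y - f‖ ^ 2
        = ∑' x, G.m x * f x ^ 2 - ∑ x ∈ s, G.m x * f x ^ 2 := by
      intro s
      have h5 : HasSum (fun x => if x ∈ s then G.m x * f x ^ 2 else 0)
          (∑ x ∈ s, if x ∈ s then G.m x * f x ^ 2 else 0) :=
        hasSum_sum_of_ne_finset_zero fun x hx => by simp [hx]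
      rw [Finset.sum_congr rfl fun x hx => if_pos hx] at h5
      rw [norm_sq_Lp, ← ((G.summable_sq_Lp f).hasSum.sub h5).tsum_eq]
      congr 1
      ext x
      rw [coe_sub_Lp, Pi.sub_apply, coe_finsetSum_delta]
      split_ifs <;> ring
    simp_rw [h3]
    have h6 : Tendsto (fun s : Finset V => ∑ x ∈ s, G.m x * f x ^ 2) atTop
        (𝓝 (∑' x, G.m x * f x ^ 2)) := (G.summable_sq_Lp f).hasSum
    have h7 := h6.const_sub (∑' x, G.m x * f x ^ 2)
    rwa [sub_self] at h7
  have h4 := h2.sqrt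
  simpa [Real.sqrt_sq] using h4

theorem clm_apply_eq_tsum (S : Lp ℝ 2 G.vol →L[ℝ] Lp ℝ 2 G.vol) (f : Lp ℝ 2 G.vol) (x : V) :
    HasSum (fun y => S (G.delta y) x * f y) (S f x) := by
  have h := (G.hasSum_delta f).mapL ((G.evalLp x).comp S)
  simpa [evalLp_apply, coe_smul_Lp, mul_comm] using h

theorem clm_ext {S R : Lp ℝ 2 G.vol →L[ℝ] Lp ℝ 2 G.vol}
    (h : ∀ x y, S (G.delta y) x = R (G.delta y) x) : S = R := by
  ext1 f
  refine G.Lp_ext fun x => ?_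
  refine (G.clm_apply_eq_tsum S f x).unique ?_
  simp_rw [h]
  exact G.clm_apply_eq_tsum R f x

end LTwo

end

section

variable {V : Type*} (G : MWG V)

/-! ### The Laplacian -/

/-- The neighbours of a vertex. -/
def nbr (x : V) : Finset V := (G.locallyFinite x).toFinset

theorem w_eq_zero_of_notMem_nbr {x y : V} (h : y ∉ G.nbr x) : G.w x y = 0 := by
  have h1 : ¬ 0 < G.w x y := by simpa [nbr] using h
  exact le_antisymm (not_lt.1 h1) (G.w_nonneg x y)

theorem lap_eq_sum (f : V → ℝ) (x : V) :
    G.lap f x = ∑ y ∈ G.nbr x, G.w x y / G.m x * (f y - f x) :=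
  tsum_eq_sum fun y hy => by rw [G.w_eq_zero_of_notMem_nbr hy, zero_div, zero_mul]

theorem lap_add (f g : V → ℝ) (x : V) : G.lap (f + g) x = G.lap f x + G.lap g x := by
  simp only [lap_eq_sum, ← Finset.sum_add_distrib, Pi.add_apply]
  exact Finset.sum_congr rfl fun y _ => by ring

theorem lap_smul (c : ℝ) (f : V → ℝ) (x : V) : G.lap (c • f) x = c * G.lap f x := by
  simp only [lap_eq_sum, Finset.mul_sum, Pi.smul_apply, smul_eq_mul]
  exact Finset.sum_congr rfl fun y _ => by ring

theorem lap_sub (f g : V → ℝ) (x : V) : G.lap (f - g) x = G.lap f x - G.lap g x := by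
  simp only [lap_eq_sum, ← Finset.sum_sub_distrib, Pi.sub_apply]
  exact Finset.sum_congr rfl fun y _ => by ring

theorem lap_const (c : ℝ) (x : V) : G.lap (fun _ => c) x = 0 := by simp [lap]

/-- The elementary maximum principle: the values of the neighbours enter the Laplacian with
nonnegative weights. -/
theorem lap_le_lap {f g : V → ℝ} {x : V} (hx : f x = g x) (h : ∀ y, f y ≤ g y) :
    G.lap f x ≤ G.lap g x := by
  simp only [lap_eq_sum]
  refine Finset.sum_le_sum fun y _ => ?_
  exact mul_le_mul_of_nonneg_left (by linarith [h y]) (div_nonneg (G.w_nonneg x y) (G.m_pos x).le)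

/-- Local finiteness makes the Laplacian a finite sum at each vertex, so pointwise limits pass
through it with no domination. -/
theorem tendsto_lap {ι : Type*} {l : Filter ι} {f : ι → V → ℝ} {g : V → ℝ}
    (h : ∀ x, Tendsto (fun i => f i x) l (𝓝 (g x))) (x : V) :
    Tendsto (fun i => G.lap (f i) x) l (𝓝 (G.lap g x)) := by
  simp only [lap_eq_sum]
  exact tendsto_finsetSum _ fun y _ => ((h y).sub (h x)).const_mul _

/-! ### The heat equation on a finite set with Dirichlet boundary condition -/

open Classical in
/-- Extension by zero of a function on a finite set. -/
def extend (F : Finset V) (f : F → ℝ) (x : V) : ℝ := if h : x ∈ F then f ⟨x, h⟩ else 0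

theorem extend_mem {F : Finset V} (f : F → ℝ) {x : V} (h : x ∈ F) : extend F f x = f ⟨x, h⟩ :=
  dif_pos h

theorem extend_notMem {F : Finset V} (f : F → ℝ) {x : V} (h : x ∉ F) : extend F f x = 0 :=
  dif_neg h

theorem extend_add (F : Finset V) (f g : F → ℝ) : extend F (f + g) = extend F f + extend F g := by
  ext x
  by_cases h : x ∈ F
  · simp [extend_mem _ h]
  · simp [extend_notMem _ h]

theorem extend_smul (F : Finset V) (c : ℝ) (f : F → ℝ) : extend F (c • f) = c • extend F f := by
  ext x
  by_cases h : x ∈ F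
  · simp [extend_mem _ h]
  · simp [extend_notMem _ h]

theorem extend_nonneg {F : Finset V} {f : F → ℝ} (hf : 0 ≤ f) (x : V) : 0 ≤ extend F f x := by
  by_cases h : x ∈ F
  · rw [extend_mem _ h]
    exact hf _
  · rw [extend_notMem _ h]

/-- The operator `Δ - U` on a finite set with Dirichlet boundary condition. -/
def dirGen (U : V → ℝ) (F : Finset V) : (F → ℝ) →L[ℝ] (F → ℝ) :=
  LinearMap.toContinuousLinearMap
    { toFun := fun f x => G.lap (extend F f) x - U x * f x
      map_add' := fun f g => by
        ext x
        simp only [extend_add, lap_add, Pi.add_apply]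
        ring
      map_smul' := fun c f => by
        ext x
        simp only [extend_smul, lap_smul, Pi.smul_apply, smul_eq_mul, RingHom.id_apply]
        ring }

theorem dirGen_apply (U : V → ℝ) (F : Finset V) (f : F → ℝ) (x : F) :
    G.dirGen U F f x = G.lap (extend F f) x - U x * f x := rfl

theorem exp_add_of_commute_pi {F : Finset V} {A B : (F → ℝ) →L[ℝ] (F → ℝ)} (h : Commute A B) :
    NormedSpace.exp (A + B) = NormedSpace.exp A * NormedSpace.exp B := by
  -- The addition law for `NormedSpace.exp` is stated over a `ℚ`-algebra; the structure is supplied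
  -- only locally.
  let := NormedAlgebra.restrictScalars ℚ ℝ ((F → ℝ) →L[ℝ] (F → ℝ))
  exact NormedSpace.exp_add_of_commute h

/-- Adding a large multiple `c` of the identity makes all matrix entries nonnegative, so the
exponential series of `B` has nonnegative terms. The shift commutes with everything and costs only
the positive factor `exp(-tc)`. -/
theorem exp_dirGen_nonneg (U : V → ℝ) (F : Finset V) {t : ℝ} (ht : 0 ≤ t) {f : F → ℝ}
    (hf : 0 ≤ f) : 0 ≤ NormedSpace.exp (t • G.dirGen U F) f := by
  -- The sum of the absolute diagonal entries dominates each of them; unlike a maximum it needs no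
  -- nonemptiness of `F`.
  set c : ℝ := ∑ x ∈ F, |∑ y ∈ G.nbr x, G.w x y / G.m x + U x| with hc
  set B := G.dirGen U F + c • (1 : (F → ℝ) →L[ℝ] (F → ℝ)) with hB
  have hBpos : ∀ g : F → ℝ, 0 ≤ g → 0 ≤ B g := by
    intro g hg x
    have h1 : B g x = ∑ y ∈ G.nbr x, G.w x y / G.m x * extend F g y
        + (c - (∑ y ∈ G.nbr x, G.w x y / G.m x + U x)) * g x := by
      simp only [hB, add_apply, smul_apply,
        one_apply_eq_self, Pi.add_apply, Pi.smul_apply, smul_eq_mul, dirGen_apply,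
        lap_eq_sum, mul_sub, Finset.sum_sub_distrib, ← Finset.sum_mul, extend_mem _ x.2]
      ring
    have h2 : |∑ y ∈ G.nbr x, G.w x y / G.m x + U x| ≤ c :=
      Finset.single_le_sum (f := fun x => |∑ y ∈ G.nbr x, G.w x y / G.m x + U x|)
        (fun _ _ => abs_nonneg _) x.2
    rw [Pi.zero_apply, h1]
    refine add_nonneg (Finset.sum_nonneg fun y _ => ?_) (mul_nonneg ?_ (hg x))
    · exact mul_nonneg (div_nonneg (G.w_nonneg _ _) (G.m_pos _).le) (extend_nonneg hg y)
    · linarith [le_abs_self (∑ y ∈ G.nbr x, G.w x y / G.m x + U x)]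
  have hpow : ∀ n : ℕ, 0 ≤ (B ^ n) f := by
    intro n
    induction n with
    | zero => simpa using hf
    | succ n ih =>
      rw [pow_succ']
      exact hBpos _ ih
  have hexpB : 0 ≤ NormedSpace.exp (t • B) f := by
    have h := NormedSpace.exp_series_hasSum_exp' (𝕂 := ℝ) (t • B)
    have h2 := h.mapL (ContinuousLinearMap.apply ℝ (F → ℝ) f)
    refine h2.nonneg fun n => ?_
    simp only [ContinuousLinearMap.apply_apply, smul_apply, smul_pow]
    refine smul_nonneg (by positivity) (smul_nonneg (by positivity) (hpow n))
  have hsplit : t • G.dirGen U F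
      = algebraMap ℝ ((F → ℝ) →L[ℝ] (F → ℝ)) (-(t * c)) + t • B := by
    rw [Algebra.algebraMap_eq_smul_one, hB, smul_add, smul_smul]
    module
  rw [hsplit, exp_add_of_commute_pi (Algebra.commute_algebraMap_left _ _),
    ← NormedSpace.algebraMap_exp_comm, Algebra.algebraMap_eq_smul_one, ← Real.exp_eq_exp_ℝ]
  simp only [smul_mul_assoc, one_mul, smul_apply]
  exact smul_nonneg (Real.exp_pos _).le hexpB

/-- **Parabolic comparison principle** on a finite set. -/
theorem nonneg_of_supersolution {U : V → ℝ} {F : Finset V} {T : ℝ} {v v' : ℝ → V → ℝ}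
    (hoff : ∀ t ∈ Set.Icc 0 T, ∀ x ∉ F, 0 ≤ v t x)
    (hd : ∀ t ∈ Set.Icc 0 T, ∀ x ∈ F, HasDerivAt (fun s => v s x) (v' t x) t)
    (hsup : ∀ t ∈ Set.Icc 0 T, ∀ x ∈ F, G.lap (v t) x - U x * v t x ≤ v' t x)
    (h0 : ∀ x ∈ F, 0 ≤ v 0 x) :
    ∀ t ∈ Set.Icc 0 T, ∀ x ∈ F, 0 ≤ v t x := by
  intro t ht x hx
  set B := G.dirGen U F
  set r : ℝ → F → ℝ := fun s y => v s y with hr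
  -- Duhamel interpolation: `q t = v t x`, while `q 0` is the Dirichlet flow of nonnegative data.
  -- The derivative is the positive operator `exp((t - s)B)` applied to `v' - B v`, so `q`
  -- increases.
  set q : ℝ → ℝ := fun s => NormedSpace.exp ((t - s) • B) (r s) ⟨x, hx⟩ with hq
  have hIcc : ∀ s ∈ Set.Icc 0 t, s ∈ Set.Icc 0 T := fun s hs => ⟨hs.1, hs.2.trans ht.2⟩
  have hderiv : ∀ s ∈ Set.Icc 0 t, HasDerivAt q
      (NormedSpace.exp ((t - s) • B) ((fun y : F => v' s y) - B (r s)) ⟨x, hx⟩) s := by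
    intro s hs
    have h1 : HasDerivAt r (fun y : F => v' s y) s :=
      hasDerivAt_pi.2 fun y => hd s (hIcc s hs) y y.2
    have h2 : HasDerivAt (fun s : ℝ => NormedSpace.exp ((t - s) • B))
        ((-1 : ℝ) • (NormedSpace.exp ((t - s) • B) * B)) s :=
      (hasDerivAt_exp_smul_const B (t - s)).scomp s ((hasDerivAt_id s).const_sub t)
    have h3 := (h2.clm_apply h1)
    have h4 := hasDerivAt_pi.1 h3 ⟨x, hx⟩
    refine h4.congr_deriv ?_
    simp [map_sub]
    ring
  have hmono : MonotoneOn q (Set.Icc 0 t) := by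
    refine monotoneOn_of_deriv_nonneg (convex_Icc 0 t)
      (fun s hs => (hderiv s hs).continuousAt.continuousWithinAt)
      (fun s hs => (hderiv s (interior_subset hs)).differentiableAt.differentiableWithinAt) ?_
    intro s hs
    have hs' := interior_subset hs
    rw [(hderiv s hs').deriv]
    refine G.exp_dirGen_nonneg U F (sub_nonneg.2 hs'.2) (fun y => ?_) _
    have h5 := hsup s (hIcc s hs') y y.2
    -- Since `v` is nonnegative off `F`, cutting it to zero there can only lower the Laplacian on
    -- `F`.
    have h6 : G.lap (extend F (r s)) y ≤ G.lap (v s) y := by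
      refine G.lap_le_lap (extend_mem _ y.2) fun z => ?_
      by_cases hz : z ∈ F
      · rw [extend_mem _ hz]
      · rw [extend_notMem _ hz]
        exact hoff s (hIcc s hs') z hz
    simp only [Pi.zero_apply, Pi.sub_apply]
    rw [dirGen_apply]
    simp only [hr] at h6 ⊢
    linarith
  have h7 := hmono (Set.left_mem_Icc.2 ht.1) (Set.right_mem_Icc.2 ht.1) ht.1
  have h8 : q t = v t x := by simp [hq, hr]
  have h9 : 0 ≤ q 0 := by
    simp only [hq, sub_zero]
    exact G.exp_dirGen_nonneg U F ht.1 (fun y => h0 y y.2) _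
  linarith

/-- The solution of `∂ₜ u = Δ u - U u` on `F` with `u = 0` off `F` and initial value `f` on `F`. -/
def heat (U : V → ℝ) (F : Finset V) (t : ℝ) (f : V → ℝ) : V → ℝ :=
  extend F (NormedSpace.exp (t • G.dirGen U F) fun y : F => f y)

variable {G} {U : V → ℝ} {F : Finset V}

theorem heat_notMem (t : ℝ) (f : V → ℝ) {x : V} (hx : x ∉ F) : G.heat U F t f x = 0 :=
  extend_notMem _ hx

theorem heat_zero (f : V → ℝ) {x : V} (hx : x ∈ F) : G.heat U F 0 f x = f x := by
  simp [heat, extend_mem _ hx]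

theorem hasDerivAt_heat (t : ℝ) (f : V → ℝ) {x : V} (hx : x ∈ F) :
    HasDerivAt (fun s => G.heat U F s f x)
      (G.lap (G.heat U F t f) x - U x * G.heat U F t f x) t := by
  have h1 := (hasDerivAt_exp_smul_const' (G.dirGen U F) t).clm_apply
    (hasDerivAt_const t fun y : F => f y)
  have h2 := hasDerivAt_pi.1 h1 ⟨x, hx⟩
  have h3 : (fun s => G.heat U F s f x)
      = fun s => NormedSpace.exp (s • G.dirGen U F) (fun y : F => f y) ⟨x, hx⟩ := by
    ext s
    rw [heat, extend_mem _ hx]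
  rw [h3]
  refine h2.congr_deriv ?_
  simp [dirGen_apply, heat, extend_mem _ hx]

theorem continuous_heat (f : V → ℝ) (x : V) : Continuous fun s => G.heat U F s f x := by
  by_cases hx : x ∈ F
  · exact continuous_iff_continuousAt.2 fun t => (hasDerivAt_heat t f hx).continuousAt
  · simp only [heat_notMem _ _ hx]
    exact continuous_const

theorem heat_add (t : ℝ) (f g : V → ℝ) :
    G.heat U F t (f + g) = G.heat U F t f + G.heat U F t g := by
  rw [heat, heat, heat, ← extend_add, ← map_add]
  rfl

theorem heat_smul (t c : ℝ) (f : V → ℝ) : G.heat U F t (c • f) = c • G.heat U F t f := by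
  rw [heat, heat, ← extend_smul, ← map_smul]
  rfl

theorem heat_congr (t : ℝ) {f g : V → ℝ} (h : ∀ x ∈ F, f x = g x) :
    G.heat U F t f = G.heat U F t g := by
  have : (fun y : F => f y) = fun y : F => g y := funext fun y => h y y.2
  rw [heat, heat, this]

theorem heat_comp (t s : ℝ) (f : V → ℝ) :
    G.heat U F (t + s) f = G.heat U F t (G.heat U F s f) := by
  have : (fun y : F => extend F (NormedSpace.exp (s • G.dirGen U F) fun y : F => f y) y)
      = NormedSpace.exp (s • G.dirGen U F) fun y : F => f y :=
    funext fun y => extend_mem _ y.2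
  rw [heat, heat, heat, this, add_smul, exp_add_of_commute_pi]
  · rfl
  · exact ((Commute.refl _).smul_left t).smul_right s

theorem heat_nonneg {t : ℝ} (ht : 0 ≤ t) {f : V → ℝ} (hf : ∀ x ∈ F, 0 ≤ f x) (x : V) :
    0 ≤ G.heat U F t f x :=
  extend_nonneg (G.exp_dirGen_nonneg U F ht fun y => hf y y.2) x

theorem heat_sub (t : ℝ) (f g : V → ℝ) :
    G.heat U F t (f - g) = G.heat U F t f - G.heat U F t g := by
  rw [sub_eq_add_neg, ← neg_one_smul ℝ g, heat_add, heat_smul, neg_one_smul, sub_eq_add_neg]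

theorem heat_le_heat {t : ℝ} (ht : 0 ≤ t) {f g : V → ℝ} (h : ∀ x ∈ F, f x ≤ g x) (x : V) :
    G.heat U F t f x ≤ G.heat U F t g x := by
  have := heat_nonneg (G := G) (U := U) ht (f := g - f) (fun x hx => sub_nonneg.2 (h x hx)) x
  rw [heat_sub] at this
  simpa using this

/-- Supersolutions dominate the Dirichlet solution. -/
theorem heat_le_of_supersolution {T : ℝ} {f : V → ℝ} {v v' : ℝ → V → ℝ}
    (hoff : ∀ t ∈ Set.Icc 0 T, ∀ x ∉ F, 0 ≤ v t x)
    (hd : ∀ t ∈ Set.Icc 0 T, ∀ x ∈ F, HasDerivAt (fun s => v s x) (v' t x) t)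
    (hsup : ∀ t ∈ Set.Icc 0 T, ∀ x ∈ F, G.lap (v t) x - U x * v t x ≤ v' t x)
    (h0 : ∀ x ∈ F, f x ≤ v 0 x) {t : ℝ} (ht : t ∈ Set.Icc 0 T) (x : V) :
    G.heat U F t f x ≤ v t x := by
  by_cases hx : x ∈ F
  · have := G.nonneg_of_supersolution (U := U) (F := F) (T := T)
      (v := fun s => v s - G.heat U F s f)
      (v' := fun s y => v' s y - (G.lap (G.heat U F s f) y - U y * G.heat U F s f y))
      (fun s hs y hy => by simpa [heat_notMem _ _ hy] using hoff s hs y hy)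
      (fun s hs y hy => (hd s hs y hy).sub (hasDerivAt_heat s f hy))
      (fun s hs y hy => by
        have := hsup s hs y hy
        simp only [lap_sub, Pi.sub_apply]
        linarith)
      (fun y hy => by simpa [heat_zero f hy] using h0 y hy) t ht x hx
    simpa using this
  · rw [heat_notMem _ _ hx]
    exact hoff t ht x hx

/-- The flow on the larger set solves the same equation on the smaller one and is nonnegative
outside it, hence is a supersolution there. -/
theorem heat_mono_set {F' : Finset V} (hF : F ⊆ F') {t : ℝ} (ht : 0 ≤ t) {f : V → ℝ}
    (hf : ∀ x ∈ F', 0 ≤ f x) (x : V) : G.heat U F t f x ≤ G.heat U F' t f x :=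
  heat_le_of_supersolution (T := t) (v := fun s => G.heat U F' s f)
    (v' := fun s y => G.lap (G.heat U F' s f) y - U y * G.heat U F' s f y)
    (fun s hs y _ => heat_nonneg hs.1 hf y)
    (fun s _ y hy => hasDerivAt_heat s f (hF hy)) (fun _ _ _ _ => le_rfl)
    (fun y hy => by rw [heat_zero f (hF hy)]) ⟨ht, le_rfl⟩ x

end

section

variable {V : Type*} (G : MWG V)

/-! ### Integration by parts -/

theorem ip_eq_sum {F : Finset V} (f : V → ℝ) {φ : V → ℝ} (hφ : ∀ x ∉ F, φ x = 0) :
    G.ip f φ = ∑ x ∈ F, G.m x * (f x * φ x) :=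
  tsum_eq_sum fun x hx => by rw [hφ x hx, mul_zero, mul_zero]

theorem Q_comm (f g : V → ℝ) : G.Q f g = G.Q g f := by
  rw [Q, Q]
  congr 2
  ext p
  ring

/-- Green's formula, with no condition on `f`: the summand splits into `h p` and its swap by
symmetry of `w`, and `h` vanishes off finitely many pairs because only vertices of `F` and their
neighbours contribute. -/
theorem Q_eq_sum {F : Finset V} (f : V → ℝ) {φ : V → ℝ} (hφ : ∀ x ∉ F, φ x = 0) :
    G.Q f φ = ∑ x ∈ F, G.m x * (-G.lap f x * φ x) := by
  classical
  set N : Finset V := F.biUnion G.nbr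
  set h : V × V → ℝ := fun p => G.w p.1 p.2 * ((f p.1 - f p.2) * φ p.1) with hh
  have h1 : HasSum h (∑ p ∈ F ×ˢ N, h p) := by
    refine hasSum_sum_of_ne_finset_zero fun p hp => ?_
    by_cases h1 : p.1 ∈ F
    · have h2 : p.2 ∉ G.nbr p.1 := fun h3 =>
        hp (Finset.mem_product.2 ⟨h1, Finset.mem_biUnion.2 ⟨_, h1, h3⟩⟩)
      rw [hh]
      simp only [G.w_eq_zero_of_notMem_nbr h2, zero_mul]
    · simp only [hh, hφ _ h1, mul_zero]
  have h2 : ∑ p ∈ F ×ˢ N, h p = ∑ x ∈ F, G.m x * (-G.lap f x * φ x) := by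
    rw [Finset.sum_product]
    refine Finset.sum_congr rfl fun x hx => ?_
    have hsub : G.nbr x ⊆ N := Finset.subset_biUnion_of_mem G.nbr hx
    rw [← Finset.sum_subset hsub, lap_eq_sum, ← Finset.sum_neg_distrib, Finset.sum_mul,
      Finset.mul_sum]
    · refine Finset.sum_congr rfl fun y _ => ?_
      have := (G.m_pos x).ne'
      simp only [hh]
      field_simp
      ring
    · intro y _ hy
      simp only [hh, G.w_eq_zero_of_notMem_nbr hy, zero_mul]
  have h3 : HasSum (fun p : V × V => h p.swap) (∑ p ∈ F ×ˢ N, h p) :=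
    (Equiv.prodComm V V).hasSum_iff.2 h1
  have h4 := (h1.add h3).tsum_eq
  rw [Q, ← h2]
  have h5 : ∀ p : V × V, G.w p.1 p.2 * ((f p.1 - f p.2) * (φ p.1 - φ p.2)) = h p + h p.swap := by
    intro p
    simp only [hh, Prod.fst_swap, Prod.snd_swap, G.w_symm p.2 p.1]
    ring
  simp_rw [h5, h4]
  ring

theorem notMem_support_toFinset {φ : V → ℝ} (h : φ.support.Finite) :
    ∀ x ∉ h.toFinset, φ x = 0 := fun x hx => by simpa using hx

/-- The form `Q + U`. -/
def schroForm (U : V → ℝ) (f g : V → ℝ) : ℝ := G.Q f g + G.ip (fun x => U x * f x) g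

theorem schroForm_comm (U f g : V → ℝ) : G.schroForm U f g = G.schroForm U g f := by
  rw [schroForm, schroForm, Q_comm, ip, ip]
  congr 2
  ext x
  ring

theorem schroForm_eq_sum {F : Finset V} (U f : V → ℝ) {φ : V → ℝ} (hφ : ∀ x ∉ F, φ x = 0) :
    G.schroForm U f φ = ∑ x ∈ F, G.m x * ((-G.lap f x + U x * f x) * φ x) := by
  rw [schroForm, G.Q_eq_sum f hφ, G.ip_eq_sum _ hφ, ← Finset.sum_add_distrib]
  exact Finset.sum_congr rfl fun x _ => by ring

theorem tendsto_schroForm {ι : Type*} {l : Filter ι} {f : ι → V → ℝ} {g : V → ℝ} (U : V → ℝ)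
    (h : ∀ x, Tendsto (fun i => f i x) l (𝓝 (g x))) {φ : V → ℝ} (hφ : φ.support.Finite) :
    Tendsto (fun i => G.schroForm U (f i) φ) l (𝓝 (G.schroForm U g φ)) := by
  simp only [G.schroForm_eq_sum U _ (notMem_support_toFinset hφ)]
  exact tendsto_finsetSum _ fun x _ =>
    ((((G.tendsto_lap h x).neg).add ((h x).const_mul _)).mul_const _).const_mul _

/-- The form `Q + U` is bounded below by `-l` on finitely supported functions. -/
def LowerBound (U : V → ℝ) (l : ℝ) : Prop :=
  ∀ φ : V → ℝ, φ.support.Finite → -(l * G.ip φ φ) ≤ G.schroForm U φ φ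

variable {G} {U : V → ℝ} {F : Finset V}

/-- The pairing of `P_s f` with `P_{t-s} g` is constant in `s` because the form is symmetric; the
identity compares the ends `s = t` and `s = 0`. -/
theorem heat_symm (t : ℝ) (f g : V → ℝ) :
    ∑ x ∈ F, G.m x * (G.heat U F t f x * g x) = ∑ x ∈ F, G.m x * (f x * G.heat U F t g x) := by
  set q : ℝ → ℝ := fun s =>
    ∑ x ∈ F, G.m x * (G.heat U F s f x * G.heat U F (t - s) g x) with hq
  have hd : ∀ s, HasDerivAt q 0 s := by
    intro s
    have h1 : HasDerivAt q (∑ x ∈ F, G.m x *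
        ((G.lap (G.heat U F s f) x - U x * G.heat U F s f x) * G.heat U F (t - s) g x +
          G.heat U F s f x * (-(G.lap (G.heat U F (t - s) g) x
            - U x * G.heat U F (t - s) g x)))) s := by
      refine HasDerivAt.fun_sum fun x hx => HasDerivAt.const_mul _ ?_
      refine (hasDerivAt_heat s f hx).mul ?_
      have := (hasDerivAt_heat (t - s) g hx (G := G) (U := U)).scomp s
        ((hasDerivAt_id s).const_sub t)
      simpa [Function.comp_def] using this
    refine h1.congr_deriv ?_
    have h2 := G.schroForm_comm U (G.heat U F s f) (G.heat U F (t - s) g)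
    rw [G.schroForm_eq_sum (F := F) U _ fun x hx => heat_notMem _ _ hx,
      G.schroForm_eq_sum (F := F) U _ fun x hx => heat_notMem _ _ hx] at h2
    rw [← sub_eq_zero, ← Finset.sum_sub_distrib] at h2
    rw [← neg_eq_zero, ← Finset.sum_neg_distrib, ← h2]
    exact Finset.sum_congr rfl fun x _ => by ring
  have h3 : q t = q 0 :=
    is_const_of_deriv_eq_zero (fun s => (hd s).differentiableAt) (fun s => (hd s).deriv) t 0
  have h4 : q t = ∑ x ∈ F, G.m x * (G.heat U F t f x * g x) :=
    Finset.sum_congr rfl fun x hx => by rw [sub_self, heat_zero g hx]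
  have h5 : q 0 = ∑ x ∈ F, G.m x * (f x * G.heat U F t g x) :=
    Finset.sum_congr rfl fun x hx => by rw [sub_zero, heat_zero f hx]
  rw [← h4, ← h5, h3]

/-- The energy estimate: the squared norm has derivative `-2 (Q + U)(u,u)`, at most `2l` times
itself, and Grönwall's argument applies. The constant does not depend on `F`, which is what allows
exhaustion. -/
theorem heat_sq_le {l : ℝ} (hl : G.LowerBound U l) {t : ℝ} (ht : 0 ≤ t) (f : V → ℝ) :
    ∑ x ∈ F, G.m x * G.heat U F t f x ^ 2
      ≤ Real.exp (2 * l * t) * ∑ x ∈ F, G.m x * f x ^ 2 := by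
  set N : ℝ → ℝ := fun s => ∑ x ∈ F, G.m x * G.heat U F s f x ^ 2 with hN
  have hd : ∀ s, HasDerivAt N (-2 * G.schroForm U (G.heat U F s f) (G.heat U F s f)) s := by
    intro s
    have h1 : HasDerivAt N (∑ x ∈ F, G.m x * (2 * G.heat U F s f x *
        (G.lap (G.heat U F s f) x - U x * G.heat U F s f x))) s := by
      refine HasDerivAt.fun_sum fun x hx => HasDerivAt.const_mul _ ?_
      simpa using (hasDerivAt_heat s f hx (G := G) (U := U)).fun_pow 2
    refine h1.congr_deriv ?_
    rw [G.schroForm_eq_sum (F := F) U _ fun x hx => heat_notMem _ _ hx, Finset.mul_sum]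
    exact Finset.sum_congr rfl fun x _ => by ring
  have hlow : ∀ s, -2 * G.schroForm U (G.heat U F s f) (G.heat U F s f) ≤ 2 * l * N s := by
    intro s
    have h1 := hl (G.heat U F s f) (F.finite_toSet.subset fun x hx => by
      by_contra h
      exact hx (heat_notMem _ _ h))
    rw [G.ip_eq_sum (F := F) _ fun x hx => heat_notMem _ _ hx] at h1
    simp only [hN, sq]
    linarith
  have hanti : AntitoneOn (fun s => Real.exp (-(2 * l * s)) * N s) (Set.Icc 0 t) := by
    have hd2 : ∀ s, HasDerivAt (fun s => Real.exp (-(2 * l * s)) * N s)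
        (Real.exp (-(2 * l * s)) * (-(2 * l)) * N s + Real.exp (-(2 * l * s)) *
          (-2 * G.schroForm U (G.heat U F s f) (G.heat U F s f))) s := by
      intro s
      refine HasDerivAt.mul (HasDerivAt.exp ?_) (hd s)
      simpa using ((hasDerivAt_id s).const_mul (2 * l)).fun_neg
    refine antitoneOn_of_deriv_nonpos (convex_Icc 0 t)
      (fun s _ => (hd2 s).continuousAt.continuousWithinAt)
      (fun s _ => (hd2 s).differentiableAt.differentiableWithinAt) fun s _ => ?_
    rw [(hd2 s).deriv]
    have := mul_le_mul_of_nonneg_left (hlow s) (Real.exp_pos (-(2 * l * s))).le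
    linarith
  have h1 := hanti (Set.left_mem_Icc.2 ht) (Set.right_mem_Icc.2 ht) ht
  simp only [mul_zero, neg_zero, Real.exp_zero, one_mul] at h1
  have h2 : N 0 = ∑ x ∈ F, G.m x * f x ^ 2 :=
    Finset.sum_congr rfl fun x hx => by rw [heat_zero f hx]
  rw [h2] at h1
  have h3 := mul_le_mul_of_nonneg_left h1 (Real.exp_pos (2 * l * t)).le
  rwa [← mul_assoc, ← Real.exp_add, add_neg_cancel, Real.exp_zero, one_mul] at h3

end

section

variable {V : Type*} (G : MWG V)

/-! ### The minimal heat kernel -/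

/-- The Dirichlet heat kernel of `Δ - U` on a finite set. -/
def dirKernel (U : V → ℝ) (F : Finset V) (t : ℝ) (x y : V) : ℝ :=
  G.heat U F t (Set.indicator {y} fun _ => 1) x

/-- The minimal heat kernel of `Δ - U`: the increasing limit of the Dirichlet kernels. -/
def minKernel (U : V → ℝ) (t : ℝ) (x y : V) : ℝ := ⨆ F : Finset V, G.dirKernel U F t x y

variable {G} {U : V → ℝ} {F : Finset V}

theorem dirKernel_notMem_left {t : ℝ} {x y : V} (hx : x ∉ F) : G.dirKernel U F t x y = 0 :=
  heat_notMem _ _ hx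

theorem heat_const_zero (t : ℝ) : G.heat U F t 0 = 0 := by
  simpa using heat_smul (G := G) (U := U) (F := F) t 0 0

theorem dirKernel_notMem_right {t : ℝ} {x y : V} (hy : y ∉ F) : G.dirKernel U F t x y = 0 := by
  rw [dirKernel, heat_congr (g := 0), heat_const_zero, Pi.zero_apply]
  intro z hz
  have : z ≠ y := by
    rintro rfl
    exact hy hz
  simp [this]

theorem heat_eq_sum (t : ℝ) (f : V → ℝ) (x : V) :
    G.heat U F t f x = ∑ y ∈ F, G.dirKernel U F t x y * f y := by
  let L : (V → ℝ) →ₗ[ℝ] (V → ℝ) :=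
    { toFun := G.heat U F t, map_add' := heat_add t, map_smul' := heat_smul t }
  have h1 : G.heat U F t f = L (∑ y ∈ F, f y • Set.indicator {y} fun _ => (1 : ℝ)) := by
    refine heat_congr t fun z hz => ?_
    rw [Finset.sum_apply, Finset.sum_eq_single z]
    · simp
    · intro y _ hy
      simp [hy.symm]
    · exact fun h => absurd hz h
  rw [h1, map_sum, Finset.sum_apply]
  refine Finset.sum_congr rfl fun y _ => ?_
  rw [map_smul, Pi.smul_apply, smul_eq_mul, mul_comm]
  rfl

theorem heat_eq_tsum (t : ℝ) (f : V → ℝ) (x : V) :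
    G.heat U F t f x = ∑' y, G.dirKernel U F t x y * f y := by
  rw [heat_eq_sum]
  exact (tsum_eq_sum fun y hy => by rw [dirKernel_notMem_right hy, zero_mul]).symm

theorem dirKernel_nonneg {t : ℝ} (ht : 0 ≤ t) (x y : V) : 0 ≤ G.dirKernel U F t x y :=
  heat_nonneg ht (fun _ _ => Set.indicator_nonneg (fun _ _ => zero_le_one) _) x

theorem dirKernel_mono {t : ℝ} (ht : 0 ≤ t) (x y : V) :
    Monotone fun F : Finset V => G.dirKernel U F t x y := fun _ _ hF =>
  heat_mono_set hF ht (fun _ _ => Set.indicator_nonneg (fun _ _ => zero_le_one) _) x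

theorem dirKernel_symm (t : ℝ) (x y : V) :
    G.m x * G.dirKernel U F t x y = G.m y * G.dirKernel U F t y x := by
  by_cases hx : x ∈ F
  · by_cases hy : y ∈ F
    · have h := heat_symm (G := G) (U := U) (F := F) t (Set.indicator {y} fun _ => 1)
        (Set.indicator {x} fun _ => 1)
      rw [Finset.sum_eq_single x, Finset.sum_eq_single y] at h
      · simpa [dirKernel] using h
      · intro z _ hz
        simp [hz]
      · exact fun h => absurd hy h
      · intro z _ hz
        simp [hz]
      · exact fun h => absurd hx h
    · rw [dirKernel_notMem_left hy, dirKernel_notMem_right hy, mul_zero, mul_zero]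
  · rw [dirKernel_notMem_left hx, dirKernel_notMem_right hx, mul_zero, mul_zero]

theorem sum_dirKernel_sq_le {l : ℝ} (hl : G.LowerBound U l) {t : ℝ} (ht : 0 ≤ t) (y : V)
    (s : Finset V) :
    ∑ x ∈ s, G.m x * G.dirKernel U F t x y ^ 2 ≤ Real.exp (2 * l * t) * G.m y := by
  classical
  have h1 := heat_sq_le (F := F) hl ht (Set.indicator {y} fun _ => 1)
  have h0 : ∀ x, 0 ≤ G.m x * G.dirKernel U F t x y ^ 2 := fun x =>
    mul_nonneg (G.m_pos x).le (sq_nonneg _)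
  have h2 : ∑ x ∈ s, G.m x * G.dirKernel U F t x y ^ 2
      ≤ ∑ x ∈ F, G.m x * G.dirKernel U F t x y ^ 2 := by
    calc _ ≤ ∑ x ∈ s ∪ F, G.m x * G.dirKernel U F t x y ^ 2 :=
          Finset.sum_le_sum_of_subset_of_nonneg Finset.subset_union_left fun x _ _ => h0 x
      _ = _ := (Finset.sum_subset Finset.subset_union_right fun x _ hx => by
          rw [dirKernel_notMem_left hx]; ring).symm
  refine h2.trans (h1.trans (mul_le_mul_of_nonneg_left ?_ (Real.exp_pos _).le))
  calc ∑ x ∈ F, G.m x * (Set.indicator {y} (fun _ => (1 : ℝ)) x) ^ 2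
      ≤ ∑ x ∈ insert y F, G.m x * (Set.indicator {y} (fun _ => (1 : ℝ)) x) ^ 2 :=
        Finset.sum_le_sum_of_subset_of_nonneg (Finset.subset_insert _ _) fun x _ _ =>
          mul_nonneg (G.m_pos x).le (sq_nonneg _)
    _ = G.m y := by
        rw [Finset.sum_eq_single y]
        · simp
        · intro z _ hz
          simp [hz]
        · simp

/-- A real supremum over an unbounded family is `0` by default, so `minKernel` is meaningful only
through this bound. It comes from the single-vertex case of the `L²` estimate for a column. -/
theorem bddAbove_dirKernel {l : ℝ} (hl : G.LowerBound U l) {t : ℝ} (ht : 0 ≤ t) (x y : V) :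
    BddAbove (Set.range fun F : Finset V => G.dirKernel U F t x y) := by
  refine ⟨√(Real.exp (2 * l * t) * G.m y / G.m x), ?_⟩
  rintro _ ⟨F, rfl⟩
  refine Real.le_sqrt_of_sq_le ?_
  rw [le_div_iff₀ (G.m_pos x), mul_comm]
  simpa using sum_dirKernel_sq_le (F := F) hl ht y {x}

theorem tendsto_dirKernel {l : ℝ} (hl : G.LowerBound U l) {t : ℝ} (ht : 0 ≤ t) (x y : V) :
    Tendsto (fun F : Finset V => G.dirKernel U F t x y) atTop (𝓝 (G.minKernel U t x y)) :=
  tendsto_atTop_ciSup (dirKernel_mono ht x y) (bddAbove_dirKernel hl ht x y)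

theorem dirKernel_le_minKernel {l : ℝ} (hl : G.LowerBound U l) {t : ℝ} (ht : 0 ≤ t)
    (F : Finset V) (x y : V) : G.dirKernel U F t x y ≤ G.minKernel U t x y :=
  le_ciSup (bddAbove_dirKernel hl ht x y) F

theorem minKernel_nonneg {l : ℝ} (hl : G.LowerBound U l) {t : ℝ} (ht : 0 ≤ t) (x y : V) :
    0 ≤ G.minKernel U t x y :=
  (dirKernel_nonneg ht x y).trans (dirKernel_le_minKernel hl ht ∅ x y)

theorem minKernel_symm {l : ℝ} (hl : G.LowerBound U l) {t : ℝ} (ht : 0 ≤ t) (x y : V) :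
    G.m x * G.minKernel U t x y = G.m y * G.minKernel U t y x := by
  refine tendsto_nhds_unique ((tendsto_dirKernel hl ht x y).const_mul _) ?_
  simp_rw [dirKernel_symm t x y]
  exact (tendsto_dirKernel hl ht y x).const_mul _

theorem summable_minKernel_sq {l : ℝ} (hl : G.LowerBound U l) {t : ℝ} (ht : 0 ≤ t) (y : V) :
    Summable fun x => G.m x * G.minKernel U t x y ^ 2 := by
  refine summable_of_sum_le (c := Real.exp (2 * l * t) * G.m y)
    (fun x => mul_nonneg (G.m_pos x).le (sq_nonneg _)) fun s => ?_
  refine le_of_tendsto (tendsto_finsetSum s fun x _ =>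
    ((tendsto_dirKernel hl ht x y).pow 2).const_mul (G.m x)) ?_
  exact Eventually.of_forall fun F => sum_dirKernel_sq_le hl ht y s

/-- Symmetry turns a row of the kernel into `m(y) / m(x)` times a column. Columns are in `L²`, so
Cauchy–Schwarz applies. -/
theorem summable_minKernel_mul {l : ℝ} (hl : G.LowerBound U l) {t : ℝ} (ht : 0 ≤ t) {f : V → ℝ}
    (hf : Summable fun x => G.m x * f x ^ 2) (x : V) :
    Summable fun y => G.minKernel U t x y * f y := by
  refine ((G.summable_mul_of_sq (summable_minKernel_sq hl ht x) hf).mul_left (G.m x)⁻¹).congr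
    fun y => ?_
  have := minKernel_symm hl ht x y
  rw [← mul_assoc (G.m y), ← this]
  have := (G.m_pos x).ne'
  field_simp

theorem tendsto_heat {l : ℝ} (hl : G.LowerBound U l) {t : ℝ} (ht : 0 ≤ t) {f : V → ℝ}
    (hf : Summable fun x => G.m x * f x ^ 2) (x : V) :
    Tendsto (fun F : Finset V => G.heat U F t f x) atTop
      (𝓝 (∑' y, G.minKernel U t x y * f y)) := by
  simp_rw [heat_eq_tsum]
  refine tendsto_tsum_of_dominated_convergence (summable_minKernel_mul hl ht hf x).norm
    (fun y => (tendsto_dirKernel hl ht x y).mul_const _) (Eventually.of_forall fun F y => ?_)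
  rw [norm_mul, norm_mul, Real.norm_of_nonneg (dirKernel_nonneg ht x y),
    Real.norm_of_nonneg (minKernel_nonneg hl ht x y)]
  exact mul_le_mul_of_nonneg_right (dirKernel_le_minKernel hl ht F x y) (norm_nonneg _)

theorem sum_sq_tsum_minKernel_le {l : ℝ} (hl : G.LowerBound U l) {t : ℝ} (ht : 0 ≤ t) {f : V → ℝ}
    (hf : Summable fun x => G.m x * f x ^ 2) (s : Finset V) :
    ∑ x ∈ s, G.m x * (∑' y, G.minKernel U t x y * f y) ^ 2
      ≤ Real.exp (2 * l * t) * ∑' x, G.m x * f x ^ 2 := by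
  refine le_of_tendsto (tendsto_finsetSum s fun x _ =>
    ((tendsto_heat hl ht hf x).pow 2).const_mul (G.m x)) ?_
  filter_upwards [eventually_ge_atTop s] with F hF
  calc _ ≤ ∑ x ∈ F, G.m x * G.heat U F t f x ^ 2 :=
        Finset.sum_le_sum_of_subset_of_nonneg hF fun x _ _ =>
          mul_nonneg (G.m_pos x).le (sq_nonneg _)
    _ ≤ _ := (heat_sq_le hl ht f).trans (mul_le_mul_of_nonneg_left
        (hf.sum_le_tsum F fun x _ => mul_nonneg (G.m_pos x).le (sq_nonneg _)) (Real.exp_pos _).le)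

theorem minKernel_zero {l : ℝ} (hl : G.LowerBound U l) (x y : V) :
    G.minKernel U 0 x y = Set.indicator {y} (fun _ => 1) x := by
  refine tendsto_nhds_unique (tendsto_dirKernel hl le_rfl x y) ?_
  refine tendsto_const_nhds.congr' ?_
  filter_upwards [eventually_ge_atTop {x}] with F hF
  rw [dirKernel, heat_zero _ (hF (Finset.mem_singleton_self x))]

/-- Chapman–Kolmogorov passes to the limit by dominated convergence, the minimal kernels themselves
being the majorant. -/
theorem minKernel_add {l : ℝ} (hl : G.LowerBound U l) {t s : ℝ} (ht : 0 ≤ t) (hs : 0 ≤ s)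
    (x y : V) :
    G.minKernel U (t + s) x y = ∑' z, G.minKernel U t x z * G.minKernel U s z y := by
  refine tendsto_nhds_unique (tendsto_dirKernel hl (add_nonneg ht hs) x y) ?_
  have h1 : ∀ F : Finset V, G.dirKernel U F (t + s) x y
      = ∑' z, G.dirKernel U F t x z * G.dirKernel U F s z y := fun F => by
    rw [dirKernel, heat_comp, heat_eq_tsum]
    rfl
  simp_rw [h1]
  refine tendsto_tsum_of_dominated_convergence
    (summable_minKernel_mul hl ht (summable_minKernel_sq hl hs y) x)
    (fun z => (tendsto_dirKernel hl ht x z).mul (tendsto_dirKernel hl hs z y))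
    (Eventually.of_forall fun F z => ?_)
  rw [Real.norm_of_nonneg (mul_nonneg (dirKernel_nonneg ht x z) (dirKernel_nonneg hs z y))]
  exact mul_le_mul (dirKernel_le_minKernel hl ht F x z) (dirKernel_le_minKernel hl hs F z y)
    (dirKernel_nonneg hs z y) (minKernel_nonneg hl ht x z)

/-! ### The minimal semigroup on `L²` -/

variable [Countable V] [MeasurableSpace V] [DiscreteMeasurableSpace V]

theorem exists_heatOp {l : ℝ} (hl : G.LowerBound U l) {t : ℝ} (ht : 0 ≤ t) :
    ∃ S : Lp ℝ 2 G.vol →L[ℝ] Lp ℝ 2 G.vol, ∀ f x, S f x = ∑' y, G.minKernel U t x y * f y := by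
  have hsum : ∀ f : Lp ℝ 2 G.vol,
      Summable fun x => G.m x * (∑' y, G.minKernel U t x y * f y) ^ 2 := fun f =>
    summable_of_sum_le (fun x => mul_nonneg (G.m_pos x).le (sq_nonneg _))
      (sum_sq_tsum_minKernel_le hl ht (G.summable_sq_Lp f))
  have hmem : ∀ f : Lp ℝ 2 G.vol, MemLp (fun x => ∑' y, G.minKernel U t x y * f y) 2 G.vol :=
    fun f => (G.memLp_two_iff _).2 (hsum f)
  have hcoe : ∀ f x, (hmem f).toLp _ x = ∑' y, G.minKernel U t x y * f y := fun f x => by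
    rw [coe_toLp]
  let L : Lp ℝ 2 G.vol →ₗ[ℝ] Lp ℝ 2 G.vol :=
    { toFun := fun f => (hmem f).toLp _
      map_add' := fun f g => G.Lp_ext fun x => by
        rw [G.coe_add_Lp ((hmem f).toLp _), Pi.add_apply, hcoe, hcoe, hcoe,
          ← (summable_minKernel_mul hl ht (G.summable_sq_Lp f) x).tsum_add
            (summable_minKernel_mul hl ht (G.summable_sq_Lp g) x), coe_add_Lp]
        simp only [Pi.add_apply, mul_add]
      map_smul' := fun c f => G.Lp_ext fun x => by
        rw [G.coe_smul_Lp _ ((hmem f).toLp _), Pi.smul_apply, hcoe, hcoe, RingHom.id_apply,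
          smul_eq_mul, ← tsum_mul_left,
          coe_smul_Lp]
        congr 1
        ext y
        simp only [Pi.smul_apply, smul_eq_mul]
        ring }
  refine ⟨L.mkContinuous (Real.exp (l * t)) fun f => ?_, fun f x => hcoe f x⟩
  refine le_of_sq_le_sq ?_ (by positivity)
  rw [mul_pow, ← Real.exp_nat_mul, norm_sq_Lp, norm_sq_Lp]
  have h1 : ∀ x, L f x = ∑' y, G.minKernel U t x y * f y := hcoe f
  simp_rw [h1]
  have h2 : ((2 : ℕ) : ℝ) * (l * t) = 2 * l * t := by push_cast; ring
  rw [h2]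
  exact (hsum f).tsum_le_of_sum_le (sum_sq_tsum_minKernel_le hl ht (G.summable_sq_Lp f))

variable (G) in
open Classical in
/-- The minimal semigroup of `Δ - U` on `L²` (zero if its kernel does not act on `L²`). -/
def heatOp (U : V → ℝ) (t : ℝ) : Lp ℝ 2 G.vol →L[ℝ] Lp ℝ 2 G.vol :=
  if h : ∃ S : Lp ℝ 2 G.vol →L[ℝ] Lp ℝ 2 G.vol,
    ∀ f x, S f x = ∑' y, G.minKernel U t x y * f y then h.choose else 0

theorem heatOp_apply {l : ℝ} (hl : G.LowerBound U l) {t : ℝ} (ht : 0 ≤ t) (f : Lp ℝ 2 G.vol)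
    (x : V) : G.heatOp U t f x = ∑' y, G.minKernel U t x y * f y := by
  rw [heatOp, dif_pos (exists_heatOp hl ht)]
  exact (exists_heatOp hl ht).choose_spec f x

theorem tendsto_heat_heatOp {l : ℝ} (hl : G.LowerBound U l) {t : ℝ} (ht : 0 ≤ t)
    (f : Lp ℝ 2 G.vol) (x : V) :
    Tendsto (fun F : Finset V => G.heat U F t f x) atTop (𝓝 (G.heatOp U t f x)) := by
  rw [heatOp_apply hl ht]
  exact tendsto_heat hl ht (G.summable_sq_Lp f) x

theorem heatOp_delta {l : ℝ} (hl : G.LowerBound U l) {t : ℝ} (ht : 0 ≤ t) (x y : V) :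
    G.heatOp U t (G.delta y) x = G.minKernel U t x y := by
  rw [heatOp_apply hl ht, tsum_eq_single y]
  · rw [delta_apply_self, mul_one]
  · intro z hz
    rw [delta_apply_ne G hz, mul_zero]

theorem norm_heatOp_le {l : ℝ} (hl : G.LowerBound U l) {t : ℝ} (ht : 0 ≤ t) (f : Lp ℝ 2 G.vol) :
    ‖G.heatOp U t f‖ ≤ Real.exp (l * t) * ‖f‖ := by
  refine le_of_sq_le_sq ?_ (by positivity)
  rw [mul_pow, ← Real.exp_nat_mul, norm_sq_Lp, norm_sq_Lp]
  have h2 : ((2 : ℕ) : ℝ) * (l * t) = 2 * l * t := by push_cast; ring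
  rw [h2]
  refine (G.summable_sq_Lp _).tsum_le_of_sum_le fun s => ?_
  simp_rw [heatOp_apply hl ht]
  exact sum_sq_tsum_minKernel_le hl ht (G.summable_sq_Lp f) s

theorem heatOp_zero {l : ℝ} (hl : G.LowerBound U l) :
    G.heatOp U 0 = ContinuousLinearMap.id ℝ _ := by
  refine G.clm_ext fun x y => ?_
  rw [heatOp_delta hl le_rfl, minKernel_zero hl, ContinuousLinearMap.id_apply, coe_delta]

theorem heatOp_add {l : ℝ} (hl : G.LowerBound U l) {t s : ℝ} (ht : 0 ≤ t) (hs : 0 ≤ s) :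
    G.heatOp U (t + s) = (G.heatOp U t).comp (G.heatOp U s) := by
  refine G.clm_ext fun x y => ?_
  rw [heatOp_delta hl (add_nonneg ht hs), minKernel_add hl ht hs, ContinuousLinearMap.comp_apply,
    heatOp_apply hl ht]
  simp_rw [heatOp_delta hl hs]

/-- By symmetry of the kernel the adjoint has the same matrix entries as the operator. -/
theorem heatOp_symm {l : ℝ} (hl : G.LowerBound U l) {t : ℝ} (ht : 0 ≤ t) (f g : Lp ℝ 2 G.vol) :
    inner ℝ (G.heatOp U t f) g = inner ℝ f (G.heatOp U t g) := by
  have h : ContinuousLinearMap.adjoint (G.heatOp U t) = G.heatOp U t := by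
    refine G.clm_ext fun x y => mul_left_cancel₀ (G.m_pos x).ne' ?_
    rw [← inner_delta, ContinuousLinearMap.adjoint_inner_left, real_inner_comm, inner_delta,
      heatOp_delta hl ht, heatOp_delta hl ht, minKernel_symm hl ht]
  conv_lhs => rw [← h]
  rw [ContinuousLinearMap.adjoint_inner_left]

theorem norm_sq_delta (y : V) : ‖G.delta y‖ ^ 2 = G.m y := by
  rw [← real_inner_self_eq_norm_sq, inner_delta, delta_apply_self, mul_one]

/-- Expanding the square leaves only the diagonal entry to be bounded below. The Dirichlet kernel of
the single vertex set `{y}` does this: it is continuous in time and equals `1` at time `0`. -/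
theorem tendsto_heatOp_delta {l : ℝ} (hl : G.LowerBound U l) (y : V) :
    Tendsto (fun t => G.heatOp U t (G.delta y)) (𝓝[≥] 0) (𝓝 (G.delta y)) := by
  rw [tendsto_iff_norm_sub_tendsto_zero]
  set b : ℝ → ℝ := fun t => (Real.exp (2 * l * t) + 1 - 2 * G.dirKernel U {y} t y y) * G.m y
  have hb : Tendsto b (𝓝[≥] 0) (𝓝 0) := by
    have h1 : Continuous b := by
      have : Continuous fun t => G.dirKernel U {y} t y y := continuous_heat _ _
      fun_prop
    have h2 : b 0 = 0 := by
      simp only [b, dirKernel]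
      rw [heat_zero _ (Finset.mem_singleton_self y)]
      simp
      left
      norm_num
    have h3 : Tendsto b (𝓝[≥] 0) (𝓝 (b 0)) := h1.continuousAt.continuousWithinAt
    rwa [h2] at h3
  have h3 : Tendsto (fun t => ‖G.heatOp U t (G.delta y) - G.delta y‖ ^ 2) (𝓝[≥] 0) (𝓝 0) := by
    refine tendsto_of_tendsto_of_tendsto_of_le_of_le' tendsto_const_nhds hb
      (Eventually.of_forall fun t => sq_nonneg _) ?_
    filter_upwards [self_mem_nhdsWithin] with t ht
    rw [norm_sub_sq_real, inner_delta, heatOp_delta hl ht, norm_sq_delta]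
    have h4 := pow_le_pow_left₀ (norm_nonneg _) (norm_heatOp_le hl ht (G.delta y)) 2
    rw [mul_pow, norm_sq_delta, ← Real.exp_nat_mul] at h4
    have h5 := mul_le_mul_of_nonneg_left (dirKernel_le_minKernel hl ht {y} y y) (G.m_pos y).le
    have h2 : ((2 : ℕ) : ℝ) * (l * t) = 2 * l * t := by push_cast; ring
    rw [h2] at h4
    simp only [b]
    linarith
  simpa [Real.sqrt_sq] using h3.sqrt

theorem tendsto_heatOp_zero {l : ℝ} (hl0 : 0 ≤ l) (hl : G.LowerBound U l) (f : Lp ℝ 2 G.vol) :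
    Tendsto (fun t => G.heatOp U t f) (𝓝[≥] 0) (𝓝 f) := by
  rw [Metric.tendsto_nhds]
  intro ε hε
  set M := Real.exp l
  have hM : 0 < M := Real.exp_pos l
  -- The error splits in three: `M` bounds the operator norm for times at most `1`, and the two
  -- other terms cost one share each, whence `M + 2`.
  obtain ⟨s, hs⟩ := ((Metric.tendsto_nhds.1 (G.hasSum_delta f)) (ε / (M + 2)) (by positivity)).exists
  set g := ∑ y ∈ s, f y • G.delta y
  have hg : Tendsto (fun t => G.heatOp U t g) (𝓝[≥] 0) (𝓝 g) := by
    simp only [g, map_sum, map_smul]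
    exact tendsto_finsetSum _ fun y _ => (tendsto_heatOp_delta hl y).const_smul _
  have h1 : ∀ᶠ t : ℝ in 𝓝[≥] 0, t ≤ 1 := nhdsWithin_le_nhds (Iic_mem_nhds zero_lt_one)
  filter_upwards [(Metric.tendsto_nhds.1 hg) (ε / (M + 2)) (by positivity), h1,
    self_mem_nhdsWithin] with t h2 h3 h4
  have h5 : ‖G.heatOp U t (f - g)‖ ≤ M * ‖f - g‖ :=
    (norm_heatOp_le hl h4 _).trans (mul_le_mul_of_nonneg_right
      (Real.exp_le_exp.2 (by nlinarith)) (norm_nonneg _))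
  rw [dist_eq_norm] at hs h2 ⊢
  have h6 : G.heatOp U t f - f = G.heatOp U t (f - g) + (G.heatOp U t g - g) + (g - f) := by
    rw [map_sub]
    abel
  have h7 : ‖f - g‖ < ε / (M + 2) := by rwa [norm_sub_rev]
  calc _ ≤ ‖G.heatOp U t (f - g)‖ + ‖G.heatOp U t g - g‖ + ‖g - f‖ := by
        rw [h6]
        exact norm_add₃_le
    _ < M * (ε / (M + 2)) + ε / (M + 2) + ε / (M + 2) := by
        have := h5.trans (mul_le_mul_of_nonneg_left h7.le hM.le)
        linarith
    _ = ε := by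
        field_simp
        ring

/-- Factoring out the flow up to the earlier of the two times reduces continuity from either side to
continuity at `0`, evaluated at `|t - a|`. -/
theorem continuousOn_heatOp {l : ℝ} (hl0 : 0 ≤ l) (hl : G.LowerBound U l) (f : Lp ℝ 2 G.vol) :
    ContinuousOn (fun t => G.heatOp U t f) (Set.Ici 0) := by
  intro a ha
  rw [ContinuousWithinAt, tendsto_iff_norm_sub_tendsto_zero]
  have h2 : Tendsto (fun t : ℝ => |t - a|) (𝓝[Set.Ici 0] a) (𝓝[≥] 0) := by
    rw [tendsto_nhdsWithin_iff]
    refine ⟨?_, Eventually.of_forall fun t => Set.mem_Ici.2 (abs_nonneg _)⟩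
    have : Tendsto (fun t : ℝ => |t - a|) (𝓝 a) (𝓝 |a - a|) :=
      ((continuous_id.sub continuous_const).abs).continuousAt
    rw [sub_self, abs_zero] at this
    exact this.mono_left nhdsWithin_le_nhds
  have h3 := ((tendsto_iff_norm_sub_tendsto_zero.1 (tendsto_heatOp_zero hl0 hl f)).comp h2).const_mul
    (Real.exp (l * a))
  rw [mul_zero] at h3
  refine tendsto_of_tendsto_of_tendsto_of_le_of_le' tendsto_const_nhds h3
    (Eventually.of_forall fun t => norm_nonneg _) ?_
  filter_upwards [self_mem_nhdsWithin] with t ht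
  have key : ∀ s r : ℝ, 0 ≤ s → s ≤ r → s ≤ a → ‖G.heatOp U r f - G.heatOp U s f‖
      ≤ Real.exp (l * a) * ‖G.heatOp U |r - s| f - f‖ := by
    intro s r hs hsr hsa
    rw [abs_of_nonneg (sub_nonneg.2 hsr)]
    have h4 : G.heatOp U r f = G.heatOp U s (G.heatOp U (r - s) f) := by
      rw [← ContinuousLinearMap.comp_apply, ← heatOp_add hl hs (sub_nonneg.2 hsr)]
      congr 2
      ring
    rw [h4, ← map_sub]
    exact (norm_heatOp_le hl hs _).trans (mul_le_mul_of_nonneg_right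
      (Real.exp_le_exp.2 (mul_le_mul_of_nonneg_left hsa hl0)) (norm_nonneg _))
  rcases le_total a t with h | h
  · exact key a t ha h le_rfl
  · have := key t a ht h h
    rwa [norm_sub_rev, abs_sub_comm] at this

end

section

/-! ### Weak limits and diagonal operators in `ℓ²` -/

section EllTwo

variable {ι : Type*}

theorem memℓp_two_iff {a : ι → ℝ} : Memℓp a 2 ↔ Summable fun i => a i ^ 2 := by
  rw [memℓp_gen_iff (by norm_num)]
  simp

theorem ellTwo_norm_sq (a : lp (fun _ : ι => ℝ) 2) : ‖a‖ ^ 2 = ∑' i, a i ^ 2 := by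
  rw [← real_inner_self_eq_norm_sq, lp.inner_eq_tsum]
  simp [sq]

theorem ellTwo_summable_sq (a : lp (fun _ : ι => ℝ) 2) : Summable fun i => a i ^ 2 :=
  memℓp_two_iff.1 (lp.memℓp a)

theorem ellTwo_inner (a b : lp (fun _ : ι => ℝ) 2) : inner ℝ a b = ∑' i, a i * b i := by
  rw [lp.inner_eq_tsum]
  simp [mul_comm]

theorem ellTwo_summable_mul (a b : lp (fun _ : ι => ℝ) 2) : Summable fun i => a i * b i := by
  have := lp.summable_inner (𝕜 := ℝ) a b
  simpa [mul_comm] using this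

/-- Bounded coordinatewise convergence is weak convergence: finitely supported test vectors are
dense, and the uniform norm bound absorbs the rest. -/
theorem tendsto_inner_of_tendsto_coord {κ : Type*} {l : Filter κ}
    {a : κ → lp (fun _ : ι => ℝ) 2} {b : lp (fun _ : ι => ℝ) 2} {C : ℝ} (hC : ∀ k, ‖a k‖ ≤ C)
    (h : ∀ i, Tendsto (fun k => a k i) l (𝓝 (b i))) (q : lp (fun _ : ι => ℝ) 2) :
    Tendsto (fun k => inner ℝ (a k) q) l (𝓝 (inner ℝ b q)) := by
  classical
  rw [Metric.tendsto_nhds]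
  intro ε hε
  by_cases hκ : Nonempty κ
  swap
  · exact Eventually.of_forall fun k => absurd ⟨k⟩ hκ
  have hC0 : 0 ≤ C := (norm_nonneg _).trans (hC hκ.some)
  have hD : 0 < C + ‖b‖ + 1 := by positivity
  have hq : HasSum (fun i => lp.single 2 i (q i)) q := lp.hasSum_single (by norm_num) q
  obtain ⟨s, hs⟩ := ((Metric.tendsto_nhds.1 hq) (ε / 2 / (C + ‖b‖ + 1)) (by positivity)).exists
  set r := ∑ i ∈ s, lp.single 2 i (q i)
  have hr : Tendsto (fun k => inner ℝ (a k) r) l (𝓝 (inner ℝ b r)) := by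
    simp only [r, inner_sum, lp.inner_single_right]
    exact tendsto_finsetSum _ fun i _ => (h i).inner tendsto_const_nhds
  filter_upwards [(Metric.tendsto_nhds.1 hr) (ε / 2) (by positivity)] with k hk
  rw [Real.dist_eq] at hk ⊢
  rw [dist_eq_norm] at hs
  have h1 : inner ℝ (a k) q - inner ℝ b q
      = (inner ℝ (a k) r - inner ℝ b r) + inner ℝ (a k - b) (q - r) := by
    rw [inner_sub_left, inner_sub_right, inner_sub_right]
    ring
  have h2 : |inner ℝ (a k - b) (q - r)| ≤ (C + ‖b‖ + 1) * ‖r - q‖ := by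
    refine (abs_real_inner_le_norm _ _).trans ?_
    rw [norm_sub_rev q r]
    refine mul_le_mul_of_nonneg_right ?_ (norm_nonneg _)
    have := norm_sub_le (a k) b
    linarith [hC k]
  have h3 : (C + ‖b‖ + 1) * ‖r - q‖ < ε / 2 := by
    rw [lt_div_iff₀ hD] at hs
    linarith
  rw [h1]
  calc _ ≤ |inner ℝ (a k) r - inner ℝ b r| + |inner ℝ (a k - b) (q - r)| := abs_add_le _ _
    _ < ε := by linarith

/-- Closed subspaces of `ℓ²` are closed under bounded coordinatewise limits. -/
theorem mem_closure_of_tendsto_coord {κ : Type*} {l : Filter κ} [l.NeBot]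
    (M : Submodule ℝ (lp (fun _ : ι => ℝ) 2)) {a : κ → lp (fun _ : ι => ℝ) 2}
    {b : lp (fun _ : ι => ℝ) 2} {C : ℝ} (hM : ∀ k, a k ∈ M.topologicalClosure)
    (hC : ∀ k, ‖a k‖ ≤ C) (h : ∀ i, Tendsto (fun k => a k i) l (𝓝 (b i))) :
    b ∈ M.topologicalClosure := by
  rw [← Submodule.orthogonal_orthogonal_eq_closure, Submodule.mem_orthogonal']
  intro q hq
  refine tendsto_nhds_unique (tendsto_inner_of_tendsto_coord hC h q) ?_
  refine tendsto_const_nhds.congr fun k => ?_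
  have := hM k
  rw [← Submodule.orthogonal_orthogonal_eq_closure, Submodule.mem_orthogonal'] at this
  exact (this q hq).symm

theorem memℓp_diag {s : ι → ℝ} (hs : ∀ i, |s i| ≤ 1) {a : ι → ℝ} (ha : Memℓp a 2) :
    Memℓp (fun i => s i * a i) 2 := by
  rw [memℓp_two_iff] at *
  refine Summable.of_nonneg_of_le (fun i => sq_nonneg _) (fun i => ?_) ha
  rw [mul_pow, ← sq_abs (s i)]
  exact mul_le_of_le_one_left (sq_nonneg _) (pow_le_one₀ (abs_nonneg _) (hs i))

/-- Multiplication by a function bounded by `1`, as an operator on `ℓ²`. -/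
def diagOp (s : ι → ℝ) (hs : ∀ i, |s i| ≤ 1) :
    lp (fun _ : ι => ℝ) 2 →L[ℝ] lp (fun _ : ι => ℝ) 2 :=
  LinearMap.mkContinuous
    { toFun := fun a => ⟨fun i => s i * a i, memℓp_diag hs (lp.memℓp a)⟩
      map_add' := fun a b => by
        ext i
        exact mul_add _ _ _
      map_smul' := fun c a => by
        ext i
        simp [mul_left_comm] } 1 fun a => by
    rw [one_mul]
    refine le_of_sq_le_sq ?_ (norm_nonneg _)
    rw [ellTwo_norm_sq, ellTwo_norm_sq]
    refine (memℓp_two_iff.1 (memℓp_diag hs (lp.memℓp a))).tsum_le_tsum (fun i => ?_)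
      (ellTwo_summable_sq a)
    simp only [LinearMap.coe_mk, AddHom.coe_mk, mul_pow]
    rw [← sq_abs (s i)]
    exact mul_le_of_le_one_left (sq_nonneg _) (pow_le_one₀ (abs_nonneg _) (hs i))

end EllTwo

end

section

variable {V : Type*} (G : MWG V)

/-! ### The form domain inside `ℓ²` -/

/-- The isometric embedding of the form domain with the norm `Q + ∑ m (1 + |U|) f²` in `ℓ²`. -/
def emb (U f : V → ℝ) : V ⊕ V × V → ℝ :=
  Sum.elim (fun x => √(G.m x * (1 + |U x|)) * f x)
    (fun p => √(G.w p.1 p.2 / 2) * (f p.1 - f p.2))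

theorem emb_inl (U f : V → ℝ) (x : V) :
    G.emb U f (Sum.inl x) = √(G.m x * (1 + |U x|)) * f x := rfl

theorem emb_inr (U f : V → ℝ) (p : V × V) :
    G.emb U f (Sum.inr p) = √(G.w p.1 p.2 / 2) * (f p.1 - f p.2) := rfl

theorem emb_inl_sq (U f : V → ℝ) (x : V) :
    G.emb U f (Sum.inl x) ^ 2 = G.m x * ((1 + |U x|) * f x ^ 2) := by
  rw [emb_inl, mul_pow, Real.sq_sqrt, mul_assoc]
  have := G.m_pos x
  positivity

theorem emb_inr_sq (U f : V → ℝ) (p : V × V) :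
    G.emb U f (Sum.inr p) ^ 2 = G.w p.1 p.2 / 2 * (f p.1 - f p.2) ^ 2 := by
  rw [emb_inr, mul_pow, Real.sq_sqrt]
  exact div_nonneg (G.w_nonneg _ _) zero_le_two

theorem emb_add (U f g : V → ℝ) (i : V ⊕ V × V) :
    G.emb U (f + g) i = G.emb U f i + G.emb U g i := by
  cases i <;> simp only [emb_inl, emb_inr, Pi.add_apply] <;> ring

theorem emb_sub (U f g : V → ℝ) (i : V ⊕ V × V) :
    G.emb U (f - g) i = G.emb U f i - G.emb U g i := by
  cases i <;> simp only [emb_inl, emb_inr, Pi.sub_apply] <;> ring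

theorem emb_smul (U : V → ℝ) (c : ℝ) (f : V → ℝ) (i : V ⊕ V × V) :
    G.emb U (c • f) i = c * G.emb U f i := by
  cases i <;> simp only [emb_inl, emb_inr, Pi.smul_apply, smul_eq_mul] <;> ring

theorem tendsto_emb {κ : Type*} {l : Filter κ} {f : κ → V → ℝ} {g : V → ℝ} (U : V → ℝ)
    (h : ∀ x, Tendsto (fun k => f k x) l (𝓝 (g x))) (i : V ⊕ V × V) :
    Tendsto (fun k => G.emb U (f k) i) l (𝓝 (G.emb U g i)) := by
  cases i with
  | inl x => exact (h x).const_mul _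
  | inr p => exact ((h p.1).sub (h p.2)).const_mul _

theorem memℓp_emb_iff {U f : V → ℝ} : Memℓp (G.emb U f) 2 ↔
    (Summable fun x => G.m x * ((1 + |U x|) * f x ^ 2)) ∧
      Summable fun p : V × V => G.w p.1 p.2 / 2 * (f p.1 - f p.2) ^ 2 := by
  rw [memℓp_two_iff]
  constructor
  · intro h
    refine ⟨?_, ?_⟩
    · exact (h.comp_injective Sum.inl_injective).congr fun x => G.emb_inl_sq U f x
    · exact (h.comp_injective Sum.inr_injective).congr fun x => G.emb_inr_sq U f x
  · rintro ⟨h1, h2⟩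
    exact Summable.sum _ (h1.congr fun x => (G.emb_inl_sq U f x).symm)
      (h2.congr fun x => (G.emb_inr_sq U f x).symm)

theorem tsum_emb_sq {U f : V → ℝ} (h : Memℓp (G.emb U f) 2) :
    ∑' i, G.emb U f i ^ 2 = ∑' x, G.m x * ((1 + |U x|) * f x ^ 2)
      + ∑' p : V × V, G.w p.1 p.2 / 2 * (f p.1 - f p.2) ^ 2 := by
  obtain ⟨h1, h2⟩ := G.memℓp_emb_iff.1 h
  rw [Summable.tsum_sum (f := fun i => G.emb U f i ^ 2) (h1.congr fun x => (G.emb_inl_sq U f x).symm)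
      (h2.congr fun x => (G.emb_inr_sq U f x).symm)]
  simp_rw [emb_inl_sq, emb_inr_sq]

/-- Only edges with an endpoint in the support contribute, and local finiteness leaves finitely many
of them. -/
theorem summable_w_mul_of_finite {φ : V → ℝ} (hφ : φ.support.Finite) {k : V × V → ℝ}
    (hk : ∀ p : V × V, φ p.1 = 0 → φ p.2 = 0 → k p = 0) :
    Summable fun p : V × V => G.w p.1 p.2 * k p := by
  classical
  set N : Finset (V × V) := hφ.toFinset.biUnion fun x => (G.nbr x).image fun y => (x, y)
  refine summable_of_ne_finset_zero (s := N ∪ N.image Prod.swap) fun p hp => ?_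
  rw [Finset.mem_union, not_or] at hp
  by_cases hw : G.w p.1 p.2 = 0
  · rw [hw, zero_mul]
  have h1 : φ p.1 = 0 := by
    by_contra h
    refine hp.1 (Finset.mem_biUnion.2 ⟨p.1, by simpa using h, ?_⟩)
    exact Finset.mem_image.2 ⟨p.2, by_contra fun h' => hw (G.w_eq_zero_of_notMem_nbr h'), rfl⟩
  have h2 : φ p.2 = 0 := by
    by_contra h
    refine hp.2 (Finset.mem_image.2 ⟨p.swap, ?_, Prod.swap_swap p⟩)
    refine Finset.mem_biUnion.2 ⟨p.2, by simpa using h, ?_⟩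
    rw [G.w_symm] at hw
    exact Finset.mem_image.2 ⟨p.1, by_contra fun h' => hw (G.w_eq_zero_of_notMem_nbr h'), rfl⟩
  rw [hk p h1 h2, mul_zero]

theorem summable_energy_of_finite {φ : V → ℝ} (hφ : φ.support.Finite) :
    Summable fun p : V × V => G.w p.1 p.2 / 2 * (φ p.1 - φ p.2) ^ 2 :=
  (G.summable_w_mul_of_finite hφ (k := fun p => (φ p.1 - φ p.2) ^ 2 / 2)
    fun p h1 h2 => by simp [h1, h2]).congr fun p => by ring

theorem memℓp_emb_of_finite (U : V → ℝ) {φ : V → ℝ} (hφ : φ.support.Finite) :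
    Memℓp (G.emb U φ) 2 := by
  refine G.memℓp_emb_iff.2 ⟨?_, G.summable_energy_of_finite hφ⟩
  refine summable_of_ne_finset_zero (s := hφ.toFinset) fun x hx => ?_
  rw [notMem_support_toFinset hφ x hx]
  ring

/-- The finitely supported functions, embedded in `ℓ²`. -/
def finCore (U : V → ℝ) : Submodule ℝ (lp (fun _ : V ⊕ V × V => ℝ) 2) where
  carrier := {a | ∃ φ : V → ℝ, φ.support.Finite ∧ ∀ i, a i = G.emb U φ i}
  add_mem' := by
    rintro a b ⟨φ, hφ, ha⟩ ⟨ψ, hψ, hb⟩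
    refine ⟨φ + ψ, (hφ.union hψ).subset (Function.support_add _ _), fun i => ?_⟩
    rw [emb_add, ← ha, ← hb]
    rfl
  zero_mem' := by
    refine ⟨0, by simp, fun i => ?_⟩
    cases i <;> simp [emb]
  smul_mem' := by
    rintro c a ⟨φ, hφ, ha⟩
    refine ⟨c • φ, hφ.subset (Function.support_const_smul_subset _ _), fun i => ?_⟩
    rw [emb_smul, ← ha]
    rfl

theorem energy_eq {f : V → ℝ}
    (h : Summable fun p : V × V => G.w p.1 p.2 / 2 * (f p.1 - f p.2) ^ 2) :
    G.energy f = ENNReal.ofReal (∑' p : V × V, G.w p.1 p.2 / 2 * (f p.1 - f p.2) ^ 2) := by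
  rw [ENNReal.ofReal_tsum_of_nonneg (fun p => mul_nonneg (div_nonneg (G.w_nonneg _ _) zero_le_two)
    (sq_nonneg _)) h, energy, ← ENNReal.tsum_mul_left]
  congr 1
  ext p
  rw [show (2 : ℝ≥0∞)⁻¹ = ENNReal.ofReal 2⁻¹ by
    rw [ENNReal.ofReal_inv_of_pos two_pos, ENNReal.ofReal_ofNat], ← ENNReal.ofReal_mul (by norm_num)]
  congr 1
  ring

theorem summable_of_energy_ne_top {f : V → ℝ} (h : G.energy f ≠ ∞) :
    Summable fun p : V × V => G.w p.1 p.2 / 2 * (f p.1 - f p.2) ^ 2 := by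
  have h1 : ∑' p : V × V, ENNReal.ofReal (G.w p.1 p.2 * (f p.1 - f p.2) ^ 2) ≠ ∞ := by
    intro h'
    rw [energy, h', ENNReal.mul_top (by simp)] at h
    exact h rfl
  refine ((ENNReal.summable_toReal h1).mul_left 2⁻¹).congr fun p => ?_
  rw [ENNReal.toReal_ofReal (mul_nonneg (G.w_nonneg _ _) (sq_nonneg _))]
  ring

theorem energy_summable_of_sub {f g : V → ℝ}
    (h : Summable fun p : V × V => G.w p.1 p.2 / 2 * (g p.1 - g p.2) ^ 2)
    (h' : Summable fun p : V × V => G.w p.1 p.2 / 2 * ((f p.1 - g p.1) - (f p.2 - g p.2)) ^ 2) :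
    Summable fun p : V × V => G.w p.1 p.2 / 2 * (f p.1 - f p.2) ^ 2 := by
  refine Summable.of_nonneg_of_le (fun p => mul_nonneg (div_nonneg (G.w_nonneg _ _) zero_le_two)
    (sq_nonneg _)) (fun p => ?_) ((h.add h').mul_left 2)
  have := div_nonneg (G.w_nonneg p.1 p.2) zero_le_two
  rw [← mul_add, mul_left_comm]
  refine mul_le_mul_of_nonneg_left ?_ this
  nlinarith [sq_nonneg ((g p.1 - g p.2) - ((f p.1 - g p.1) - (f p.2 - g p.2)))]

/-- Clamping `a` to `[-|r|, |r|]` is `1`-Lipschitz in `(a, r)` for the maximum norm. So truncating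
an approximant by `|f|` costs no more than its energy plus that of `f`. -/
theorem clamp_sub_sq_le (a b r s : ℝ) :
    (max (-|r|) (min a |r|) - max (-|s|) (min b |s|)) ^ 2 ≤ (a - b) ^ 2 + (r - s) ^ 2 := by
  have h1 : |max (-|r|) (min a |r|) - max (-|s|) (min b |s|)| ≤ max |a - b| |r - s| := by
    refine (abs_max_sub_max_le_max _ _ _ _).trans (max_le ?_ ?_)
    · rw [neg_sub_neg, abs_sub_comm]
      exact (abs_abs_sub_abs_le_abs_sub r s).trans (le_max_right _ _)
    · exact (abs_min_sub_min_le_max _ _ _ _).trans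
        (max_le_max_left _ (abs_abs_sub_abs_le_abs_sub r s))
  rw [← sq_abs]
  rcases le_total |a - b| |r - s| with h | h
  · rw [max_eq_right h] at h1
    have := pow_le_pow_left₀ (abs_nonneg _) h1 2
    rw [sq_abs (r - s)] at this
    linarith [sq_nonneg (a - b)]
  · rw [max_eq_left h] at h1
    have := pow_le_pow_left₀ (abs_nonneg _) h1 2
    rw [sq_abs (a - b)] at this
    linarith [sq_nonneg (r - s)]

theorem abs_clamp_le (a r : ℝ) : |max (-|r|) (min a |r|)| ≤ |r| := by
  rw [abs_le]
  refine ⟨le_max_left _ _, max_le ?_ (min_le_right _ _)⟩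
  linarith [abs_nonneg r]

theorem clamp_self (r : ℝ) : max (-|r|) (min r |r|) = r := by
  rw [min_eq_left (le_abs_self r), max_eq_right (neg_abs_le r)]

variable [Countable V] [MeasurableSpace V] [DiscreteMeasurableSpace V]

/-- The form domain corresponds to the closure of the finitely supported functions in `ℓ²`; in
particular finitely supported functions form a core of `Q + U`. -/
theorem mem_formDomPot_iff {U f : V → ℝ} : f ∈ G.formDomPot U ↔
    ∃ a ∈ (G.finCore U).topologicalClosure, ∀ i, a i = G.emb U f i := by
  constructor
  · rintro ⟨⟨hf, happ⟩, hpot⟩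
    have hf2 := (G.memLp_two_iff f).1 hf
    have hone : ∀ k : ℕ, (0 : ℝ≥0∞) < ENNReal.ofReal (1 / (k + 1)) := fun k =>
      ENNReal.ofReal_pos.2 (by positivity)
    choose φ hφ happφ using fun k : ℕ => happ _ (hone k)
    have hes : ∀ k, Summable fun p : V × V =>
        G.w p.1 p.2 / 2 * ((f p.1 - φ k p.1) - (f p.2 - φ k p.2)) ^ 2 := fun k =>
      G.summable_of_energy_ne_top (f := fun x => f x - φ k x)
        ((le_self_add.trans_lt ((happφ k).trans ENNReal.ofReal_lt_top)).ne)
    have hen : ∀ k, ∑' p : V × V,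
        G.w p.1 p.2 / 2 * ((f p.1 - φ k p.1) - (f p.2 - φ k p.2)) ^ 2 ≤ 1 := fun k => by
      have h1 := (le_self_add.trans_lt (happφ k)).le
      rw [G.energy_eq (f := fun x => f x - φ k x) (hes k)] at h1
      refine ((ENNReal.ofReal_le_ofReal_iff (by positivity)).1 h1).trans ?_
      rw [div_le_one (by positivity)]
      linarith [Nat.cast_nonneg (α := ℝ) k]
    have hptw : ∀ x, Tendsto (fun k => φ k x) atTop (𝓝 (f x)) := by
      intro x
      have h1 : ∀ k : ℕ, G.m x * (f x - φ k x) ^ 2 ≤ 1 / (k + 1) := by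
        intro k
        have h2 := (le_add_self.trans_lt (happφ k)).le
        rw [eLpNorm_two_sq] at h2
        exact (ENNReal.ofReal_le_ofReal_iff (by positivity)).1 ((ENNReal.le_tsum x).trans h2)
      have h2 : Tendsto (fun k : ℕ => (f x - φ k x) ^ 2) atTop (𝓝 0) := by
        have h3 := (tendsto_one_div_add_atTop_nhds_zero_nat (𝕜 := ℝ)).const_mul (G.m x)⁻¹
        rw [mul_zero] at h3
        refine tendsto_of_tendsto_of_tendsto_of_le_of_le tendsto_const_nhds h3
          (fun k => sq_nonneg _) fun k => ?_
        rw [inv_mul_eq_div, le_div_iff₀ (G.m_pos x), mul_comm]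
        exact h1 k
      have h4 := h2.sqrt
      simp only [Real.sqrt_sq_eq_abs, Real.sqrt_zero] at h4
      have h5 := (tendsto_zero_iff_abs_tendsto_zero _).2 h4
      simpa using h5.const_sub (f x)
    have hfe : Summable fun p : V × V => G.w p.1 p.2 / 2 * (f p.1 - f p.2) ^ 2 :=
      G.energy_summable_of_sub (G.summable_energy_of_finite (hφ 0)) (hes 0)
    have hfm : Summable fun x => G.m x * ((1 + |U x|) * f x ^ 2) :=
      (hf2.add hpot).congr fun x => by ring
    have hfmem : Memℓp (G.emb U f) 2 := G.memℓp_emb_iff.2 ⟨hfm, hfe⟩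
    -- The approximants `φ k` are controlled only in the norm of `Q`, and their mass against `|U| m`
    -- may blow up. Truncation by `|f|` keeps finite support and bounds that mass by the mass of
    -- `f`.
    set ψ : ℕ → V → ℝ := fun k x => max (-|f x|) (min (φ k x) |f x|) with hψ
    have hψfin : ∀ k, (ψ k).support.Finite := fun k => (hφ k).subset fun x hx => by
      by_contra h
      refine hx ?_
      have : φ k x = 0 := by simpa using h
      simp [hψ, this]
    have hψmem := fun k => G.memℓp_emb_of_finite U (hψfin k)
    -- The truncation has energy at most `E(φ) + E(f)`, while `E(φ) ≤ 2 E(f - φ) + 2 E(f)` with `E(f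
    -- - φ) ≤ 1`; this gives `2 * 1 + 3 E(f)`.
    set B : ℝ := ∑' x, G.m x * ((1 + |U x|) * f x ^ 2)
      + (2 * 1 + 3 * ∑' p : V × V, G.w p.1 p.2 / 2 * (f p.1 - f p.2) ^ 2) with hB
    have hbound : ∀ k, ‖(⟨_, hψmem k⟩ : lp (fun _ : V ⊕ V × V => ℝ) 2)‖ ≤ √B := by
      intro k
      refine Real.le_sqrt_of_sq_le ?_
      rw [ellTwo_norm_sq, G.tsum_emb_sq (hψmem k)]
      obtain ⟨h1, h2⟩ := G.memℓp_emb_iff.1 (hψmem k)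
      refine add_le_add (h1.tsum_le_tsum (fun x => ?_) hfm) ?_
      · have := G.m_pos x
        refine mul_le_mul_of_nonneg_left (mul_le_mul_of_nonneg_left ?_ (by positivity)) this.le
        exact sq_le_sq.2 (abs_clamp_le _ _)
      · refine (h2.tsum_le_tsum (fun p => ?_) (((hes k).mul_left 2).add (hfe.mul_left 3))).trans ?_
        · have h3 := div_nonneg (G.w_nonneg p.1 p.2) zero_le_two
          rw [mul_left_comm, mul_left_comm 3, ← mul_add]
          refine mul_le_mul_of_nonneg_left ((clamp_sub_sq_le _ _ _ _).trans ?_) h3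
          nlinarith [sq_nonneg (((f p.1 - φ k p.1) - (f p.2 - φ k p.2)) + (f p.1 - f p.2))]
        · rw [((hes k).mul_left 2).tsum_add (hfe.mul_left 3), tsum_mul_left, tsum_mul_left]
          linarith [hen k]
    refine ⟨⟨_, hfmem⟩, ?_, fun i => rfl⟩
    -- Bounded norms and pointwise convergence give weak convergence only; this is enough, since a
    -- norm-closed subspace is weakly closed.
    refine mem_closure_of_tendsto_coord (l := atTop) (C := √B) (G.finCore U)
      (fun k => Submodule.le_topologicalClosure _ ⟨ψ k, hψfin k, fun i => rfl⟩) hbound ?_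
    refine G.tendsto_emb U fun x => ?_
    have h1 := (tendsto_const_nhds (x := -|f x|)).max
      ((hptw x).min (tendsto_const_nhds (x := |f x|)))
    rwa [clamp_self] at h1
  · rintro ⟨a, ha, haf⟩
    have hmem : Memℓp (G.emb U f) 2 := by
      have := lp.memℓp a
      rwa [show (a : V ⊕ V × V → ℝ) = G.emb U f from funext haf] at this
    obtain ⟨h1, h2⟩ := G.memℓp_emb_iff.1 hmem
    have hm : ∀ x, 0 ≤ G.m x := fun x => (G.m_pos x).le
    refine ⟨⟨?_, fun ε hε => ?_⟩, ?_⟩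
    · refine (G.memLp_two_iff f).2 (Summable.of_nonneg_of_le
        (fun x => mul_nonneg (hm x) (sq_nonneg _)) (fun x => ?_) h1)
      refine mul_le_mul_of_nonneg_left ?_ (hm x)
      nlinarith [mul_nonneg (abs_nonneg (U x)) (sq_nonneg (f x))]
    · obtain ⟨δ, hδ, hδε⟩ := ENNReal.lt_iff_exists_nnreal_btwn.1 hε
      have hδ0 : (0 : ℝ) < δ := by exact_mod_cast hδ
      obtain ⟨b, hb, hab⟩ := Metric.mem_closure_iff.1 ha (√δ) (Real.sqrt_pos.2 hδ0)
      obtain ⟨φ, hφ, hbφ⟩ := hb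
      refine ⟨φ, hφ, lt_of_le_of_lt ?_ hδε⟩
      have hsub : Memℓp (G.emb U (f - φ)) 2 := by
        have := lp.memℓp (a - b)
        rwa [show ((a - b : lp (fun _ : V ⊕ V × V => ℝ) 2) : V ⊕ V × V → ℝ) = G.emb U (f - φ) from
          funext fun i => by rw [emb_sub, ← haf, ← hbφ]; rfl] at this
      obtain ⟨h3, h4⟩ := G.memℓp_emb_iff.1 hsub
      have h5 : ∑' i, G.emb U (f - φ) i ^ 2 ≤ δ := by
        rw [dist_eq_norm] at hab
        have h6 : ‖a - b‖ ^ 2 ≤ √δ ^ 2 := pow_le_pow_left₀ (norm_nonneg _) hab.le 2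
        rw [Real.sq_sqrt hδ0.le, ellTwo_norm_sq] at h6
        refine le_of_eq_of_le (tsum_congr fun i => ?_) h6
        rw [emb_sub, ← haf, ← hbφ]
        rfl
      rw [G.tsum_emb_sq hsub] at h5
      have h7 : Summable fun x => G.m x * (f x - φ x) ^ 2 := Summable.of_nonneg_of_le
        (fun x => mul_nonneg (hm x) (sq_nonneg _)) (fun x => by
          refine mul_le_mul_of_nonneg_left ?_ (hm x)
          simp only [Pi.sub_apply]
          nlinarith [mul_nonneg (abs_nonneg (U x)) (sq_nonneg (f x - φ x))]) h3
      have h8 : ∑' x, G.m x * (f x - φ x) ^ 2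
          ≤ ∑' x, G.m x * ((1 + |U x|) * (f - φ) x ^ 2) := by
        refine h7.tsum_le_tsum (fun x => ?_) h3
        refine mul_le_mul_of_nonneg_left ?_ (hm x)
        simp only [Pi.sub_apply]
        nlinarith [mul_nonneg (abs_nonneg (U x)) (sq_nonneg (f x - φ x))]
      rw [G.energy_eq (f := fun x => f x - φ x) h4, eLpNorm_two_sq,
        ← ENNReal.ofReal_tsum_of_nonneg (fun x => mul_nonneg (hm x) (sq_nonneg _)) h7,
        ← ENNReal.ofReal_add (tsum_nonneg fun p => mul_nonneg
          (div_nonneg (G.w_nonneg _ _) zero_le_two) (sq_nonneg _))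
          (tsum_nonneg fun x => mul_nonneg (hm x) (sq_nonneg _)),
        ← ENNReal.ofReal_coe_nnreal]
      refine ENNReal.ofReal_le_ofReal ?_
      simp only [Pi.sub_apply] at h5 h8 ⊢
      linarith
    · refine Summable.of_nonneg_of_le (fun x => mul_nonneg (hm x)
        (mul_nonneg (abs_nonneg _) (sq_nonneg _))) (fun x => ?_) h1
      refine mul_le_mul_of_nonneg_left ?_ (hm x)
      nlinarith [sq_nonneg (f x)]

end

section

variable {V : Type*} (G : MWG V)

/-! ### The form sum as a bounded form on `ℓ²` -/

/-- The multiplier representing the form `Q + U` on `ℓ²`. -/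
def formMult (U : V → ℝ) : V ⊕ V × V → ℝ := Sum.elim (fun x => U x / (1 + |U x|)) fun _ => 1

/-- The multiplier representing the `L²` inner product on `ℓ²`. -/
def massMult (U : V → ℝ) : V ⊕ V × V → ℝ := Sum.elim (fun x => 1 / (1 + |U x|)) fun _ => 0

theorem abs_formMult_le (U : V → ℝ) (i : V ⊕ V × V) : |formMult U i| ≤ 1 := by
  cases i with
  | inl x =>
    have := abs_nonneg (U x)
    simp only [formMult, Sum.elim_inl]
    rw [abs_div, abs_of_nonneg (by positivity : 0 ≤ 1 + |U x|), div_le_one (by positivity)]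
    linarith
  | inr p => simp [formMult]

theorem abs_massMult_le (U : V → ℝ) (i : V ⊕ V × V) : |massMult U i| ≤ 1 := by
  cases i with
  | inl x =>
    have := abs_nonneg (U x)
    simp only [massMult, Sum.elim_inl]
    rw [abs_of_nonneg (by positivity), div_le_one (by positivity)]
    linarith
  | inr p => simp [massMult]

theorem inner_diagOp_eq {s : V ⊕ V × V → ℝ} (hs : ∀ i, |s i| ≤ 1)
    (a b : lp (fun _ : V ⊕ V × V => ℝ) 2) :
    inner ℝ a (diagOp s hs b) = ∑' x, a (Sum.inl x) * (s (Sum.inl x) * b (Sum.inl x))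
      + ∑' p, a (Sum.inr p) * (s (Sum.inr p) * b (Sum.inr p)) := by
  have h := ellTwo_summable_mul a (diagOp s hs b)
  rw [ellTwo_inner, Summable.tsum_sum (h.comp_injective Sum.inl_injective)
    (h.comp_injective Sum.inr_injective)]
  rfl

/-- Relative to the weights of `emb` the form is multiplication by a function bounded by `1`. It is
thus continuous on `ℓ²`, and relations checked on finitely supported functions extend to the
closure. -/
theorem schroForm_eq_inner {U f g : V → ℝ} {a b : lp (fun _ : V ⊕ V × V => ℝ) 2}
    (ha : ∀ i, a i = G.emb U f i) (hb : ∀ i, b i = G.emb U g i) :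
    G.schroForm U f g = inner ℝ a (diagOp (formMult U) (abs_formMult_le U) b) := by
  rw [inner_diagOp_eq, schroForm, Q, ip, add_comm, ← tsum_mul_left]
  congr 1
  · refine tsum_congr fun x => ?_
    rw [ha, hb, emb_inl, emb_inl]
    have h1 : 0 < 1 + |U x| := by positivity
    have h2 := Real.mul_self_sqrt (mul_pos (G.m_pos x) h1).le
    simp only [formMult, Sum.elim_inl]
    field_simp
    linear_combination (-f x * U x * g x) * h2
  · refine tsum_congr fun p => ?_
    rw [ha, hb, emb_inr, emb_inr]
    have h2 := Real.mul_self_sqrt (div_nonneg (G.w_nonneg p.1 p.2) zero_le_two)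
    simp only [formMult, Sum.elim_inr]
    linear_combination (-(f p.1 - f p.2) * (g p.1 - g p.2)) * h2

theorem ip_eq_inner {U f g : V → ℝ} {a b : lp (fun _ : V ⊕ V × V => ℝ) 2}
    (ha : ∀ i, a i = G.emb U f i) (hb : ∀ i, b i = G.emb U g i) :
    G.ip f g = inner ℝ a (diagOp (massMult U) (abs_massMult_le U) b) := by
  rw [inner_diagOp_eq, ip]
  have h0 : ∀ p : V × V, a (Sum.inr p) * (massMult U (Sum.inr p) * b (Sum.inr p)) = 0 :=
    fun p => by simp [massMult]
  simp_rw [h0]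
  rw [tsum_zero, add_zero]
  refine tsum_congr fun x => ?_
  rw [ha, hb, emb_inl, emb_inl]
  have h1 : 0 < 1 + |U x| := by positivity
  have h2 := Real.mul_self_sqrt (mul_pos (G.m_pos x) h1).le
  simp only [massMult, Sum.elim_inl]
  field_simp
  linear_combination (-f x * g x) * h2

/-- The representing vector is written down explicitly; the extra weight `1 + |U|` sits in the
denominator of its squares, so `g` in `L²` suffices. -/
theorem exists_ip_eq_inner (U : V → ℝ) {g : V → ℝ} (hg : Summable fun x => G.m x * g x ^ 2) :
    ∃ c : lp (fun _ : V ⊕ V × V => ℝ) 2, ∀ (f : V → ℝ) (a : lp (fun _ : V ⊕ V × V => ℝ) 2),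
      (∀ i, a i = G.emb U f i) → G.ip g f = inner ℝ c a := by
  set c : V ⊕ V × V → ℝ :=
    Sum.elim (fun x => G.m x * g x / √(G.m x * (1 + |U x|))) fun _ => 0 with hc
  have hpos : ∀ x, 0 < G.m x * (1 + |U x|) := fun x =>
    mul_pos (G.m_pos x) (by positivity)
  have hcm : Memℓp c 2 := by
    rw [memℓp_two_iff]
    refine Summable.sum _ ?_ ?_
    · refine Summable.of_nonneg_of_le (fun x => sq_nonneg _) (fun x => ?_) hg
      simp only [hc, Function.comp_apply, Sum.elim_inl]
      rw [div_pow, Real.sq_sqrt (hpos x).le, div_le_iff₀ (hpos x)]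
      have := mul_nonneg (mul_nonneg (sq_nonneg (G.m x)) (abs_nonneg (U x))) (sq_nonneg (g x))
      linarith
    · refine summable_zero.congr fun p => ?_
      simp [hc]
  refine ⟨⟨c, hcm⟩, fun f a ha => ?_⟩
  have h := ellTwo_summable_mul ⟨c, hcm⟩ a
  rw [ellTwo_inner, Summable.tsum_sum (h.comp_injective Sum.inl_injective)
    (h.comp_injective Sum.inr_injective)]
  have h0 : ∀ p : V × V, c (Sum.inr p) * a (Sum.inr p) = 0 := fun p => by simp [hc]
  simp only [h0, tsum_zero, add_zero, ip]
  refine tsum_congr fun x => ?_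
  rw [ha, emb_inl]
  have h2 := (Real.sqrt_pos.2 (hpos x)).ne'
  simp only [hc, Sum.elim_inl]
  field_simp

/-- The form `Q + U + l` controls the form norm on finitely supported functions. -/
structure Coercive (U : V → ℝ) (l C : ℝ) : Prop where
  l_nonneg : 0 ≤ l
  C_pos : 0 < C
  le : ∀ φ : V → ℝ, φ.support.Finite →
    ∑' i, G.emb U φ i ^ 2 ≤ C * (G.schroForm U φ φ + l * G.ip φ φ)

variable {G} {U : V → ℝ} {l C : ℝ}

theorem Coercive.lowerBound (h : G.Coercive U l C) : G.LowerBound U l := fun φ hφ => by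
  have h1 := (tsum_nonneg fun i => sq_nonneg (G.emb U φ i)).trans (h.le φ hφ)
  have h2 := nonneg_of_mul_nonneg_right h1 h.C_pos
  linarith

/-- Both sides are continuous on `ℓ²`, so the inequality passes from finitely supported functions to
their closure. -/
theorem Coercive.norm_sq_le (h : G.Coercive U l C) {f : V → ℝ}
    {a : lp (fun _ : V ⊕ V × V => ℝ) 2} (ha : a ∈ (G.finCore U).topologicalClosure)
    (haf : ∀ i, a i = G.emb U f i) :
    ‖a‖ ^ 2 ≤ C * (G.schroForm U f f + l * G.ip f f) := by
  rw [G.schroForm_eq_inner haf haf, G.ip_eq_inner haf haf]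
  have hclosed : IsClosed {b : lp (fun _ : V ⊕ V × V => ℝ) 2 | ‖b‖ ^ 2 ≤
      C * (inner ℝ b (diagOp (formMult U) (abs_formMult_le U) b)
        + l * inner ℝ b (diagOp (massMult U) (abs_massMult_le U) b))} :=
    isClosed_le (by fun_prop) (by fun_prop)
  refine closure_minimal ?_ hclosed ha
  rintro b ⟨φ, hφ, hb⟩
  rw [Set.mem_ofPred_eq, ← G.schroForm_eq_inner hb hb, ← G.ip_eq_inner hb hb, ellTwo_norm_sq]
  simp_rw [hb]
  exact h.le φ hφ

/-! ### Testing on the core, and closedness of the operator -/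

variable [Countable V] [MeasurableSpace V] [DiscreteMeasurableSpace V]

theorem mem_formDomPot_of_finite (U : V → ℝ) {φ : V → ℝ} (hφ : φ.support.Finite) :
    φ ∈ G.formDomPot U :=
  G.mem_formDomPot_iff.2 ⟨⟨_, G.memℓp_emb_of_finite U hφ⟩,
    Submodule.le_topologicalClosure _ ⟨φ, hφ, fun _ => rfl⟩, fun _ => rfl⟩

theorem Coercive.schroForm_lower (h : G.Coercive U l C) {f : V → ℝ} (hf : f ∈ G.formDomPot U) :
    -(l * G.ip f f) ≤ G.schroForm U f f := by
  obtain ⟨a, ha, haf⟩ := G.mem_formDomPot_iff.1 hf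
  have h2 := nonneg_of_mul_nonneg_right ((sq_nonneg _).trans (h.norm_sq_le ha haf)) h.C_pos
  linarith

/-- The weak equation `(L + U) u = g` need only be tested on finitely supported functions. -/
theorem isSchrodinger_of_core {u g : Lp ℝ 2 G.vol} (hu : (u : V → ℝ) ∈ G.formDomPot U)
    (h : ∀ φ : V → ℝ, φ.support.Finite → G.schroForm U u φ = G.ip g φ) :
    G.IsSchrodinger U u g := by
  refine ⟨hu, fun v hv => ?_⟩
  change G.schroForm U u v = G.ip g v
  obtain ⟨a, ha, hau⟩ := G.mem_formDomPot_iff.1 hu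
  obtain ⟨b, hb, hbv⟩ := G.mem_formDomPot_iff.1 hv
  obtain ⟨c, hc⟩ := G.exists_ip_eq_inner U (G.summable_sq_Lp g)
  rw [G.schroForm_eq_inner hau hbv, hc v b hbv]
  have hclosed : IsClosed {b : lp (fun _ : V ⊕ V × V => ℝ) 2 |
      inner ℝ a (diagOp (formMult U) (abs_formMult_le U) b) = inner ℝ c b} :=
    isClosed_eq (by fun_prop) (by fun_prop)
  refine closure_minimal ?_ hclosed hb
  rintro d ⟨φ, hφ, hd⟩
  rw [Set.mem_ofPred_eq, ← G.schroForm_eq_inner hau hd, ← hc φ d hd]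
  exact h φ hφ

/-- Lower semicontinuity of the form norm: a pointwise limit of a family bounded in this norm stays
in the domain, with no norm convergence needed. -/
theorem mem_formDomPot_of_tendsto {κ : Type*} {L : Filter κ} [L.NeBot] {f : κ → V → ℝ}
    {g : V → ℝ} {a : κ → lp (fun _ : V ⊕ V × V => ℝ) 2} {B : ℝ}
    (ha : ∀ k, a k ∈ (G.finCore U).topologicalClosure) (haf : ∀ k i, a k i = G.emb U (f k) i)
    (hB : ∀ k, ‖a k‖ ≤ B) (h : ∀ x, Tendsto (fun k => f k x) L (𝓝 (g x))) :
    g ∈ G.formDomPot U := by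
  have h1 : ∀ i, Tendsto (fun k => a k i) L (𝓝 (G.emb U g i)) := fun i => by
    simp_rw [haf]
    exact G.tendsto_emb U h i
  have hmem : Memℓp (G.emb U g) 2 :=
    lp.memℓp_of_tendsto (l := L) (F := a)
      (isBounded_iff_forall_norm_le.2 ⟨B, by rintro _ ⟨k, rfl⟩; exact hB k⟩)
      (tendsto_pi_nhds.2 h1)
  exact G.mem_formDomPot_iff.2 ⟨⟨_, hmem⟩, mem_closure_of_tendsto_coord _ ha hB h1, fun _ => rfl⟩

theorem tendsto_Lp_apply {κ : Type*} {L : Filter κ} {u : κ → Lp ℝ 2 G.vol} {v : Lp ℝ 2 G.vol}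
    (h : Tendsto u L (𝓝 v)) (x : V) : Tendsto (fun k => u k x) L (𝓝 (v x)) :=
  ((G.evalLp x).continuous.tendsto v).comp h

theorem ip_eq_sum_support (g : V → ℝ) {φ : V → ℝ} (hφ : φ.support.Finite) :
    G.ip g φ = ∑ x ∈ hφ.toFinset, G.m x * (g x * φ x) :=
  G.ip_eq_sum g (notMem_support_toFinset hφ)

/-- The operator `L + U` is closed. -/
theorem Coercive.isSchrodinger_of_tendsto (h : G.Coercive U l C) {u g : ℕ → Lp ℝ 2 G.vol}
    {u₀ g₀ : Lp ℝ 2 G.vol} (hs : ∀ k, G.IsSchrodinger U (u k) (g k))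
    (hu : Tendsto u atTop (𝓝 u₀)) (hg : Tendsto g atTop (𝓝 g₀)) : G.IsSchrodinger U u₀ g₀ := by
  choose a ha hau using fun k => G.mem_formDomPot_iff.1 (hs k).1
  obtain ⟨Bu, hBu⟩ := hu.norm.bddAbove_range
  obtain ⟨Bg, hBg⟩ := hg.norm.bddAbove_range
  have hBu' : ∀ k, ‖u k‖ ≤ Bu := fun k => hBu ⟨k, rfl⟩
  have hBg' : ∀ k, ‖g k‖ ≤ Bg := fun k => hBg ⟨k, rfl⟩
  have hu0 : 0 ≤ Bu := (norm_nonneg _).trans (hBu' 0)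
  refine isSchrodinger_of_core (mem_formDomPot_of_tendsto (L := atTop) ha hau
    (B := √(C * (Bg * Bu + l * Bu ^ 2))) (fun k => ?_) fun x => tendsto_Lp_apply hu x) ?_
  -- Testing the equation for `u k` with `u k` itself turns its form value into the pairing of `g k`
  -- with `u k`, which the norm bounds control.
  · refine Real.le_sqrt_of_sq_le ((h.norm_sq_le (ha k) (hau k)).trans ?_)
    refine mul_le_mul_of_nonneg_left (add_le_add ?_ (mul_le_mul_of_nonneg_left ?_ h.l_nonneg))
      h.C_pos.le
    · have h1 : G.schroForm U (u k) (u k) = inner ℝ (g k) (u k) := by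
        rw [inner_Lp]
        exact (hs k).2 _ (hs k).1
      rw [h1]
      exact (real_inner_le_norm _ _).trans
        (mul_le_mul (hBg' k) (hBu' k) (norm_nonneg _) ((norm_nonneg _).trans (hBg' 0)))
    · rw [← inner_Lp, real_inner_self_eq_norm_sq]
      exact pow_le_pow_left₀ (norm_nonneg _) (hBu' k) 2
  · intro φ hφ
    refine tendsto_nhds_unique (G.tendsto_schroForm U (fun x => tendsto_Lp_apply hu x) hφ) ?_
    have h1 : ∀ k, G.schroForm U (u k) φ = G.ip (g k) φ := fun k =>
      (hs k).2 φ (mem_formDomPot_of_finite U hφ)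
    simp_rw [h1, ip_eq_sum_support _ hφ]
    exact tendsto_finsetSum _ fun x _ => ((tendsto_Lp_apply hg x).mul_const _).const_mul _

end

section

variable {V : Type*} {G : MWG V} {U : V → ℝ} {l C : ℝ} {F : Finset V}

/-! ### Time integrals of the Dirichlet heat flow -/

variable (G) in
/-- The time integral of the Dirichlet heat flow. -/
def heatInt (U : V → ℝ) (F : Finset V) (t : ℝ) (f : V → ℝ) (x : V) : ℝ :=
  ∫ s in (0 : ℝ)..t, G.heat U F s f x

theorem heatInt_notMem (t : ℝ) (f : V → ℝ) {x : V} (hx : x ∉ F) : G.heatInt U F t f x = 0 := by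
  simp [heatInt, heat_notMem _ _ hx]

theorem intervalIntegrable_heat (f : V → ℝ) (x : V) (a b : ℝ) :
    IntervalIntegrable (fun s => G.heat U F s f x) volume a b :=
  (continuous_heat f x).intervalIntegrable a b

theorem lap_integral {u : ℝ → V → ℝ} {a b : ℝ}
    (hu : ∀ x, IntervalIntegrable (fun s => u s x) volume a b) (x : V) :
    G.lap (fun y => ∫ s in a..b, u s y) x = ∫ s in a..b, G.lap (u s) x := by
  simp only [lap_eq_sum]
  rw [intervalIntegral.integral_finsetSum fun y _ => ((hu y).sub (hu x)).const_mul _]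
  refine Finset.sum_congr rfl fun y _ => ?_
  rw [intervalIntegral.integral_const_mul, intervalIntegral.integral_sub (hu y) (hu x)]

theorem intervalIntegrable_lap {u : ℝ → V → ℝ} {a b : ℝ}
    (hu : ∀ x, IntervalIntegrable (fun s => u s x) volume a b) (x : V) :
    IntervalIntegrable (fun s => G.lap (u s) x) volume a b := by
  simp only [lap_eq_sum]
  have := IntervalIntegrable.sum (G.nbr x) (μ := volume) (a := a) (b := b)
    (f := fun y s => G.w x y / G.m x * (u s y - u s x))
    fun y _ => ((hu y).sub (hu x)).const_mul _
  simpa [Finset.sum_fn] using this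

/-- The heat equation integrated over `[0,t]`: the accumulated flow solves the stationary equation
with right-hand side `f - P_t f`. -/
theorem lap_heatInt (t : ℝ) (f : V → ℝ) {x : V} (hx : x ∈ F) :
    -G.lap (G.heatInt U F t f) x + U x * G.heatInt U F t f x = f x - G.heat U F t f x := by
  have hint := fun y => intervalIntegrable_heat (G := G) (U := U) (F := F) f y 0 t
  have h1 := intervalIntegral.integral_eq_sub_of_hasDerivAt (a := 0) (b := t)
    (fun s _ => hasDerivAt_heat (G := G) (U := U) s f hx)
    ((intervalIntegrable_lap hint x).sub ((hint x).const_mul _))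
  rw [intervalIntegral.integral_sub (intervalIntegrable_lap hint x) ((hint x).const_mul _),
    intervalIntegral.integral_const_mul, ← lap_integral hint, heat_zero f hx] at h1
  simp only [heatInt] at *
  change -G.lap (fun y => ∫ s in (0 : ℝ)..t, G.heat U F s f y) x + _ = _
  linarith

theorem sum_mul_le_sqrt (F : Finset V) (g h : V → ℝ) :
    ∑ x ∈ F, G.m x * (g x * h x)
      ≤ √(∑ x ∈ F, G.m x * g x ^ 2) * √(∑ x ∈ F, G.m x * h x ^ 2) := by
  have h1 := Real.sum_mul_le_sqrt_mul_sqrt F (fun x => √(G.m x) * g x) fun x => √(G.m x) * h x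
  have h2 : ∀ x, √(G.m x) ^ 2 = G.m x := fun x => Real.sq_sqrt (G.m_pos x).le
  simp only [mul_pow, h2] at h1
  refine le_of_eq_of_le (Finset.sum_congr rfl fun x _ => ?_) h1
  linear_combination (-(g x * h x)) * h2 x

/-- Minkowski's integral inequality in dual form: Cauchy–Schwarz and the energy estimate are applied
under the time integral. -/
theorem sum_mul_heatInt_le (hl0 : 0 ≤ l) (hl : G.LowerBound U l) {t : ℝ} (ht : 0 ≤ t)
    (f g : V → ℝ) :
    ∑ x ∈ F, G.m x * (g x * G.heatInt U F t f x)
      ≤ √(∑ x ∈ F, G.m x * g x ^ 2) *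
        (t * (Real.exp (l * t) * √(∑ x ∈ F, G.m x * f x ^ 2))) := by
  have hint := fun y => intervalIntegrable_heat (G := G) (U := U) (F := F) f y 0 t
  have h1 : ∑ x ∈ F, G.m x * (g x * G.heatInt U F t f x)
      = ∫ s in (0 : ℝ)..t, ∑ x ∈ F, G.m x * (g x * G.heat U F s f x) := by
    rw [intervalIntegral.integral_finsetSum fun x _ => ((hint x).const_mul _).const_mul _]
    simp only [intervalIntegral.integral_const_mul, heatInt]
  have h2 : ∀ s ∈ Set.Icc 0 t, ∑ x ∈ F, G.m x * (g x * G.heat U F s f x)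
      ≤ √(∑ x ∈ F, G.m x * g x ^ 2) * (Real.exp (l * t) * √(∑ x ∈ F, G.m x * f x ^ 2)) := by
    intro s hs
    refine (sum_mul_le_sqrt F _ _).trans (mul_le_mul_of_nonneg_left ?_ (Real.sqrt_nonneg _))
    refine (Real.sqrt_le_sqrt (heat_sq_le hl hs.1 f)).trans ?_
    rw [Real.sqrt_mul (Real.exp_pos _).le, show 2 * l * s = l * s + l * s by ring, Real.exp_add,
      Real.sqrt_mul_self (Real.exp_pos _).le]
    exact mul_le_mul_of_nonneg_right (Real.exp_le_exp.2 (mul_le_mul_of_nonneg_left hs.2 hl0))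
      (Real.sqrt_nonneg _)
  rw [h1]
  have hc : Continuous fun s => ∑ x ∈ F, G.m x * (g x * G.heat U F s f x) :=
    continuous_finsetSum _ fun x _ => ((continuous_heat f x).const_mul _).const_mul _
  refine (intervalIntegral.integral_mono_on ht (hc.intervalIntegrable 0 t)
    intervalIntegrable_const h2).trans ?_
  rw [intervalIntegral.integral_const, sub_zero, smul_eq_mul]
  exact le_of_eq (by ring)

variable [Countable V] [MeasurableSpace V] [DiscreteMeasurableSpace V]

theorem sum_sq_le_norm_sq (F : Finset V) (f : Lp ℝ 2 G.vol) :
    ∑ x ∈ F, G.m x * f x ^ 2 ≤ ‖f‖ ^ 2 := by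
  rw [norm_sq_Lp]
  exact (G.summable_sq_Lp f).sum_le_tsum F fun x _ => mul_nonneg (G.m_pos x).le (sq_nonneg _)

theorem abs_heat_le (hl0 : 0 ≤ l) (hl : G.LowerBound U l) {t s : ℝ} (hs : 0 ≤ s) (hst : s ≤ t)
    (f : Lp ℝ 2 G.vol) (x : V) :
    |G.heat U F s f x| ≤ √(Real.exp (2 * l * t) * ‖f‖ ^ 2 / G.m x) := by
  refine Real.abs_le_sqrt ?_
  rw [le_div_iff₀ (G.m_pos x)]
  by_cases hx : x ∈ F
  · rw [mul_comm]
    refine (Finset.single_le_sum (f := fun x => G.m x * G.heat U F s f x ^ 2)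
      (fun y _ => mul_nonneg (G.m_pos y).le (sq_nonneg _)) hx).trans ?_
    refine (heat_sq_le hl hs f).trans (mul_le_mul ?_ (sum_sq_le_norm_sq F f) ?_ ?_)
    · exact Real.exp_le_exp.2 (mul_le_mul_of_nonneg_left hst (by positivity))
    · exact Finset.sum_nonneg fun y _ => mul_nonneg (G.m_pos y).le (sq_nonneg _)
    · exact (Real.exp_pos _).le
  · rw [heat_notMem _ _ hx]
    have := Real.exp_pos (2 * l * t)
    simp only [ne_eq, OfNat.ofNat_ne_zero, not_false_eq_true, zero_pow, zero_mul]
    positivity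

theorem intervalIntegrable_heatOp (hl0 : 0 ≤ l) (hl : G.LowerBound U l) {t : ℝ} (ht : 0 ≤ t)
    (f : Lp ℝ 2 G.vol) : IntervalIntegrable (fun s => G.heatOp U s f) volume 0 t := by
  refine ContinuousOn.intervalIntegrable ((continuousOn_heatOp hl0 hl f).mono ?_)
  rw [Set.uIcc_of_le ht]
  exact fun s hs => hs.1

theorem tendsto_heatInt (hl0 : 0 ≤ l) (hl : G.LowerBound U l) {t : ℝ} (ht : 0 ≤ t)
    (f : Lp ℝ 2 G.vol) (x : V) :
    Tendsto (fun F : Finset V => G.heatInt U F t f x) atTop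
      (𝓝 ((∫ s in (0 : ℝ)..t, G.heatOp U s f : Lp ℝ 2 G.vol) x)) := by
  have h1 : (∫ s in (0 : ℝ)..t, G.heatOp U s f : Lp ℝ 2 G.vol) x
      = ∫ s in (0 : ℝ)..t, G.heatOp U s f x := by
    rw [← evalLp_apply, ← ContinuousLinearMap.intervalIntegral_comp_comm _
      (intervalIntegrable_heatOp hl0 hl ht f)]
    rfl
  rw [h1]
  refine intervalIntegral.tendsto_integral_filter_of_dominated_convergence
    (fun _ => √(Real.exp (2 * l * t) * ‖f‖ ^ 2 / G.m x)) ?_ ?_ intervalIntegrable_const ?_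
  · exact Eventually.of_forall fun F => (continuous_heat _ x).aestronglyMeasurable
  · refine Eventually.of_forall fun F => Eventually.of_forall fun s hs => ?_
    rw [Set.uIoc_of_le ht] at hs
    exact abs_heat_le hl0 hl hs.1.le hs.2 f x
  · refine Eventually.of_forall fun s hs => ?_
    rw [Set.uIoc_of_le ht] at hs
    exact tendsto_heat_heatOp hl hs.1.le f x

/-- The finite-set integrals `v F` are finitely supported and solve the equation on `F`. Coercivity
bounds their form norm uniformly in `F`, so the pointwise limit is in the form domain. Each finitely
supported test function eventually sees only vertices of `F`, where the equation holds exactly. -/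
theorem Coercive.isSchrodinger_integral (h : G.Coercive U l C) {t : ℝ} (ht : 0 ≤ t)
    (f : Lp ℝ 2 G.vol) :
    G.IsSchrodinger U (∫ s in (0 : ℝ)..t, G.heatOp U s f) (f - G.heatOp U t f) := by
  have hl := h.lowerBound
  have hl0 := h.l_nonneg
  set v : Finset V → V → ℝ := fun F => G.heatInt U F t f
  have hoff : ∀ F : Finset V, ∀ x ∉ F, v F x = 0 := fun F x hx => heatInt_notMem _ _ hx
  have hvfin : ∀ F, (v F).support.Finite := fun F => F.finite_toSet.subset fun x hx => by
    by_contra h'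
    exact hx (hoff F x h')
  have hlim : ∀ x, Tendsto (fun F => v F x) atTop
      (𝓝 ((∫ s in (0 : ℝ)..t, G.heatOp U s f : Lp ℝ 2 G.vol) x)) := tendsto_heatInt hl0 hl ht f
  set K : ℝ := t * (Real.exp (l * t) * ‖f‖) with hK
  have hK0 : 0 ≤ K := by positivity
  have hdual : ∀ (F : Finset V) (g : V → ℝ), ∑ x ∈ F, G.m x * (g x * v F x)
      ≤ √(∑ x ∈ F, G.m x * g x ^ 2) * K := fun F g => by
    refine (sum_mul_heatInt_le hl0 hl ht f g).trans
      (mul_le_mul_of_nonneg_left (mul_le_mul_of_nonneg_left ?_ ht) (Real.sqrt_nonneg _))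
    refine mul_le_mul_of_nonneg_left (Real.sqrt_le_iff.2 ⟨norm_nonneg _, ?_⟩) (Real.exp_pos _).le
    exact sum_sq_le_norm_sq F f
  have hip : ∀ F, G.ip (v F) (v F) ≤ K ^ 2 := fun F => by
    have h1 := hdual F (v F)
    rw [G.ip_eq_sum _ (hoff F)]
    have h2 : ∑ x ∈ F, G.m x * (v F x * v F x) = ∑ x ∈ F, G.m x * v F x ^ 2 := by simp only [sq]
    rw [h2] at h1 ⊢
    set n := ∑ x ∈ F, G.m x * v F x ^ 2
    have hn : 0 ≤ n := Finset.sum_nonneg fun y _ => mul_nonneg (G.m_pos y).le (sq_nonneg _)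
    have h3 := Real.sq_sqrt hn
    -- Duality with `g = v F` gives `n ≤ √n K`, from which one factor `√n` is cancelled.
    have h4 : √n ≤ K := by
      by_contra hcon
      rw [not_le] at hcon
      nlinarith [mul_pos (hK0.trans_lt hcon) (sub_pos.2 hcon)]
    rw [← h3]
    exact pow_le_pow_left₀ (Real.sqrt_nonneg _) h4 2
  set R : ℝ := √(2 * ‖f‖ ^ 2 + 2 * (Real.exp (2 * l * t) * ‖f‖ ^ 2))
  have hform : ∀ F, G.schroForm U (v F) (v F) ≤ R * K := fun F => by
    have h1 := hdual F fun x => f x - G.heat U F t f x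
    rw [G.schroForm_eq_sum U _ (hoff F),
      Finset.sum_congr rfl fun x hx => by rw [lap_heatInt t f hx]]
    refine h1.trans (mul_le_mul_of_nonneg_right (Real.sqrt_le_sqrt ?_) hK0)
    have h2 : ∑ x ∈ F, G.m x * (f x - G.heat U F t f x) ^ 2
        ≤ ∑ x ∈ F, (2 * (G.m x * f x ^ 2) + 2 * (G.m x * G.heat U F t f x ^ 2)) := by
      refine Finset.sum_le_sum fun x _ => ?_
      nlinarith [mul_nonneg (G.m_pos x).le (sq_nonneg (f x + G.heat U F t f x))]
    rw [Finset.sum_add_distrib, ← Finset.mul_sum, ← Finset.mul_sum] at h2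
    have h3 := sum_sq_le_norm_sq F f
    have h4 := (heat_sq_le (F := F) hl ht f).trans
      (mul_le_mul_of_nonneg_left h3 (Real.exp_pos _).le)
    linarith
  refine isSchrodinger_of_core (mem_formDomPot_of_tendsto (L := atTop) (f := v)
    (a := fun F => ⟨_, G.memℓp_emb_of_finite U (hvfin F)⟩)
    (B := √(C * (R * K + l * K ^ 2)))
    (fun F => Submodule.le_topologicalClosure _ ⟨v F, hvfin F, fun _ => rfl⟩)
    (fun _ _ => rfl) (fun F => ?_) hlim) fun φ hφ => ?_
  · refine Real.le_sqrt_of_sq_le ?_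
    rw [ellTwo_norm_sq]
    refine (h.le _ (hvfin F)).trans (mul_le_mul_of_nonneg_left ?_ h.C_pos.le)
    exact add_le_add (hform F) (mul_le_mul_of_nonneg_left (hip F) hl0)
  · refine tendsto_nhds_unique (G.tendsto_schroForm U hlim hφ) ?_
    rw [ip_eq_sum_support _ hφ]
    have h1 : Tendsto (fun F : Finset V => ∑ x ∈ hφ.toFinset,
        G.m x * ((f x - G.heat U F t f x) * φ x)) atTop
        (𝓝 (∑ x ∈ hφ.toFinset, G.m x * ((f x - G.heatOp U t f x) * φ x))) :=
      tendsto_finsetSum _ fun x _ =>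
        ((tendsto_const_nhds.sub (tendsto_heat_heatOp hl ht f x)).mul_const _).const_mul _
    rw [coe_sub_Lp]
    refine h1.congr' ?_
    filter_upwards [eventually_ge_atTop hφ.toFinset] with F hF
    rw [G.schroForm_eq_sum U _ (notMem_support_toFinset hφ)]
    exact Finset.sum_congr rfl fun x hx => by rw [lap_heatInt t f (hF hx)]

/-! ### The minimal semigroup is generated by the form sum -/

theorem smul_mem_formDomPot {f : V → ℝ} (hf : f ∈ G.formDomPot U) (c : ℝ) :
    c • f ∈ G.formDomPot U := by
  obtain ⟨a, ha, haf⟩ := G.mem_formDomPot_iff.1 hf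
  refine G.mem_formDomPot_iff.2 ⟨c • a, Submodule.smul_mem _ c ha, fun i => ?_⟩
  rw [emb_smul, ← haf]
  rfl

theorem sub_mem_formDomPot {f g : V → ℝ} (hf : f ∈ G.formDomPot U) (hg : g ∈ G.formDomPot U) :
    f - g ∈ G.formDomPot U := by
  obtain ⟨a, ha, haf⟩ := G.mem_formDomPot_iff.1 hf
  obtain ⟨b, hb, hbg⟩ := G.mem_formDomPot_iff.1 hg
  refine G.mem_formDomPot_iff.2 ⟨a - b, Submodule.sub_mem _ ha hb, fun i => ?_⟩
  rw [emb_sub, ← haf, ← hbg]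
  rfl

theorem IsSchrodinger.smul {u g : Lp ℝ 2 G.vol} (h : G.IsSchrodinger U u g) (c : ℝ) :
    G.IsSchrodinger U (c • u) (c • g) := by
  refine isSchrodinger_of_core ?_ fun φ hφ => ?_
  · rw [coe_smul_Lp]
    exact smul_mem_formDomPot h.1 c
  · have h1 : G.schroForm U u φ = G.ip g φ := h.2 φ (mem_formDomPot_of_finite U hφ)
    rw [G.schroForm_eq_sum U _ (notMem_support_toFinset hφ), ip_eq_sum_support _ hφ] at h1 ⊢
    rw [coe_smul_Lp, coe_smul_Lp]
    simp only [lap_smul, Pi.smul_apply, smul_eq_mul]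
    calc _ = c * ∑ x ∈ hφ.toFinset, G.m x * ((-G.lap u x + U x * u x) * φ x) := by
          rw [Finset.mul_sum]
          exact Finset.sum_congr rfl fun x _ => by ring
      _ = _ := by
          rw [h1, Finset.mul_sum]
          exact Finset.sum_congr rfl fun x _ => by ring

theorem IsSchrodinger.sub {u g v k : Lp ℝ 2 G.vol} (hu : G.IsSchrodinger U u g)
    (hv : G.IsSchrodinger U v k) : G.IsSchrodinger U (u - v) (g - k) := by
  refine isSchrodinger_of_core ?_ fun φ hφ => ?_
  · rw [coe_sub_Lp]
    exact sub_mem_formDomPot hu.1 hv.1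
  · have h1 : G.schroForm U u φ = G.ip g φ := hu.2 φ (mem_formDomPot_of_finite U hφ)
    have h2 : G.schroForm U v φ = G.ip k φ := hv.2 φ (mem_formDomPot_of_finite U hφ)
    rw [G.schroForm_eq_sum U _ (notMem_support_toFinset hφ), ip_eq_sum_support _ hφ] at h1 h2 ⊢
    rw [coe_sub_Lp, coe_sub_Lp]
    simp only [lap_sub, Pi.sub_apply]
    calc _ = ∑ x ∈ hφ.toFinset, G.m x * ((-G.lap u x + U x * u x) * φ x)
          - ∑ x ∈ hφ.toFinset, G.m x * ((-G.lap v x + U x * v x) * φ x) := by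
          rw [← Finset.sum_sub_distrib]
          exact Finset.sum_congr rfl fun x _ => by ring
      _ = _ := by
          rw [h1, h2, ← Finset.sum_sub_distrib]
          exact Finset.sum_congr rfl fun x _ => by ring

theorem IsSchrodinger.inner_symm {u g v k : Lp ℝ 2 G.vol} (hu : G.IsSchrodinger U u g)
    (hv : G.IsSchrodinger U v k) : inner ℝ g v = inner ℝ k u := by
  have h1 : G.schroForm U u v = G.ip g v := hu.2 _ hv.1
  have h2 : G.schroForm U v u = G.ip k u := hv.2 _ hu.1
  rw [inner_Lp, inner_Lp, ← h1, ← h2, schroForm_comm]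

theorem Coercive.tendsto_integral (h : G.Coercive U l C) (f : Lp ℝ 2 G.vol) :
    Tendsto (fun t : ℝ => t⁻¹ • ∫ s in (0 : ℝ)..t, G.heatOp U s f) (𝓝[>] 0) (𝓝 f) := by
  have hc := continuousOn_heatOp h.l_nonneg h.lowerBound f
  have h1 : HasDerivWithinAt (fun t => ∫ s in (0 : ℝ)..t, G.heatOp U s f) (G.heatOp U 0 f)
      (Set.Ioi 0) 0 := by
    refine (intervalIntegral.integral_hasDerivWithinAt_right (s := Set.Ici 0) (t := Set.Ioi 0)
      IntervalIntegrable.refl ?_ ?_).mono Set.Ioi_subset_Ici_self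
    · exact ⟨Set.Ioi 0, self_mem_nhdsWithin,
        (hc.mono Set.Ioi_subset_Ici_self).aestronglyMeasurable measurableSet_Ioi⟩
    · exact (hc 0 Set.self_mem_Ici).mono Set.Ioi_subset_Ici_self
  rw [hasDerivWithinAt_iff_tendsto_slope' (by simp)] at h1
  rw [heatOp_zero h.lowerBound, ContinuousLinearMap.id_apply] at h1
  refine h1.congr fun t => ?_
  simp [slope_def_module]

/-- Pair with an arbitrary `k`. The time integral of `P_s k` is in the domain with image `k - P_t
k`, so symmetry of `L + U` moves the operator onto `f`, and symmetry of `P_s` moves the flow onto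
`g`. -/
theorem Coercive.heatOp_sub_eq (h : G.Coercive U l C) {f g : Lp ℝ 2 G.vol}
    (hfg : G.IsSchrodinger U f g) {t : ℝ} (ht : 0 ≤ t) :
    G.heatOp U t f - f = -∫ s in (0 : ℝ)..t, G.heatOp U s g := by
  have hl := h.lowerBound
  refine ext_inner_right ℝ fun k => ?_
  have h1 := hfg.inner_symm (h.isSchrodinger_integral ht k)
  have h2 : inner ℝ g (∫ s in (0 : ℝ)..t, G.heatOp U s k)
      = inner ℝ (∫ s in (0 : ℝ)..t, G.heatOp U s g) k := by
    have h3 := ContinuousLinearMap.intervalIntegral_comp_comm (innerSL ℝ g)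
      (intervalIntegrable_heatOp h.l_nonneg hl ht k)
    have h4 := ContinuousLinearMap.intervalIntegral_comp_comm (innerSL ℝ k)
      (intervalIntegrable_heatOp h.l_nonneg hl ht g)
    simp only [innerSL_apply_apply] at h3 h4
    rw [real_inner_comm, ← real_inner_comm] at *
    rw [← h3, real_inner_comm, ← h4]
    refine intervalIntegral.integral_congr fun s hs => ?_
    rw [Set.uIcc_of_le ht] at hs
    rw [← heatOp_symm hl hs.1, real_inner_comm]
  rw [inner_neg_left, ← h2, h1, inner_sub_left, inner_sub_left, heatOp_symm hl ht,
    real_inner_comm f k, real_inner_comm f (G.heatOp U t k)]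
  ring

/-- On the domain, `P_t f - f` is minus a time integral of `P_s g`, whose average tends to `g`.
Conversely, if the difference quotient converges, closedness is applied to the averages of `P_s f`
over `[0, 1/(k+1)]`, which lie in the domain and tend to `f`. -/
theorem Coercive.generates (h : G.Coercive U l C) : G.Generates U (G.heatOp U) where
  zero := heatOp_zero h.lowerBound
  add _ _ hs ht := heatOp_add h.lowerBound hs ht
  cont := continuousOn_heatOp h.l_nonneg h.lowerBound
  gen f g := by
    constructor
    · intro hfg
      refine (h.tendsto_integral g).neg.congr' ?_
      filter_upwards [self_mem_nhdsWithin] with t ht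
      rw [h.heatOp_sub_eq hfg (le_of_lt ht), smul_neg]
    · intro hlim
      have ht : Tendsto (fun k : ℕ => 1 / ((k : ℝ) + 1)) atTop (𝓝[>] 0) :=
        tendsto_nhdsWithin_iff.2 ⟨tendsto_one_div_add_atTop_nhds_zero_nat,
          Eventually.of_forall fun k => Set.mem_Ioi.2 (by positivity)⟩
      refine h.isSchrodinger_of_tendsto
        (u := fun k : ℕ => (1 / ((k : ℝ) + 1))⁻¹ • ∫ s in (0 : ℝ)..(1 / ((k : ℝ) + 1)),
          G.heatOp U s f)
        (g := fun k : ℕ => (1 / ((k : ℝ) + 1))⁻¹ • (f - G.heatOp U (1 / ((k : ℝ) + 1)) f))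
        (fun k => ?_) ((h.tendsto_integral f).comp ht) ?_
      · exact (h.isSchrodinger_integral (by positivity) f).smul _
      · have := (hlim.comp ht).neg
        rw [neg_neg] at this
        refine this.congr fun k => ?_
        simp only [Function.comp_apply]
        rw [← smul_neg, neg_sub]

/-! ### Uniqueness of the generated semigroup -/

variable {S R : ℝ → Lp ℝ 2 G.vol →L[ℝ] Lp ℝ 2 G.vol}

theorem Generates.isSchrodinger_apply (hS : G.Generates U S) {f g : Lp ℝ 2 G.vol}
    (hfg : G.IsSchrodinger U f g) {t : ℝ} (ht : 0 ≤ t) : G.IsSchrodinger U (S t f) (S t g) := by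
  rw [hS.gen]
  have h1 := ((S t).continuous.tendsto (-g)).comp ((hS.gen f g).1 hfg)
  rw [map_neg] at h1
  refine h1.congr' ?_
  filter_upwards [self_mem_nhdsWithin] with s hs
  have hs' : 0 ≤ s := le_of_lt hs
  rw [Function.comp_apply, map_smul, map_sub, ← ContinuousLinearMap.comp_apply,
    ← ContinuousLinearMap.comp_apply, ← hS.add t s ht hs', ← hS.add s t hs' ht, add_comm]

theorem Generates.hasDerivWithinAt (hS : G.Generates U S) {f g : Lp ℝ 2 G.vol}
    (hfg : G.IsSchrodinger U f g) {t : ℝ} (ht : 0 ≤ t) :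
    HasDerivWithinAt (fun s => S s f) (-S t g) (Set.Ici t) t := by
  rw [← hasDerivWithinAt_Ioi_iff_Ici, hasDerivWithinAt_iff_tendsto_slope' (by simp)]
  have h1 := (hS.gen _ _).1 (hS.isSchrodinger_apply hfg ht)
  have h2 : Tendsto (fun s : ℝ => s - t) (𝓝[>] t) (𝓝[>] 0) := by
    refine tendsto_nhdsWithin_iff.2 ⟨?_, ?_⟩
    · have : Tendsto (fun s : ℝ => s - t) (𝓝 t) (𝓝 (t - t)) :=
        (continuous_id.sub continuous_const).continuousAt
      rw [sub_self] at this
      exact this.mono_left nhdsWithin_le_nhds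
    · filter_upwards [self_mem_nhdsWithin] with s hs using Set.mem_Ioi.2 (sub_pos.2 (Set.mem_Ioi.1 hs))
  refine (h1.comp h2).congr' ?_
  filter_upwards [self_mem_nhdsWithin] with s hs
  rw [Function.comp_apply, slope_def_module, ← ContinuousLinearMap.comp_apply,
    ← hS.add _ _ (sub_nonneg.2 (le_of_lt hs)) ht, sub_add_cancel]

/-- For `f` in the domain the difference `u` of two orbits stays in the domain, and the lower bound
makes `exp(-2ls) ‖u s‖²` nonincreasing from `0`. Only right derivatives are available, hence the
liminf-slope form of the mean value inequality. Averages of the flow show that the domain is dense.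
-/
theorem Coercive.unique (h : G.Coercive U l C) (hS : G.Generates U S) (hR : G.Generates U R)
    {t : ℝ} (ht : 0 ≤ t) : S t = R t := by
  have hdom : ∀ f g, G.IsSchrodinger U f g → S t f = R t f := by
    intro f g hfg
    set u : ℝ → Lp ℝ 2 G.vol := fun s => S s f - R s f with hu
    have hud : ∀ s, 0 ≤ s → HasDerivWithinAt u (-(S s g - R s g)) (Set.Ici s) s := fun s hs =>
      ((hS.hasDerivWithinAt hfg hs).sub (hR.hasDerivWithinAt hfg hs)).congr_deriv (by abel)
    set N : ℝ → ℝ := fun s => Real.exp (-(2 * l * s)) * ‖u s‖ ^ 2 with hN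
    have hNd : ∀ s, 0 ≤ s → HasDerivWithinAt N (Real.exp (-(2 * l * s)) * (-(2 * l)) * ‖u s‖ ^ 2
        + Real.exp (-(2 * l * s)) * (2 * inner ℝ (u s) (-(S s g - R s g)))) (Set.Ici s) s := by
      intro s hs
      refine HasDerivWithinAt.mul (HasDerivAt.hasDerivWithinAt (HasDerivAt.exp ?_))
        (hud s hs).norm_sq
      simpa using ((hasDerivAt_id s).const_mul (2 * l)).fun_neg
    have hNc : ContinuousOn N (Set.Icc 0 t) := by
      have hc : ContinuousOn u (Set.Icc 0 t) :=
        ((hS.cont f).sub (hR.cont f)).mono Set.Icc_subset_Ici_self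
      have he : Continuous fun s : ℝ => Real.exp (-(2 * l * s)) := by fun_prop
      exact he.continuousOn.mul (hc.norm.pow 2)
    have hle : N t ≤ 0 := by
      refine image_le_of_liminf_slope_right_le_deriv_boundary (B := fun _ => 0) (B' := fun _ => 0)
        hNc ?_ continuousOn_const (fun s _ => hasDerivWithinAt_const _ _ _)
        (fun s hs r hr => (hNd s hs.1).liminf_right_slope_le (lt_of_le_of_lt ?_ hr))
        (Set.right_mem_Icc.2 ht)
      · simp [hN, hu, hS.zero, hR.zero]
      · have hsch : G.IsSchrodinger U (u s) (S s g - R s g) :=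
          (hS.isSchrodinger_apply hfg hs.1).sub (hR.isSchrodinger_apply hfg hs.1)
        have h1 : G.schroForm U (u s) (u s) = G.ip (S s g - R s g : Lp ℝ 2 G.vol) (u s) :=
          hsch.2 _ hsch.1
        have h2 := h.schroForm_lower hsch.1
        rw [h1, ← inner_Lp, ← inner_Lp, real_inner_self_eq_norm_sq] at h2
        rw [inner_neg_right, real_inner_comm]
        have h3 := mul_le_mul_of_nonneg_left h2 (Real.exp_pos (-(2 * l * s))).le
        linarith
    have h1 : ‖u t‖ ^ 2 ≤ 0 := nonpos_of_mul_nonpos_right hle (Real.exp_pos _)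
    have h2 : u t = 0 := by
      rw [← norm_eq_zero]
      exact pow_eq_zero_iff two_ne_zero |>.1 (le_antisymm h1 (sq_nonneg _))
    exact sub_eq_zero.1 h2
  ext1 f
  have h1 := h.tendsto_integral f
  refine tendsto_nhds_unique (((S t).continuous.tendsto f).comp h1)
    ((((R t).continuous.tendsto f).comp h1).congr' ?_)
  filter_upwards [self_mem_nhdsWithin] with s hs
  exact (hdom _ _ ((h.isSchrodinger_integral (le_of_lt hs) f).smul s⁻¹)).symm

theorem Coercive.generates_semigroup (h : G.Coercive U l C) : G.Generates U (G.semigroup U) := by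
  have hex : ∃ S, G.Generates U S := ⟨_, h.generates⟩
  rw [semigroup, dif_pos hex]
  exact hex.choose_spec

/-- `semigroup` is obtained by choice; uniqueness is what gives it the explicit minimal kernel. -/
theorem Coercive.kernel_eq (h : G.Coercive U l C) {t : ℝ} (ht : 0 ≤ t) (x y : V) :
    G.kernel U t x y = G.minKernel U t x y := by
  rw [← heatOp_delta h.lowerBound ht, ← h.unique h.generates_semigroup h.generates ht]
  rfl

end

section

variable {V : Type*} {G : MWG V} {U W : V → ℝ} {F : Finset V} {T κ : ℝ}

/-! ### Consequences of a Kato bound on finite sets -/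

variable (G) in
/-- The time integrated heat flow of `W` up to time `T` is bounded by `κ`, on every finite set. -/
def KatoBound (T : ℝ) (W : V → ℝ) (κ : ℝ) : Prop :=
  ∀ (F : Finset V) (x : V), ∀ t ∈ Set.Icc 0 T, G.heatInt 0 F t W x ≤ κ

theorem hasDerivAt_heatInt (t : ℝ) (f : V → ℝ) (x : V) :
    HasDerivAt (fun s => G.heatInt U F s f x) (G.heat U F t f x) t :=
  ((continuous_heat f x).integral_hasStrictDerivAt 0 t).hasDerivAt

theorem heatInt_nonneg {t : ℝ} (ht : 0 ≤ t) {f : V → ℝ} (hf : ∀ x, 0 ≤ f x) (x : V) :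
    0 ≤ G.heatInt U F t f x :=
  intervalIntegral.integral_nonneg ht fun _ hs => heat_nonneg hs.1 (fun y _ => hf y) x

theorem heatInt_zero (f : V → ℝ) (x : V) : G.heatInt U F 0 f x = 0 :=
  intervalIntegral.integral_same

theorem heatInt_smul (t c : ℝ) (f : V → ℝ) (x : V) :
    G.heatInt U F t (c • f) x = c * G.heatInt U F t f x := by
  simp [heatInt, heat_smul]

theorem KatoBound.const_smul (h : G.KatoBound T W κ) {c : ℝ} (hc : 0 ≤ c) :
    G.KatoBound T (c • W) (c * κ) := fun F x t ht => by
  rw [heatInt_smul]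
  exact mul_le_mul_of_nonneg_left (h F x t ht) hc

variable (G) in
/-- The supersolution `1 + b ∫₀ᵗ P_s W ds`. -/
def katoSuper (F : Finset V) (W : V → ℝ) (b t : ℝ) : V → ℝ :=
  (fun _ => 1) + b • G.heatInt 0 F t W

theorem katoSuper_apply (b t : ℝ) (x : V) :
    G.katoSuper F W b t x = 1 + b * G.heatInt 0 F t W x := rfl

theorem one_le_katoSuper (hW : ∀ x, 0 ≤ W x) {b t : ℝ} (hb : 0 ≤ b) (ht : 0 ≤ t) (x : V) :
    1 ≤ G.katoSuper F W b t x := by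
  rw [katoSuper_apply]
  linarith [mul_nonneg hb (heatInt_nonneg (G := G) (U := 0) (F := F) ht hW x)]

theorem hasDerivAt_katoSuper (b t : ℝ) {x : V} (hx : x ∈ F) :
    HasDerivAt (fun s => G.katoSuper F W b s x) (G.lap (G.katoSuper F W b t) x + b * W x) t := by
  refine (((hasDerivAt_heatInt t W x).const_mul b).const_add 1).congr_deriv ?_
  have h1 := lap_heatInt (G := G) (U := 0) t W hx
  rw [katoSuper, lap_add, lap_const, lap_smul]
  simp only [Pi.zero_apply, zero_mul, add_zero] at h1
  linear_combination b * h1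

/-- The value `b = θ / (1 - θκ)` is chosen self-consistently: `1 + bκ = 1 / (1 - θκ) = b / θ` when
`θ > 0`. Hence `b ≥ θ g`, and the source `bW` of `g` dominates `θ W g`. -/
theorem KatoBound.katoSuper_le (h : G.KatoBound T W κ) {θ : ℝ} (hθ : 0 ≤ θ) (hθκ : θ * κ < 1)
    {t : ℝ} (ht : t ∈ Set.Icc 0 T) (x : V) :
    G.katoSuper F W (θ / (1 - θ * κ)) t x ≤ 1 / (1 - θ * κ) := by
  have h1 : 0 < 1 - θ * κ := by linarith
  rw [katoSuper_apply, div_mul_eq_mul_div, le_div_iff₀ h1, add_mul, div_mul_cancel₀ _ h1.ne']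
  linarith [mul_le_mul_of_nonneg_left (h F x t ht) hθ]

/-- **Khasminskii's lemma**, up to time `T`. -/
theorem KatoBound.heat_one_le (h : G.KatoBound T W κ) (hW : ∀ x, 0 ≤ W x) (hκ : κ < 1) {a : ℝ}
    (hU : ∀ x, a - W x ≤ U x) {t : ℝ} (ht : t ∈ Set.Icc 0 T) (x : V) :
    G.heat U F t (fun _ => 1) x ≤ Real.exp (-(a * t)) * (1 / (1 - κ)) := by
  have h1 : (1 : ℝ) * κ < 1 := by linarith
  have hb : 0 ≤ 1 / (1 - 1 * κ) := div_nonneg zero_le_one (by linarith)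
  set g := G.katoSuper F W (1 / (1 - 1 * κ)) with hg
  have hg1 : ∀ s ∈ Set.Icc 0 T, ∀ y, 1 ≤ g s y := fun s hs y => one_le_katoSuper hW hb hs.1 y
  have hgle : ∀ s ∈ Set.Icc 0 T, ∀ y, g s y ≤ 1 / (1 - 1 * κ) := fun s hs y =>
    h.katoSuper_le zero_le_one h1 hs y
  have key : G.heat U F t (fun _ => 1) x ≤ Real.exp (-(a * t)) * g t x := by
    -- The factor `exp(-as)` absorbs the constant `a`, and the source term of `g` pays for the
    -- deficit `W` in `U ≥ a - W`.
    refine heat_le_of_supersolution (T := T) (v := fun s => Real.exp (-(a * s)) • g s)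
      (v' := fun s y => Real.exp (-(a * s)) * (-a) * g s y
        + Real.exp (-(a * s)) * (G.lap (g s) y + 1 / (1 - 1 * κ) * W y)) ?_ ?_ ?_ ?_ ht x
    · intro s hs y _
      exact mul_nonneg (Real.exp_pos _).le (zero_le_one.trans (hg1 s hs y))
    · intro s _ y hy
      refine HasDerivAt.mul (HasDerivAt.exp ?_) (hasDerivAt_katoSuper _ s hy)
      simpa using ((hasDerivAt_id s).const_mul a).fun_neg
    · intro s hs y _
      rw [lap_smul, Pi.smul_apply, smul_eq_mul]
      have h2 : 0 ≤ (U y - (a - W y)) * g s y :=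
        mul_nonneg (sub_nonneg.2 (hU y)) (zero_le_one.trans (hg1 s hs y))
      have h3 : 0 ≤ (1 / (1 - 1 * κ) - g s y) * W y :=
        mul_nonneg (sub_nonneg.2 (hgle s hs y)) (hW y)
      have h4 := mul_nonneg (Real.exp_pos (-(a * s))).le (add_nonneg h2 h3)
      linarith
    · intro y _
      simp [hg, katoSuper_apply, heatInt_zero]
  refine key.trans (mul_le_mul_of_nonneg_left ?_ (Real.exp_pos _).le)
  simpa using hgle t ht x

/-- **Khasminskii's lemma**, for all times. -/
theorem KatoBound.heat_one_le_pow (h : G.KatoBound T W κ) (hT : 0 ≤ T) (hW : ∀ x, 0 ≤ W x)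
    (hκ0 : 0 ≤ κ) (hκ : κ < 1) {a : ℝ} (hU : ∀ x, a - W x ≤ U x) (n : ℕ) {t : ℝ} (ht0 : 0 ≤ t)
    (ht : t ≤ (n + 1) * T) (x : V) :
    G.heat U F t (fun _ => 1) x ≤ Real.exp (-(a * t)) * (1 / (1 - κ)) ^ (n + 1) := by
  have hc : 1 ≤ 1 / (1 - κ) := by
    rw [le_div_iff₀ (by linarith)]
    linarith
  induction n generalizing t x with
  | zero =>
    rw [zero_add, pow_one]
    exact h.heat_one_le hW hκ hU ⟨ht0, by simpa using ht⟩ x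
  | succ n ih =>
    rcases le_total t ((n + 1) * T) with h1 | h1
    · refine (ih ht0 h1 x).trans (mul_le_mul_of_nonneg_left ?_ (Real.exp_pos _).le)
      exact pow_le_pow_right₀ hc (Nat.le_succ _)
    · have hTt : T ≤ t := (le_mul_of_one_le_left hT (by linarith [Nat.cast_nonneg (α := ℝ) n])).trans h1
      have h2 : t - T ≤ (n + 1) * T := by
        push_cast at ht
        linarith
      set A := Real.exp (-(a * T)) * (1 / (1 - κ)) with hA
      have hA0 : 0 ≤ A := mul_nonneg (Real.exp_pos _).le (zero_le_one.trans hc)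
      -- One block of length `T` is peeled off: its flow of `1` is at most the constant `A`, and
      -- positivity and linearity reduce to the remaining time.
      calc G.heat U F t (fun _ => 1) x
          = G.heat U F (t - T) (G.heat U F T fun _ => 1) x := by
            rw [← heat_comp, sub_add_cancel]
        _ ≤ G.heat U F (t - T) (A • fun _ => 1) x := by
            refine heat_le_heat (sub_nonneg.2 hTt) (fun y _ => ?_) x
            change _ ≤ A * 1
            rw [mul_one]
            exact h.heat_one_le hW hκ hU ⟨hT, le_rfl⟩ y
        _ = A * G.heat U F (t - T) (fun _ => 1) x := by
            rw [heat_smul]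
            rfl
        _ ≤ A * (Real.exp (-(a * (t - T))) * (1 / (1 - κ)) ^ (n + 1)) :=
            mul_le_mul_of_nonneg_left (ih (sub_nonneg.2 hTt) h2 x) hA0
        _ = _ := by
            rw [hA, show -(a * t) = -(a * T) + -(a * (t - T)) by ring, Real.exp_add]
            ring

/-- **Picone's inequality.** -/
theorem sum_neg_lap_mul_le_Q {H : V → ℝ} (hH : ∀ x, 0 < H x) {φ : V → ℝ} (hφ : φ.support.Finite) :
    ∑ x ∈ hφ.toFinset, G.m x * (-G.lap H x * (φ x ^ 2 / H x)) ≤ G.Q φ φ := by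
  rw [← G.Q_eq_sum H (φ := fun x => φ x ^ 2 / H x) fun x hx => by
    simp [notMem_support_toFinset hφ x hx], Q, Q]
  refine mul_le_mul_of_nonneg_left ?_ (by norm_num)
  refine Summable.tsum_le_tsum (fun p => mul_le_mul_of_nonneg_left ?_ (G.w_nonneg _ _))
    (G.summable_w_mul_of_finite hφ fun p h1 h2 => by simp [h1, h2])
    (G.summable_w_mul_of_finite hφ fun p h1 h2 => by simp [h1, h2])
  have h1 := hH p.1
  have h2 := hH p.2
  have h3 : (φ p.1 - φ p.2) * (φ p.1 - φ p.2)
      - (H p.1 - H p.2) * (φ p.1 ^ 2 / H p.1 - φ p.2 ^ 2 / H p.2)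
      = (φ p.1 * H p.2 - φ p.2 * H p.1) ^ 2 / (H p.1 * H p.2) := by
    field_simp
    ring
  have h4 : 0 ≤ (φ p.1 * H p.2 - φ p.2 * H p.1) ^ 2 / (H p.1 * H p.2) := by positivity
  linarith

/-- A Kato bound makes `W` form bounded with respect to `Q`. -/
theorem KatoBound.form_le (h : G.KatoBound T W κ) (hT : 0 < T) (hW : ∀ x, 0 ≤ W x) {θ ω : ℝ}
    (hθ : 0 ≤ θ) (hθκ : θ * κ < 1) (hω : 1 ≤ Real.exp (ω * T) * (1 - θ * κ)) {φ : V → ℝ}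
    (hφ : φ.support.Finite) :
    θ * G.ip (fun x => W x * φ x) φ ≤ G.Q φ φ + ω * G.ip φ φ := by
  set F := hφ.toFinset
  have hpos : 0 < 1 - θ * κ := by linarith
  set b := θ / (1 - θ * κ) with hbdef
  have hb : 0 ≤ b := div_nonneg hθ hpos.le
  set g := G.katoSuper F W b with hg
  set e : ℝ → ℝ := fun s => Real.exp (-(ω * s)) with he
  have hecont : Continuous e := by fun_prop
  have hgcont : ∀ x, Continuous fun s => g s x := fun x => by
    have : Continuous fun s => G.heatInt 0 F s W x :=
      continuous_iff_continuousAt.2 fun s => (hasDerivAt_heatInt s W x).continuousAt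
    exact continuous_const.add (this.const_mul b)
  set u : ℝ → V → ℝ := fun s => e s • g s with hu
  have hucont : ∀ x, Continuous fun s => u s x := fun x => hecont.mul (hgcont x)
  have huint : ∀ x, IntervalIntegrable (fun s => u s x) volume 0 T := fun x =>
    (hucont x).intervalIntegrable 0 T
  -- The ground state substitute for Picone's inequality: integrating `exp(-ωs) g s` in time removes
  -- the time derivative up to boundary terms, leaving `-Δ H ≥ (θW - ω) H` on the support of `φ`.
  set H : V → ℝ := fun x => ∫ s in (0 : ℝ)..T, u s x with hHdef
  have hupos : ∀ x, ∀ s ∈ Set.Icc 0 T, 0 < u s x := fun x s hs =>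
    mul_pos (Real.exp_pos _) (zero_lt_one.trans_le (one_le_katoSuper hW hb hs.1 x))
  have hH : ∀ x, 0 < H x := fun x =>
    intervalIntegral.intervalIntegral_pos_of_pos_on (huint x)
      (fun s hs => hupos x s (Set.Ioo_subset_Icc_self hs)) hT
  have hkey : ∀ x ∈ F, (θ * W x - ω) * H x ≤ -G.lap H x := by
    intro x hx
    have hd : ∀ s, HasDerivAt (fun s => u s x)
        (e s * (-ω) * g s x + e s * (G.lap (g s) x + b * W x)) s := fun s => by
      refine HasDerivAt.mul (HasDerivAt.exp ?_) (hasDerivAt_katoSuper _ s hx)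
      simpa using ((hasDerivAt_id s).const_mul ω).fun_neg
    have hlapc : Continuous fun s => G.lap (g s) x := by
      simp only [lap_eq_sum]
      exact continuous_finsetSum _ fun y _ => ((hgcont y).sub (hgcont x)).const_mul _
    have hdc : Continuous fun s => e s * (-ω) * g s x + e s * (G.lap (g s) x + b * W x) :=
      ((hecont.mul continuous_const).mul (hgcont x)).add
        (hecont.mul (hlapc.add continuous_const))
    have hftc := intervalIntegral.integral_eq_sub_of_hasDerivAt (fun s _ => hd s)
      (hdc.intervalIntegrable 0 T)
    have hu0 : u 0 x = 1 := by simp [hu, he, hg, katoSuper_apply, heatInt_zero]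
    -- The hypothesis on `ω` is exactly what makes `u T ≤ 1 = u 0`, so the boundary terms have the
    -- favourable sign.
    have huT : u T x ≤ 1 := by
      have h1 : g T x ≤ 1 / (1 - θ * κ) := h.katoSuper_le hθ hθκ ⟨hT.le, le_rfl⟩ x
      rw [le_div_iff₀ hpos] at h1
      have h2 : u T x * Real.exp (ω * T) = g T x := by
        simp only [hu, he, Pi.smul_apply, smul_eq_mul]
        rw [mul_right_comm, ← Real.exp_add, neg_add_cancel, Real.exp_zero, one_mul]
      have h3 := hupos x T ⟨hT.le, le_rfl⟩
      rw [← h2] at h1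
      nlinarith
    have hmono : ∫ s in (0 : ℝ)..T, (G.lap (u s) x + (θ * W x - ω) * u s x)
        ≤ ∫ s in (0 : ℝ)..T, (e s * (-ω) * g s x + e s * (G.lap (g s) x + b * W x)) := by
      refine intervalIntegral.integral_mono_on hT.le
        ((intervalIntegrable_lap huint x).add ((huint x).const_mul _))
        (hdc.intervalIntegrable 0 T) fun s hs => ?_
      have h1 : g s x ≤ 1 / (1 - θ * κ) := h.katoSuper_le hθ hθκ hs x
      have h2 : 0 ≤ e s * (W x * (θ * (1 / (1 - θ * κ) - g s x))) :=
        mul_nonneg (Real.exp_pos _).le (mul_nonneg (hW x) (mul_nonneg hθ (sub_nonneg.2 h1)))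
      have h3 : b = θ * (1 / (1 - θ * κ)) := by rw [hbdef]; ring
      simp only [hu, lap_smul, Pi.smul_apply, smul_eq_mul]
      rw [h3]
      linarith
    rw [intervalIntegral.integral_add (intervalIntegrable_lap huint x) ((huint x).const_mul _),
      intervalIntegral.integral_const_mul, ← lap_integral huint, hftc, hu0] at hmono
    change G.lap H x + (θ * W x - ω) * H x ≤ _ at hmono
    linarith
  have hoff := notMem_support_toFinset hφ
  refine le_trans ?_ (add_le_add_left (sum_neg_lap_mul_le_Q hH hφ) _)
  rw [ip_eq_sum G _ hoff, ip_eq_sum G _ hoff, Finset.mul_sum, Finset.mul_sum,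
    ← Finset.sum_add_distrib]
  refine Finset.sum_le_sum fun x hx => ?_
  have h1 := mul_le_mul_of_nonneg_right (hkey x hx)
    (mul_nonneg (G.m_pos x).le (div_nonneg (sq_nonneg (φ x)) (hH x).le))
  have h2 : (θ * W x - ω) * H x * (G.m x * (φ x ^ 2 / H x)) = (θ * W x - ω) * (G.m x * φ x ^ 2) := by
    have := (hH x).ne'
    field_simp
  rw [h2] at h1
  linarith

theorem Q_self_nonneg (f : V → ℝ) : 0 ≤ G.Q f f :=
  mul_nonneg (by norm_num) (tsum_nonneg fun p =>
    mul_nonneg (G.w_nonneg _ _) (mul_self_nonneg _))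

theorem ip_self_nonneg (f : V → ℝ) : 0 ≤ G.ip f f :=
  tsum_nonneg fun x => mul_nonneg (G.m_pos x).le (mul_self_nonneg _)

theorem tsum_emb_sq_eq {φ : V → ℝ} (hφ : φ.support.Finite) :
    ∑' i, G.emb U φ i ^ 2
      = G.ip φ φ + G.ip (fun x => |U x| * φ x) φ + G.Q φ φ := by
  have hoff := notMem_support_toFinset hφ
  rw [G.tsum_emb_sq (G.memℓp_emb_of_finite U hφ), ip_eq_sum G _ hoff, ip_eq_sum G _ hoff, Q,
    ← tsum_mul_left, ← Finset.sum_add_distrib]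
  congr 1
  · rw [tsum_eq_sum fun x hx => by rw [hoff x hx]; ring]
    exact Finset.sum_congr rfl fun x _ => by ring
  · exact tsum_congr fun p => by ring

/-- From `U ≥ -W` follows `|U| ≤ U + 2W`, and the form bound with `θ = 2` absorbs `2W` into `Q + ω`.
It also gives `U ≥ -(Q + ω) / 2`, so the slack left by the factor `4` is nonnegative. -/
theorem KatoBound.coercive (h : G.KatoBound T W κ) (hT : 0 < T) (hW : ∀ x, 0 ≤ W x) {a ω : ℝ}
    (ha : 0 ≤ a) (hω0 : 0 ≤ ω) (hκ : 2 * κ < 1) (hω : 1 ≤ Real.exp (ω * T) * (1 - 2 * κ))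
    (hU : ∀ x, a - W x ≤ U x) : G.Coercive U (1 + ω) 4 where
  l_nonneg := by linarith
  C_pos := by norm_num
  le φ hφ := by
    have hoff := notMem_support_toFinset hφ
    have h1 := h.form_le hT hW zero_le_two hκ hω hφ
    have hQ := Q_self_nonneg (G := G) φ
    have hip := ip_self_nonneg (G := G) φ
    have hm : ∀ x, 0 ≤ G.m x * φ x ^ 2 := fun x => mul_nonneg (G.m_pos x).le (sq_nonneg _)
    rw [tsum_emb_sq_eq hφ, schroForm]
    have h2 : G.ip (fun x => |U x| * φ x) φ
        ≤ G.ip (fun x => U x * φ x) φ + 2 * G.ip (fun x => W x * φ x) φ := by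
      rw [ip_eq_sum G _ hoff, ip_eq_sum G _ hoff, ip_eq_sum G _ hoff, Finset.mul_sum,
        ← Finset.sum_add_distrib]
      refine Finset.sum_le_sum fun x _ => ?_
      have h3 : |U x| ≤ U x + 2 * W x := by
        rw [abs_le]
        constructor <;> linarith [hU x, hW x]
      linarith [mul_le_mul_of_nonneg_right h3 (hm x)]
    have h4 : -G.ip (fun x => W x * φ x) φ ≤ G.ip (fun x => U x * φ x) φ := by
      rw [ip_eq_sum G _ hoff, ip_eq_sum G _ hoff, ← Finset.sum_neg_distrib]
      refine Finset.sum_le_sum fun x _ => ?_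
      have h3 : -W x ≤ U x := by linarith [hU x]
      linarith [mul_le_mul_of_nonneg_right h3 (hm x)]
    have h5 := mul_nonneg hω0 hip
    linarith

theorem coercive_zero : G.Coercive 0 1 1 where
  l_nonneg := zero_le_one
  C_pos := zero_lt_one
  le φ hφ := by
    rw [tsum_emb_sq_eq hφ, schroForm]
    simp [ip]
    linarith

end

section

variable {V : Type*} {G : MWG V} {U W : V → ℝ} {F : Finset V} {T κ l : ℝ}

/-! ### Row sums of the minimal kernel -/

theorem sum_minKernel_le (hl : G.LowerBound U l) {t : ℝ} (ht : 0 ≤ t) {B : ℝ} {x : V}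
    (hB : ∀ F : Finset V, G.heat U F t (fun _ => 1) x ≤ B) (s : Finset V) :
    ∑ y ∈ s, G.minKernel U t x y ≤ B := by
  classical
  refine le_of_tendsto (tendsto_finsetSum s fun y _ => tendsto_dirKernel hl ht x y)
    (Eventually.of_forall fun F => ?_)
  calc ∑ y ∈ s, G.dirKernel U F t x y ≤ ∑ y ∈ s ∪ F, G.dirKernel U F t x y :=
        Finset.sum_le_sum_of_subset_of_nonneg Finset.subset_union_left
          fun y _ _ => dirKernel_nonneg ht x y
    _ = ∑ y ∈ F, G.dirKernel U F t x y :=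
        (Finset.sum_subset Finset.subset_union_right fun y _ hy => dirKernel_notMem_right hy).symm
    _ = G.heat U F t (fun _ => 1) x := by simp [heat_eq_sum]
    _ ≤ B := hB F

theorem heat_zero_one_le {t : ℝ} (ht : 0 ≤ t) (x : V) : G.heat 0 F t (fun _ => 1) x ≤ 1 :=
  heat_le_of_supersolution (T := t) (v := fun _ _ => 1) (v' := fun _ _ => 0)
    (fun _ _ _ _ => zero_le_one) (fun _ _ _ _ => hasDerivAt_const _ _)
    (fun _ _ _ _ => by simp [lap_const]) (fun _ _ => le_rfl) ⟨ht, le_rfl⟩ x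

variable [Countable V] [MeasurableSpace V] [DiscreteMeasurableSpace V]

theorem enorm_le_eLpNorm_top (f : V → ℝ) (x : V) : ‖f x‖ₑ ≤ eLpNorm f ∞ G.vol := by
  rw [eLpNorm_exponent_top]
  exact (G.ae_vol_iff.1 (ae_le_eLpNormEssSup (f := f) (μ := G.vol))) x

/-- The Kato constant controls the time integrated Dirichlet heat flow on finite sets. -/
theorem katoBound_of_kato_le (hκ : 0 ≤ κ) (hW : ∀ x, 0 ≤ W x)
    (h : G.kato T W ≤ ENNReal.ofReal κ) : G.KatoBound T W κ := by
  intro F x t ht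
  have hl := (coercive_zero (G := G)).lowerBound
  -- On the finite set `F` the truncation at a large `j` is inert, so a single member of the
  -- supremum defining the Kato constant suffices.
  obtain ⟨j, hj⟩ : ∃ j : ℕ, ∀ y ∈ F, W y ≤ j := by
    obtain ⟨j, hj⟩ := exists_nat_ge (∑ y ∈ F, W y)
    exact ⟨j, fun y hy => (Finset.single_le_sum (fun z _ => hW z) hy).trans hj⟩
  have hpt : ∀ s, 0 ≤ s → ENNReal.ofReal (G.heat 0 F s W x)
      ≤ eLpNorm (G.act 0 s fun y => min (j : ℝ) (W y)) ∞ G.vol := by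
    intro s hs
    refine le_trans ?_ (enorm_le_eLpNorm_top _ x)
    have hnn : ∀ y, 0 ≤ G.minKernel 0 s x y * min (j : ℝ) (W y) := fun y =>
      mul_nonneg (minKernel_nonneg hl hs x y) (le_min (Nat.cast_nonneg j) (hW y))
    have hact : G.act 0 s (fun y => min (j : ℝ) (W y)) x
        = ∑' y, G.minKernel 0 s x y * min (j : ℝ) (W y) :=
      tsum_congr fun y => by
        rw [(coercive_zero (G := G)).kernel_eq hs]
    have hrow : Summable fun y => G.minKernel 0 s x y :=
      summable_of_sum_le (minKernel_nonneg hl hs x)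
        (sum_minKernel_le hl hs fun F => heat_zero_one_le hs x)
    have hsum : Summable fun y => G.minKernel 0 s x y * min (j : ℝ) (W y) :=
      Summable.of_nonneg_of_le hnn (fun y => mul_le_mul_of_nonneg_left (min_le_left _ _)
        (minKernel_nonneg hl hs x y)) (hrow.mul_right (j : ℝ))
    rw [hact, Real.enorm_of_nonneg (tsum_nonneg hnn)]
    refine ENNReal.ofReal_le_ofReal ?_
    rw [heat_eq_sum]
    refine (Finset.sum_le_sum fun y hy => ?_).trans (hsum.sum_le_tsum F fun y _ => hnn y)
    rw [min_eq_right (hj y hy)]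
    exact mul_le_mul_of_nonneg_right (dirKernel_le_minKernel hl hs F x y) (hW y)
  have hint : Integrable (fun s => G.heat 0 F s W x) (volume.restrict (Set.Ioc 0 t)) :=
    (intervalIntegrable_iff_integrableOn_Ioc_of_le ht.1).1 (intervalIntegrable_heat W x 0 t)
  have hnn : 0 ≤ᵐ[volume.restrict (Set.Ioc 0 t)] fun s => G.heat 0 F s W x := by
    filter_upwards [ae_restrict_mem measurableSet_Ioc] with s hs
    exact heat_nonneg hs.1.le (fun y _ => hW y) x
  rw [← ENNReal.ofReal_le_ofReal_iff hκ, heatInt, intervalIntegral.integral_of_le ht.1,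
    ofReal_integral_eq_lintegral_ofReal hint hnn]
  calc ∫⁻ s in Set.Ioc 0 t, ENNReal.ofReal (G.heat 0 F s W x)
      ≤ ∫⁻ s in Set.Ioc 0 T, ENNReal.ofReal (G.heat 0 F s W x) :=
        lintegral_mono_set (Set.Ioc_subset_Ioc_right ht.2)
    _ ≤ ∫⁻ s in Set.Ioc 0 T, eLpNorm (G.act 0 s fun y => min (j : ℝ) (W y)) ∞ G.vol := by
        refine setLIntegral_mono' measurableSet_Ioc fun s hs => hpt s hs.1.le
    _ ≤ G.kato T W := le_iSup (fun j : ℕ =>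
        ∫⁻ s in Set.Ioc 0 T, eLpNorm (G.act 0 s fun y => min (j : ℝ) (W y)) ∞ G.vol) j
    _ ≤ ENNReal.ofReal κ := h

/-! ### The Schur test -/

/-- The measure on `V` whose point masses are a row of a kernel. -/
def rowMeasure (k : V → V → ℝ) (x : V) : Measure V :=
  Measure.sum fun y => ENNReal.ofReal (k x y) • Measure.dirac y

theorem lintegral_rowMeasure (k : V → V → ℝ) (x : V) (f : V → ℝ≥0∞) :
    ∫⁻ y, f y ∂rowMeasure k x = ∑' y, ENNReal.ofReal (k x y) * f y := by
  rw [rowMeasure, lintegral_sum_measure]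
  congr 1
  ext y
  rw [lintegral_smul_measure, lintegral_dirac, smul_eq_mul]

/-- **Schur test**: a nonnegative kernel, symmetric with respect to `m` and with row sums at most
`C`, acts on every `L^p` with norm at most `C`. -/
theorem schur_test {k : V → V → ℝ} (hk : ∀ x y, 0 ≤ k x y)
    (hsymm : ∀ x y, G.m x * k x y = G.m y * k y x) {C : ℝ} (hC : 0 < C)
    (hrow : ∀ x (s : Finset V), ∑ y ∈ s, k x y ≤ C) {p : ℝ≥0∞} (hp : 1 ≤ p) {f : V → ℝ}
    (hf : MemLp f p G.vol) :
    (∀ x, Summable fun y => k x y * f y) ∧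
      eLpNorm (fun x => ∑' y, k x y * f y) p G.vol ≤ ENNReal.ofReal C * eLpNorm f p G.vol := by
  set A : V → ℝ≥0∞ := fun x => ∑' y, ENNReal.ofReal (k x y) * ‖f y‖ₑ with hA
  have hrow' : ∀ x, ∑' y, ENNReal.ofReal (k x y) ≤ ENNReal.ofReal C := fun x => by
    rw [ENNReal.tsum_eq_iSup_sum]
    refine iSup_le fun s => ?_
    rw [← ENNReal.ofReal_sum_of_nonneg fun y _ => hk x y]
    exact ENNReal.ofReal_le_ofReal (hrow x s)
  have henorm : ∀ x y, ENNReal.ofReal (k x y) * ‖f y‖ₑ = ‖k x y * f y‖ₑ := fun x y => by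
    rw [enorm_mul, Real.enorm_of_nonneg (hk x y)]
  have hsummable : ∀ x, A x ≠ ∞ → Summable fun y => k x y * f y := fun x hx => by
    simp only [hA, henorm] at hx
    exact Summable.of_enorm hx
  have hle : ∀ x, ‖∑' y, k x y * f y‖ₑ ≤ A x := fun x => by
    simp only [hA, henorm]
    exact enorm_tsum_le_tsum_enorm
  have hmass : ∀ x, rowMeasure k x Set.univ ≤ ENNReal.ofReal C := fun x => by
    rw [← setLIntegral_one, Measure.restrict_univ, lintegral_rowMeasure]
    simpa using hrow' x
  rcases eq_or_ne p ∞ with rfl | hp_top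
  · have hA_le : ∀ x, A x ≤ ENNReal.ofReal C * eLpNorm f ∞ G.vol := fun x => by
      calc A x ≤ ∑' y, ENNReal.ofReal (k x y) * eLpNorm f ∞ G.vol :=
            ENNReal.tsum_le_tsum fun y => mul_le_mul_right (enorm_le_eLpNorm_top f y) _
        _ ≤ _ := by
            rw [ENNReal.tsum_mul_right]
            exact mul_le_mul_left (hrow' x) _
    refine ⟨fun x => hsummable x (ne_top_of_le_ne_top
      (ENNReal.mul_ne_top ENNReal.ofReal_ne_top hf.2.ne) (hA_le x)), ?_⟩
    rw [eLpNorm_exponent_top]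
    exact essSup_le_of_ae_le _ (Eventually.of_forall fun x => (hle x).trans (hA_le x))
  · set r := p.toReal with hr
    have hr1 : 1 ≤ r := by
      rw [hr, ← ENNReal.toReal_one]
      exact ENNReal.toReal_mono hp_top hp
    have hr0 : 0 < r := zero_lt_one.trans_le hr1
    have hC0 : ENNReal.ofReal C ≠ 0 := (ENNReal.ofReal_pos.2 hC).ne'
    -- Hölder's inequality on the row measure, of total mass at most `C`, yields the factor `C ^ (r
    -- - 1)`. The last factor `C` comes from the column sums, which symmetry turns into row sums.
    have hpow : ∀ x, A x ^ r
        ≤ (∑' y, ENNReal.ofReal (k x y) * ‖f y‖ₑ ^ r) * ENNReal.ofReal C ^ (r - 1) := fun x => by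
      have h1 := eLpNorm'_le_eLpNorm'_mul_rpow_measure_univ (μ := rowMeasure k x) zero_lt_one hr1
        (measurable_of_countable f).aestronglyMeasurable
      simp only [eLpNorm', lintegral_rowMeasure, ENNReal.rpow_one, div_one] at h1
      have h2 := ENNReal.rpow_le_rpow h1 hr0.le
      rw [ENNReal.mul_rpow_of_nonneg _ _ hr0.le, ← ENNReal.rpow_mul, ← ENNReal.rpow_mul,
        one_div_mul_cancel hr0.ne', ENNReal.rpow_one, sub_mul, one_div_mul_cancel hr0.ne',
        one_mul] at h2
      exact h2.trans (mul_le_mul_right (ENNReal.rpow_le_rpow (hmass x) (by linarith)) _)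
    have hint : ∫⁻ x, A x ^ r ∂G.vol
        ≤ ENNReal.ofReal C ^ r * ∫⁻ x, ‖f x‖ₑ ^ r ∂G.vol := by
      have hswap : ∀ x y, ENNReal.ofReal (G.m x) * (ENNReal.ofReal (k x y) * ‖f y‖ₑ ^ r)
          = ENNReal.ofReal (G.m y) * ‖f y‖ₑ ^ r * ENNReal.ofReal (k y x) := fun x y => by
        rw [← mul_assoc, ← ENNReal.ofReal_mul (G.m_pos x).le, hsymm,
          ENNReal.ofReal_mul (G.m_pos y).le]
        ring
      calc ∫⁻ x, A x ^ r ∂G.vol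
          ≤ ∫⁻ x, (∑' y, ENNReal.ofReal (k x y) * ‖f y‖ₑ ^ r)
              * ENNReal.ofReal C ^ (r - 1) ∂G.vol := lintegral_mono hpow
        _ = (∑' x, ∑' y, ENNReal.ofReal (G.m x) * (ENNReal.ofReal (k x y) * ‖f y‖ₑ ^ r))
              * ENNReal.ofReal C ^ (r - 1) := by
            rw [lintegral_vol, ← ENNReal.tsum_mul_right]
            simp_rw [ENNReal.tsum_mul_left, mul_assoc]
        _ ≤ (∑' y, ENNReal.ofReal (G.m y) * ‖f y‖ₑ ^ r * ENNReal.ofReal C)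
              * ENNReal.ofReal C ^ (r - 1) := by
            refine mul_le_mul_left ?_ _
            rw [ENNReal.tsum_comm]
            refine ENNReal.tsum_le_tsum fun y => ?_
            simp_rw [hswap, ENNReal.tsum_mul_left]
            exact mul_le_mul_right (hrow' y) _
        _ = ENNReal.ofReal C ^ r * ∫⁻ x, ‖f x‖ₑ ^ r ∂G.vol := by
            have h1 : ENNReal.ofReal C ^ r
                = ENNReal.ofReal C * ENNReal.ofReal C ^ (r - 1) := by
              have h2 := ENNReal.rpow_add 1 (r - 1) hC0 ENNReal.ofReal_ne_top
              rwa [add_sub_cancel, ENNReal.rpow_one] at h2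
            rw [lintegral_vol, ENNReal.tsum_mul_right, h1]
            ring
    have hfr : ∫⁻ x, ‖f x‖ₑ ^ r ∂G.vol ≠ ∞ :=
      (lintegral_rpow_enorm_lt_top_of_eLpNorm_lt_top (zero_lt_one.trans_le hp).ne' hp_top hf.2).ne
    have hAfin : ∫⁻ x, A x ^ r ∂G.vol ≠ ∞ := ne_top_of_le_ne_top
      (ENNReal.mul_ne_top (ENNReal.rpow_ne_top_of_nonneg hr0.le ENNReal.ofReal_ne_top) hfr) hint
    refine ⟨fun x => hsummable x fun hx => ?_, ?_⟩
    · rw [lintegral_vol] at hAfin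
      refine ENNReal.ne_top_of_tsum_ne_top hAfin x ?_
      rw [hx, ENNReal.top_rpow_of_pos hr0, ENNReal.mul_top (ENNReal.ofReal_pos.2 (G.m_pos x)).ne']
    · rw [eLpNorm_eq_lintegral_rpow_enorm_toReal (zero_lt_one.trans_le hp).ne' hp_top,
        eLpNorm_eq_lintegral_rpow_enorm_toReal (zero_lt_one.trans_le hp).ne' hp_top, ← hr]
      calc _ ≤ (ENNReal.ofReal C ^ r * ∫⁻ x, ‖f x‖ₑ ^ r ∂G.vol) ^ (1 / r) :=
            ENNReal.rpow_le_rpow ((lintegral_mono fun x =>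
              ENNReal.rpow_le_rpow (hle x) hr0.le).trans hint) (by positivity)
        _ = _ := by
            rw [ENNReal.mul_rpow_of_nonneg _ _ (by positivity), ← ENNReal.rpow_mul,
              mul_one_div_cancel hr0.ne', ENNReal.rpow_one]

/-! ### The main estimates -/

theorem Coercive.opNormLE {C' : ℝ} (h : G.Coercive U l C') {t : ℝ} (ht : 0 ≤ t) {C : ℝ} (hC : 0 < C)
    (hrow : ∀ x (F : Finset V), G.heat U F t (fun _ => 1) x ≤ C) {p : ℝ≥0∞} (hp : 1 ≤ p) :
    G.OpNormLE U t p C := by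
  refine ⟨hC.le, fun f hf => ?_⟩
  have h1 := schur_test (fun x y => minKernel_nonneg h.lowerBound ht x y)
    (fun x y => minKernel_symm h.lowerBound ht x y) hC
    (fun x s => sum_minKernel_le h.lowerBound ht (hrow x) s) hp hf
  have h2 : G.act U t f = fun x => ∑' y, G.minKernel U t x y * f y :=
    funext fun x => tsum_congr fun y => by rw [h.kernel_eq ht]
  rw [h2]
  refine ⟨fun x => (h1.1 x).congr fun y => ?_, h1.2⟩
  rw [h.kernel_eq ht]

/-- The constants in the exponential Kato condition. -/
theorem KatoBound.main {a : ℝ} (ha : 0 < a) (hT : 0 < T) (hW : ∀ x, 0 ≤ W x)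
    (hU : ∀ x, a - W x ≤ U x)
    (h : G.KatoBound T W (1 / 2 * (1 - Real.exp (-(a * T / 4))))) :
    G.Coercive U (1 + a / 4) 4 ∧
      (∀ φ : V → ℝ, φ.support.Finite →
        2 * G.ip (fun x => W x * φ x) φ ≤ G.Q φ φ + a / 4 * G.ip φ φ) ∧
      ∀ t : ℝ, 0 ≤ t → ∀ (x : V) (F : Finset V),
        G.heat U F t (fun _ => 1) x ≤ Real.exp (a * (T - t) / 2) := by
  set q := Real.exp (-(a * T / 4)) with hq
  have hq0 : 0 < q := Real.exp_pos _
  have hq1 : q ≤ 1 := Real.exp_le_one_iff.2 (by have := mul_pos ha hT; linarith)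
  have hκ0 : 0 ≤ 1 / 2 * (1 - q) := by linarith
  have h2κ : 2 * (1 / 2 * (1 - q)) < 1 := by linarith
  -- The threshold gives `1 - 2κ = q = exp(-aT/4)`, so `ω = a/4` satisfies the requirement with
  -- equality.
  have hω : 1 ≤ Real.exp (a / 4 * T) * (1 - 2 * (1 / 2 * (1 - q))) := by
    have h1 : 1 - 2 * (1 / 2 * (1 - q)) = q := by ring
    rw [h1, hq, ← Real.exp_add, show a / 4 * T + -(a * T / 4) = 0 by ring, Real.exp_zero]
  refine ⟨h.coercive hT hW ha.le (by positivity) h2κ hω hU,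
    fun φ hφ => h.form_le hT hW zero_le_two h2κ hω hφ, fun t ht x F => ?_⟩
  have hn := Nat.floor_le (div_nonneg ht hT.le)
  have hn' := (Nat.lt_floor_add_one (t / T)).le
  rw [div_le_iff₀ hT] at hn'
  rw [le_div_iff₀ hT] at hn
  refine (h.heat_one_le_pow hT.le hW hκ0 (by linarith) hU ⌊t / T⌋₊ ht hn' x).trans ?_
  -- Here `1 - κ = (1 + q) / 2`, which is at least `q²` because `0 < q ≤ 1`; and `q² = exp(-aT/2)`.
  have hc : 1 / (1 - 1 / 2 * (1 - q)) ≤ Real.exp (a * T / 2) := by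
    have h1 : q * q ≤ 1 - 1 / 2 * (1 - q) := by nlinarith
    have h2 : Real.exp (a * T / 2) * (q * q) = 1 := by
      rw [hq, ← Real.exp_add, ← Real.exp_add,
        show a * T / 2 + (-(a * T / 4) + -(a * T / 4)) = 0 by ring, Real.exp_zero]
    rw [div_le_iff₀ (by linarith)]
    exact h2.symm.le.trans (mul_le_mul_of_nonneg_left h1 (Real.exp_pos _).le)
  calc _ ≤ Real.exp (-(a * t)) * Real.exp (a * T / 2) ^ (⌊t / T⌋₊ + 1) :=
        mul_le_mul_of_nonneg_left (pow_le_pow_left₀ (div_nonneg zero_le_one (by linarith)) hc _)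
          (Real.exp_pos _).le
    _ ≤ _ := by
        rw [← Real.exp_nat_mul, ← Real.exp_add]
        -- With `⌊t/T⌋ * T ≤ t` the exponent is at most `-at + a(t + T)/2 = a(T - t)/2`; the
        -- additional block produces the constant `aT/2`.
        refine Real.exp_le_exp.2 ?_
        push_cast
        nlinarith

end

end MWG

end

theorem mainTheorem10 {V : Type*} [Countable V] [MeasurableSpace V] [DiscreteMeasurableSpace V]
    (G : MWG V) (K T : ℝ) (hK : 0 < K) (hT : 0 < T) (n : ℝ≥0∞) (hn : 0 < n) (ρ : V → ℝ)
    (hCD : G.CD ρ n) :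
    (G.kato T (fun x => (ρ x - K)⁻) ≤ ENNReal.ofReal (1 / 2 * (1 - Real.exp (-(K * T / 4)))) →
      G.SpectrallyPositive (K / 2) n ρ ∧
      G.Generates ρ (G.semigroup ρ) ∧
      (∀ t : ℝ, 0 < t → ∀ p : ℝ≥0∞, 1 ≤ p → ∃ C : ℝ, G.OpNormLE ρ t p C) ∧
      (∀ t : ℝ, 0 < t → G.OpNormLE ρ t ∞ (Real.exp (K * (T - t) / 2)))) ∧
    (G.kato T (fun x => (ρ x - K)⁻) ≤ ENNReal.ofReal (1 / 4 * (1 - Real.exp (-(K * T / 2)))) →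
      G.Generates (fun x => 2 * ρ x) (G.semigroup (fun x => 2 * ρ x)) ∧
      (∀ t : ℝ, 0 < t →
        G.OpNormLE (fun x => 2 * ρ x) t ∞ (Real.exp (K * (T - t))))) := by
  have hW : ∀ x, 0 ≤ (ρ x - K)⁻ := fun x => negPart_nonneg _
  have hlow : ∀ x, K - (ρ x - K)⁻ ≤ ρ x := fun x => by
    have := neg_le_negPart (ρ x - K)
    linarith
  have hexp : ∀ s : ℝ, 0 < s → Real.exp (-s) ≤ 1 := fun s hs =>
    Real.exp_le_one_iff.2 (by linarith)
  constructor
  · intro hkato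
    have hκ : 0 ≤ 1 / 2 * (1 - Real.exp (-(K * T / 4))) := by
      have := hexp (K * T / 4) (by positivity)
      linarith
    obtain ⟨hco, hform, hrow⟩ := (MWG.katoBound_of_kato_le hκ hW hkato).main hK hT hW hlow
    refine ⟨⟨hCD, fun φ hφ => ?_⟩, hco.generates_semigroup, fun t ht p hp =>
      ⟨_, hco.opNormLE ht.le (Real.exp_pos _) (hrow t ht.le) hp⟩, fun t ht =>
      hco.opNormLE ht.le (Real.exp_pos _) (hrow t ht.le) le_top⟩
    have hoff := MWG.notMem_support_toFinset hφ
    have h1 := hform φ hφ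
    have hip := MWG.ip_self_nonneg (G := G) φ
    have h2 : G.ip (fun x => -G.lap φ x) φ = G.Q φ φ := by
      rw [G.Q_eq_sum φ hoff, G.ip_eq_sum _ hoff]
    have h3 : K * G.ip φ φ - G.ip (fun x => (ρ x - K)⁻ * φ x) φ
        ≤ G.ip (fun x => ρ x * φ x) φ := by
      rw [G.ip_eq_sum _ hoff, G.ip_eq_sum _ hoff, G.ip_eq_sum _ hoff, Finset.mul_sum,
        ← Finset.sum_sub_distrib]
      refine Finset.sum_le_sum fun x _ => ?_
      have := mul_le_mul_of_nonneg_right (hlow x)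
        (mul_nonneg (G.m_pos x).le (sq_nonneg (φ x)))
      linarith
    rw [h2]
    -- Half of the form bound reads `Q/2 - W ≥ -K/8`, so together with `ρ ≥ K - W` the form is at
    -- least `7K/8`, more than the required `K/2`.
    nlinarith
  · intro hkato
    have hκ : 0 ≤ 1 / 4 * (1 - Real.exp (-(K * T / 2))) := by
      have := hexp (K * T / 2) (by positivity)
      linarith
    -- The second part is the first estimate for `2ρ ≥ 2K - 2W`: doubling `W` doubles the Kato
    -- bound, and `a = 2K` matches the threshold.
    have hkb := (MWG.katoBound_of_kato_le hκ hW hkato).const_smul zero_le_two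
    rw [show 2 * (1 / 4 * (1 - Real.exp (-(K * T / 2))))
      = 1 / 2 * (1 - Real.exp (-(2 * K * T / 4))) by ring_nf] at hkb
    obtain ⟨hco, -, hrow⟩ := hkb.main (U := fun x => 2 * ρ x) (a := 2 * K) (by positivity) hT
      (fun x => mul_nonneg zero_le_two (hW x)) fun x => by
        change 2 * K - 2 * (ρ x - K)⁻ ≤ 2 * ρ x
        linarith [hlow x]
    refine ⟨hco.generates_semigroup, fun t ht => ?_⟩
    rw [show K * (T - t) = 2 * K * (T - t) / 2 by ring]
    exact hco.opNormLE ht.le (Real.exp_pos _) (hrow t ht.le) le_top
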